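/- Let $p$ be a prime and let $(\mathcal T,\mathcal G)$ be a tree of finite groups: $\mathcal T$ is a tree, each vertex $v$ and each edge $e$ carries a finite group $\mathcal G(v)$, $\mathcal G(e)$, and for each vertex $v$ on an edge $e$ there is an injective homomorphism $\mathcal G(e)\to\mathcal G(v)$. Let $\mathcal G_{\mathcal T}$ be its completion, i.e. the colimit of $\mathcal G$ (the free product of the vertex groups modulo the identifications given by the edge groups). Let $\tilde{\mathcal T}$ be the orbit graph: its vertices are the left cosets $g\mathcal G(v)$, its edges are the left cosets $g\mathcal G(e)$ ($g\in\mathcal G_{\mathcal T}$), and $g\mathcal G(e)$ with $e=(v,w)$ joins $g\mathcal G(v)$ and $g\mathcal G(w)$; $\mathcal G_{\mathcal T}$ acts on it by left multiplication. For each vertex $v$ let $\mathcal S(v)$ be a Sylow $p$-subgroup of $\mathcal G(v)$. Assume that there is a vertex $v_*$ such that for every vertex $v\neq v_*$ we have $p\nmid|\mathcal G(v):\mathcal G(e)|$, where $e$ is the edge incident to $v$ in the unique minimal path from $v$ to $v_*$. Put $S:=\mathcal S(v_*)$, regarded as a subgroup of $\mathcal G_{\mathcal T}$, and for a group $G$ with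 a finite $p$-subgroup $R$ let $\mathcal F_R(G)$ be the fusion system on $R$ whose morphisms are the homomorphisms between subgroups of $R$ induced by conjugation in $G$. Assume that for each $P\le S$: (a) if $P$ is $\mathcal G_{\mathcal T}$-conjugate to an $\mathcal F_{\mathcal S(v)}(\mathcal G(v))$-essential subgroup for some vertex $v$, then $P$ is $\mathcal F_S(\mathcal G_{\mathcal T})$-centric; and (b) if $P$ is $\mathcal F_S(\mathcal G_{\mathcal T})$-centric, then $\tilde{\mathcal T}^P/C_{\mathcal G_{\mathcal T}}(P)$ is a tree, where $\tilde{\mathcal T}^P$ is the subgraph of $\tilde{\mathcal T}$ fixed by $P$, and the quotient is the (multi)graph whose vertices and edges are the orbits of vertices and edges. Then $\mathcal F_S(\mathcal G_{\mathcal T})$ is saturated. Here, for a fusion system $\mathcal F$ on a finite $p$-group $R$, a subgroup $P\le R$ is $\mathcal F$-centric if $C_R(Q)=Z(Q)$ for every $\mathcal F$-conjugate $Q$ of $P$, and $\mathcal F$-essential if it is $\mathcal F$-centric and $\operatorname{Out}_{\mathcal F}(P)=\operatorname{Aut}_{\mathcal F}(P)/\operatorname{Inn}(P)$ has a strongly $p$-embedded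 subgroup; a subgroup $H$ of a finite group $G$ is strongly $p$-embedded if $H<G$, $H$ contains a Sylow $p$-subgroup of $G$, and $H\cap H^g$ is a $p'$-group for each $g\in G\setminus H$. (It is not required that $p$ divides $|H|$; in particular $\mathcal S(v)$ itself is $\mathcal F_{\mathcal S(v)}(\mathcal G(v))$-essential as soon as $\operatorname{Out}_{\mathcal G(v)}(\mathcal S(v))\neq1$.) The system $\mathcal F$ is saturated if every fully $\mathcal F$-normalised $P\le R$ is fully $\mathcal F$-centralised and satisfies $\operatorname{Aut}_R(P)\in\operatorname{Syl}_p(\operatorname{Aut}_{\mathcal F}(P))$, and if every $\varphi\in\operatorname{Hom}_{\mathcal F}(P,R)$ with $P\varphi$ fully $\mathcal F$-centralised extends to a morphism in $\operatorname{Hom}_{\mathcal F}(N_\varphi,R)$, where $N_\varphi=\{g\in N_R(P)\mid \varphi^{-1}c_g\varphi\in\operatorname{Aut}_R(P\varphi)\}$ (maps written on the right). -/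

import Mathlib

universe u₁ u₂ u₃

set_option linter.checkUnivs false

/-! ### Fusion systems -/

/-- The image `Pφ ≤ S` of a homomorphism `φ : P → Q` between subgroups of `S`. -/
def imageIn {S : Type*} [Group S] {P Q : Subgroup S} (φ : P →* Q) : Subgroup S :=
  (Q.subtype.comp φ).range

/-- A fusion system on a group `S` (used for finite `p`-groups `S` only): a category whose objects
are the subgroups of `S`, whose morphisms are injective homomorphisms, which contains all maps
`x ↦ s⁻¹ x s` with `s ∈ S`, and in which every morphism factorises as an isomorphism of the
category onto its image followed by an inclusion. -/
structure FusionSystem (S : Type*) [Group S] where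
  Hom : (P Q : Subgroup S) → Set (P →* Q)
  conj_mem : ∀ {P Q : Subgroup S} (φ : P →* Q) (s : S),
    (∀ x : P, (φ x : S) = s⁻¹ * (x : S) * s) → φ ∈ Hom P Q
  injective : ∀ {P Q : Subgroup S} (φ : P →* Q), φ ∈ Hom P Q → Function.Injective φ
  comp_mem : ∀ {P Q R : Subgroup S} (φ : P →* Q) (ψ : Q →* R),
    φ ∈ Hom P Q → ψ ∈ Hom Q R → ψ.comp φ ∈ Hom P R
  factor : ∀ {P Q : Subgroup S} (φ : P →* Q), φ ∈ Hom P Q →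
    ∃ α : P ≃* imageIn φ, (∀ x : P, (α x : S) = φ x) ∧
      α.toMonoidHom ∈ Hom P (imageIn φ) ∧ α.symm.toMonoidHom ∈ Hom (imageIn φ) P

/-- The fusion system `F_S(G)` on the subgroup `S` of `G`: the morphisms are the homomorphisms
between subgroups of `S` that are induced by conjugation by elements of `G`. -/
def groupFusion (G : Type*) [Group G] (S : Subgroup G) : FusionSystem S where
  Hom P Q := {φ | ∃ g : G, ∀ x : P, ((φ x : S) : G) = g⁻¹ * ((x : S) : G) * g}
  conj_mem φ s h := ⟨s, fun x => by simpa using congrArg (Subtype.val : S → G) (h x)⟩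
  injective φ := by
    rintro ⟨g, hg⟩ x y hxy
    have h := hg x
    rw [hxy, hg y] at h
    exact (Subtype.ext (Subtype.ext (mul_left_cancel (mul_right_cancel h)))).symm
  comp_mem φ ψ := by
    rintro ⟨g, hg⟩ ⟨k, hk⟩
    refine ⟨g * k, fun x => ?_⟩
    rw [MonoidHom.comp_apply, hk, hg]
    group
  factor {P Q} φ := by
    rintro ⟨g, hg⟩
    have hinj : Function.Injective (Q.subtype.comp φ) := by
      intro x y hxy
      have hxy' : φ x = φ y := Subtype.ext hxy
      have h := hg x
      rw [hxy', hg y] at h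
      exact (Subtype.ext (Subtype.ext (mul_left_cancel (mul_right_cancel h)))).symm
    obtain ⟨α, hα⟩ : ∃ α : P ≃* imageIn φ, ∀ x : P, (α x : S) = φ x :=
      ⟨MonoidHom.ofInjective hinj, fun x => rfl⟩
    refine ⟨α, hα, ⟨g, fun x => ?_⟩, ⟨g⁻¹, fun y => ?_⟩⟩
    · rw [MulEquiv.toMonoidHom_eq_coe, MonoidHom.coe_coe, hα, hg]
    · obtain ⟨x, rfl⟩ := α.surjective y
      rw [MulEquiv.toMonoidHom_eq_coe, MonoidHom.coe_coe, α.symm_apply_apply, hα, hg]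
      group

/-- `G` has a strongly `p`-embedded subgroup: a proper subgroup `H` that contains a Sylow
`p`-subgroup of `G` and such that `H ∩ H^g` is a `p'`-group for every `g ∈ G ∖ H`, where
`H^g = g⁻¹ H g`. It is not required that `p` divides the order of `H`. -/
def HasStronglyEmbedded (p : ℕ) (G : Type*) [Group G] : Prop :=
  ∃ H : Subgroup G, H < ⊤ ∧ (∃ Q : Sylow p G, (Q : Subgroup G) ≤ H) ∧
    ∀ g : G, g ∉ H → ¬ p ∣ Nat.card ↥(H ⊓ H.map (MulAut.conj g⁻¹).toMonoidHom)

/-- `Inn(P)`, as a subgroup of `Aut(P)`. -/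
def innerAut (P : Type*) [Group P] : Subgroup (MulAut P) := (MulAut.conj (G := P)).range

instance innerAut_normal (P : Type*) [Group P] : (innerAut P).Normal where
  conj_mem := by
    rintro _ ⟨x, rfl⟩ α
    refine ⟨α x, ?_⟩
    ext y
    simp [MulAut.conj_apply]

namespace FusionSystem

variable {S : Type*} [Group S] (F : FusionSystem S)

/-- `P` and `Q` are `F`-conjugate. -/
def Conj (P Q : Subgroup S) : Prop :=
  ∃ φ : P ≃* Q, φ.toMonoidHom ∈ F.Hom P Q ∧ φ.symm.toMonoidHom ∈ F.Hom Q P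

/-- `Aut_F(P)`. -/
def aut (P : Subgroup S) : Subgroup (MulAut P) where
  carrier := {α | α.toMonoidHom ∈ F.Hom P P ∧ α.symm.toMonoidHom ∈ F.Hom P P}
  mul_mem' {a b} ha hb :=
    ⟨F.comp_mem _ _ hb.1 ha.1, F.comp_mem _ _ ha.2 hb.2⟩
  one_mem' := ⟨F.conj_mem _ 1 fun x => by simp,
    F.conj_mem _ 1 fun x => by rw [inv_one, one_mul, mul_one]; rfl⟩
  inv_mem' {a} ha := ⟨ha.2, ha.1⟩

/-- `Out_F(P) = Aut_F(P) / Inn(P)`. -/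
abbrev Out (P : Subgroup S) : Type _ := F.aut P ⧸ (innerAut P).subgroupOf (F.aut P)

/-- `Aut_S(P)`: the automorphisms of `P` induced by conjugation by elements of `S`. -/
def autS (P : Subgroup S) : Subgroup (MulAut P) where
  carrier := {α | ∃ s : S, ∀ x : P, (α x : S) = s⁻¹ * (x : S) * s}
  mul_mem' := by
    rintro a b ⟨s, hs⟩ ⟨t, ht⟩
    refine ⟨t * s, fun x => ?_⟩
    rw [MulAut.mul_apply, hs, ht]
    group
  one_mem' := ⟨1, fun x => by simp⟩
  inv_mem' := by
    rintro a ⟨s, hs⟩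
    refine ⟨s⁻¹, fun x => ?_⟩
    have h := hs (a⁻¹ x)
    rw [MulAut.apply_inv_self] at h
    rw [h]
    group

/-- `P` is fully `F`-normalised. -/
def FullyNormalised (P : Subgroup S) : Prop :=
  ∀ R : Subgroup S, F.Conj P R →
    Nat.card (Subgroup.normalizer (R : Set S)) ≤ Nat.card (Subgroup.normalizer (P : Set S))

/-- `P` is fully `F`-centralised. -/
def FullyCentralised (P : Subgroup S) : Prop :=
  ∀ R : Subgroup S, F.Conj P R →
    Nat.card (Subgroup.centralizer (R : Set S)) ≤ Nat.card (Subgroup.centralizer (P : Set S))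

/-- `P` is fully `F`-automised: `Aut_S(P)` is a Sylow `p`-subgroup of `Aut_F(P)`. -/
def FullyAutomised (p : ℕ) (P : Subgroup S) : Prop :=
  ∃ Q : Sylow p (F.aut P), (Q : Subgroup (F.aut P)) = (autS P).subgroupOf (F.aut P)

/-- `N_φ`: the elements `g ∈ N_S(P)` such that `φ⁻¹ ∘ c_g ∘ φ` (maps written on the right) is the
conjugation `c_h` by some `h ∈ N_S(Pφ)`. -/
def extender {P : Subgroup S} (φ : P →* (⊤ : Subgroup S)) : Subgroup S where
  carrier := {g | g ∈ Subgroup.normalizer (P : Set S) ∧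
    ∃ h ∈ Subgroup.normalizer (imageIn φ : Set S), ∀ x y : P, (y : S) = g⁻¹ * (x : S) * g →
      (φ y : S) = h⁻¹ * (φ x : S) * h}
  mul_mem' := by
    rintro a b ⟨ha, h, hh, hah⟩ ⟨hb, k, hk, hbk⟩
    refine ⟨mul_mem ha hb, h * k, mul_mem hh hk, fun x y hxy => ?_⟩
    have hz : a⁻¹ * (x : S) * a ∈ P := (Subgroup.mem_normalizer_iff''.1 ha _).1 x.2
    rw [hbk ⟨_, hz⟩ y (by rw [hxy]; group), hah x ⟨_, hz⟩ rfl]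
    group
  one_mem' := ⟨one_mem _, 1, one_mem _, fun x y hxy => by
    have : y = x := Subtype.ext (by simpa using hxy)
    simp [this]⟩
  inv_mem' := by
    rintro a ⟨ha, h, hh, hah⟩
    refine ⟨inv_mem ha, h⁻¹, inv_mem hh, fun x y hxy => ?_⟩
    rw [hah y x (by rw [hxy]; group)]
    group

theorem le_extender {P : Subgroup S} (φ : P →* (⊤ : Subgroup S)) : P ≤ extender φ := by
  intro g hg
  refine ⟨Subgroup.le_normalizer hg, φ ⟨g, hg⟩, Subgroup.le_normalizer ⟨⟨g, hg⟩, rfl⟩,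
    fun x y hxy => ?_⟩
  have : y = (⟨g, hg⟩ : P)⁻¹ * x * ⟨g, hg⟩ := Subtype.ext hxy
  simp [this]

/-- `F` is saturated (at the prime `p`). -/
def IsSaturated (p : ℕ) : Prop :=
  (∀ P : Subgroup S, F.FullyNormalised P → F.FullyCentralised P ∧ F.FullyAutomised p P) ∧
  ∀ (P : Subgroup S) (φ : P →* (⊤ : Subgroup S)), φ ∈ F.Hom P ⊤ →
    F.FullyCentralised (imageIn φ) →
    ∃ ψ ∈ F.Hom (extender φ) ⊤, ψ.comp (Subgroup.inclusion (le_extender φ)) = φ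

/-- `P` is `F`-centric: `C_S(Q) = Z(Q)`, that is `C_S(Q) ≤ Q`, for every `F`-conjugate `Q` of
`P`. -/
def IsCentric (P : Subgroup S) : Prop :=
  ∀ Q : Subgroup S, F.Conj P Q → Subgroup.centralizer (Q : Set S) ≤ Q

/-- `P` is `F`-essential: it is `F`-centric and `Out_F(P)` has a strongly `p`-embedded
subgroup. -/
def IsEssential (p : ℕ) (P : Subgroup S) : Prop :=
  F.IsCentric P ∧ HasStronglyEmbedded p (F.Out P)

end FusionSystem

/-! ### Graphs: trees and quotients -/

/-- The barycentric subdivision of a multigraph: its vertices are the vertices and the edges of `Γ`,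
and an edge of `Γ` is joined to its end vertices. -/
def Graph.subdivision {α β : Type*} (Γ : Graph α β) : SimpleGraph (Γ.vertexSet ⊕ Γ.edgeSet) :=
  SimpleGraph.fromRel fun a b =>
    ∃ (x : Γ.vertexSet) (e : Γ.edgeSet), a = Sum.inl x ∧ b = Sum.inr e ∧ Γ.Inc (e : β) (x : α)

/-- A multigraph is a tree if it has no loops and its barycentric subdivision is a tree. (Two
parallel edges give a cycle of length four in the subdivision.) -/
def Graph.IsMultiTree {α β : Type*} (Γ : Graph α β) : Prop :=
  (∀ (e : β) (x : α), ¬ Γ.IsLink e x x) ∧ Γ.subdivision.IsTree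

/-- The quotient of a multigraph `Γ` by a group `H` acting on it: its vertices and edges are the
`H`-orbits of vertices and of edges of `Γ`, with the induced incidence. -/
def Graph.orbitQuotient {α β : Type*} (H : Type*) [Group H] [MulAction H α] [MulAction H β]
    (Γ : Graph α β)
    (hΓ : ∀ (h : H) (e : β) (x y : α), Γ.IsLink e x y → Γ.IsLink (h • e) (h • x) (h • y)) :
    Graph (MulAction.orbitRel.Quotient H α) (MulAction.orbitRel.Quotient H β) where
  vertexSet := {a | ∃ x ∈ Γ.vertexSet, Quotient.mk'' x = a}
  IsLink ε a b := ∃ (e : β) (x y : α), Γ.IsLink e x y ∧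
    Quotient.mk'' e = ε ∧ Quotient.mk'' x = a ∧ Quotient.mk'' y = b
  isLink_symm := by
    intro ε _
    refine ⟨?_⟩
    rintro a b ⟨e, x, y, h, he, hx, hy⟩
    exact ⟨e, y, x, h.symm, he, hy, hx⟩
  eq_or_eq_of_isLink_of_isLink := by
    rintro ε a b c d ⟨e, x, y, h, rfl, rfl, rfl⟩ ⟨e', x', y', h', he', rfl, rfl⟩
    obtain ⟨k, hk⟩ : e' ∈ MulAction.orbit H e := MulAction.orbitRel_apply.1 (Quotient.exact he')
    have hk' : k • e = e' := hk
    have h2 := hΓ k e x y h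
    rw [hk'] at h2
    have hx : (Quotient.mk'' x : MulAction.orbitRel.Quotient H α) = Quotient.mk'' (k • x) :=
      (Quotient.sound (MulAction.orbitRel_apply.2 ⟨k, rfl⟩)).symm
    rcases h2.left_eq_or_eq h' with h3 | h3
    · exact Or.inl (by rw [hx, h3])
    · exact Or.inr (by rw [hx, h3])
  left_mem_of_isLink := by
    rintro ε a b ⟨e, x, y, h, -, rfl, -⟩
    exact ⟨x, h.left_mem, rfl⟩

/-! ### Trees of groups -/

/-- A tree of groups over the tree `T`: a group for each vertex and each edge of `T`, and for each
edge `e` and each vertex `v` on `e` an injective homomorphism from the group of `e` to the group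
of `v`. -/
structure TreeOfGroups {V : Type u₁} (T : SimpleGraph V) where
  isTree : T.IsTree
  vertexGroup : V → Type u₂
  edgeGroup : T.edgeSet → Type u₃
  [vertexGroupInst : ∀ v, Group (vertexGroup v)]
  [edgeGroupInst : ∀ e, Group (edgeGroup e)]
  hom : ∀ (e : T.edgeSet) (v : V), v ∈ (e : Sym2 V) → edgeGroup e →* vertexGroup v
  hom_injective : ∀ (e : T.edgeSet) (v : V) (h : v ∈ (e : Sym2 V)), Function.Injective (hom e v h)

namespace TreeOfGroups

attribute [instance] TreeOfGroups.vertexGroupInst TreeOfGroups.edgeGroupInst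

variable {V : Type u₁} {T : SimpleGraph V} (𝒢 : TreeOfGroups.{u₁, u₂, u₃} T)

/-- The relators of the completion: the two images of an element of an edge group in the free
product of the vertex groups are identified. -/
def relators : Set (Monoid.CoprodI 𝒢.vertexGroup) :=
  {r | ∃ (e : T.edgeSet) (v w : V) (hv : v ∈ (e : Sym2 V)) (hw : w ∈ (e : Sym2 V))
    (x : 𝒢.edgeGroup e),
    r = Monoid.CoprodI.of (𝒢.hom e v hv x) * (Monoid.CoprodI.of (𝒢.hom e w hw x))⁻¹}

/-- The completion (colimit in the category of groups) of the tree of groups: the free product of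
the vertex groups modulo the relations given by the edge groups. -/
def Completion : Type (max u₁ u₂) :=
  Monoid.CoprodI 𝒢.vertexGroup ⧸ Subgroup.normalClosure 𝒢.relators

instance : Group 𝒢.Completion :=
  inferInstanceAs (Group (Monoid.CoprodI 𝒢.vertexGroup ⧸ Subgroup.normalClosure 𝒢.relators))

/-- The canonical homomorphism from a vertex group to the completion. -/
def vertexMap (v : V) : 𝒢.vertexGroup v →* 𝒢.Completion :=
  (QuotientGroup.mk' (Subgroup.normalClosure 𝒢.relators)).comp Monoid.CoprodI.of

/-- The canonical homomorphism from an edge group to the completion (through either end of the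
edge, see `edgeMap_apply`). -/
noncomputable def edgeMap (e : T.edgeSet) : 𝒢.edgeGroup e →* 𝒢.Completion :=
  (𝒢.vertexMap (e : Sym2 V).out.1).comp (𝒢.hom e (e : Sym2 V).out.1 (Sym2.out_fst_mem _))

theorem edgeMap_apply (e : T.edgeSet) (v : V) (hv : v ∈ (e : Sym2 V)) (x : 𝒢.edgeGroup e) :
    𝒢.edgeMap e x = 𝒢.vertexMap v (𝒢.hom e v hv x) := by
  refine ((QuotientGroup.eq (s := Subgroup.normalClosure 𝒢.relators)).2 ?_).symm
  have h : (Monoid.CoprodI.of (𝒢.hom e v hv x⁻¹) *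
      (Monoid.CoprodI.of (𝒢.hom e _ (Sym2.out_fst_mem (e : Sym2 V)) x⁻¹))⁻¹ :
      Monoid.CoprodI 𝒢.vertexGroup) ∈ Subgroup.normalClosure 𝒢.relators :=
    Subgroup.subset_normalClosure ⟨e, _, _, hv, Sym2.out_fst_mem _, x⁻¹, rfl⟩
  simpa using h

/-- The vertices of the orbit graph: left cosets of the (images of the) vertex groups in the
completion. The completion acts on them by left multiplication. -/
abbrev OrbitVertex : Type (max u₁ u₂) := Σ v : V, 𝒢.Completion ⧸ (𝒢.vertexMap v).range

/-- The edges of the orbit graph: left cosets of the (images of the) edge groups in the completion.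
The completion acts on them by left multiplication. -/
abbrev OrbitEdge : Type (max u₁ u₂) := Σ e : T.edgeSet, 𝒢.Completion ⧸ (𝒢.edgeMap e).range

/-- The orbit graph of the tree of groups: the edge `g𝒢(e)`, for `e = (v, w)`, joins `g𝒢(v)` and
`g𝒢(w)`. -/
def orbitGraph : Graph 𝒢.OrbitVertex 𝒢.OrbitEdge where
  vertexSet := Set.univ
  IsLink i a b := s(a.1, b.1) = (i.1 : Sym2 V) ∧ ∃ g : 𝒢.Completion,
    i.2 = (g : 𝒢.Completion ⧸ (𝒢.edgeMap i.1).range) ∧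
    a.2 = (g : 𝒢.Completion ⧸ (𝒢.vertexMap a.1).range) ∧
    b.2 = (g : 𝒢.Completion ⧸ (𝒢.vertexMap b.1).range)
  isLink_symm := by
    intro i _
    refine ⟨?_⟩
    rintro a b ⟨h, g, hi, ha, hb⟩
    exact ⟨by rw [← h, Sym2.eq_swap], g, hi, hb, ha⟩
  eq_or_eq_of_isLink_of_isLink := by
    rintro ⟨e, i⟩ ⟨a, x⟩ ⟨b, y⟩ ⟨c, z⟩ ⟨d, t⟩ ⟨h, g, hi, ha, -⟩ ⟨h', g', hi', hc, hd⟩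
    dsimp only at h h' hi hi' ha hc hd
    obtain ⟨k, hk⟩ := QuotientGroup.eq.1 (hi.symm.trans hi')
    have key : ∀ v : V, v ∈ (e : Sym2 V) →
        ((g : 𝒢.Completion) : 𝒢.Completion ⧸ (𝒢.vertexMap v).range) = g' := fun v hv =>
      QuotientGroup.eq.2 ⟨𝒢.hom e v hv k, by rw [← 𝒢.edgeMap_apply, hk]⟩
    have hae : a ∈ (e : Sym2 V) := by rw [← h]; exact Sym2.mem_mk_left _ _
    have hacd : a = c ∨ a = d := by
      have : a ∈ s(c, d) := by rw [h']; exact hae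
      simpa using this
    rcases hacd with rfl | rfl
    · exact Or.inl (by rw [ha, hc, key _ hae])
    · exact Or.inr (by rw [ha, hd, key _ hae])
  left_mem_of_isLink := fun _ _ _ _ => Set.mem_univ _

theorem orbitGraph_smul (g : 𝒢.Completion) (i : 𝒢.OrbitEdge) (a b : 𝒢.OrbitVertex)
    (h : 𝒢.orbitGraph.IsLink i a b) : 𝒢.orbitGraph.IsLink (g • i) (g • a) (g • b) := by
  obtain ⟨h, k, hi, ha, hb⟩ := h
  refine ⟨h, g * k, ?_, ?_, ?_⟩
  · exact congrArg (g • ·) hi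
  · exact congrArg (g • ·) ha
  · exact congrArg (g • ·) hb

/-- The subgraph of the orbit graph fixed by the subgroup `P` of the completion: its vertices and
edges are the vertices and edges of the orbit graph that are fixed by all elements of `P`. -/
def fixedGraph (P : Subgroup 𝒢.Completion) : Graph 𝒢.OrbitVertex 𝒢.OrbitEdge where
  vertexSet := MulAction.fixedPoints P 𝒢.OrbitVertex
  IsLink i a b := i ∈ MulAction.fixedPoints P 𝒢.OrbitEdge ∧
    a ∈ MulAction.fixedPoints P 𝒢.OrbitVertex ∧ b ∈ MulAction.fixedPoints P 𝒢.OrbitVertex ∧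
    𝒢.orbitGraph.IsLink i a b
  isLink_symm := fun _ _ => ⟨fun _ _ ⟨hi, ha, hb, h⟩ => ⟨hi, hb, ha, h.symm⟩⟩
  eq_or_eq_of_isLink_of_isLink := fun _ _ _ _ _ h h' => h.2.2.2.left_eq_or_eq h'.2.2.2
  left_mem_of_isLink := fun _ _ _ h => h.2.1

theorem fixedGraph_smul (P : Subgroup 𝒢.Completion)
    (c : Subgroup.centralizer (P : Set 𝒢.Completion)) (i : 𝒢.OrbitEdge) (a b : 𝒢.OrbitVertex)
    (h : (𝒢.fixedGraph P).IsLink i a b) :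
    (𝒢.fixedGraph P).IsLink (c • i) (c • a) (c • b) := by
  have comm : ∀ x : P, (x : 𝒢.Completion) * c = c * x := fun x =>
    Subgroup.mem_centralizer_iff.1 c.2 x x.2
  obtain ⟨hi, ha, hb, h⟩ := h
  refine ⟨fun x => ?_, fun x => ?_, fun x => ?_, 𝒢.orbitGraph_smul c i a b h⟩
  · change (x : 𝒢.Completion) • (c : 𝒢.Completion) • i = (c : 𝒢.Completion) • i
    rw [smul_smul, comm, mul_smul]
    exact congrArg _ (hi x)
  · change (x : 𝒢.Completion) • (c : 𝒢.Completion) • a = (c : 𝒢.Completion) • a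
    rw [smul_smul, comm, mul_smul]
    exact congrArg _ (ha x)
  · change (x : 𝒢.Completion) • (c : 𝒢.Completion) • b = (c : 𝒢.Completion) • b
    rw [smul_smul, comm, mul_smul]
    exact congrArg _ (hb x)

/-- The quotient of the `P`-fixed subgraph of the orbit graph by the centralizer of `P` in the
completion. -/
noncomputable def centralizerQuotient (P : Subgroup 𝒢.Completion) :
    Graph (MulAction.orbitRel.Quotient (Subgroup.centralizer (P : Set 𝒢.Completion)) 𝒢.OrbitVertex)
      (MulAction.orbitRel.Quotient (Subgroup.centralizer (P : Set 𝒢.Completion)) 𝒢.OrbitEdge) :=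
  (𝒢.fixedGraph P).orbitQuotient (Subgroup.centralizer (P : Set 𝒢.Completion))
    (𝒢.fixedGraph_smul P)

end TreeOfGroups

/-! Write `G` for the completion, `N(R)` and `C(R)` for normaliser and centralizer in `G`. Although
`G` is usually infinite, the saturation proof for finite groups applies as soon as every finite
`p`-subgroup `R` is well placed (`IsGood`): all groups between `C(R)` and `N(R)` then obey Sylow's
theorem for finite `p`-subgroups, and their Sylow subgroups induce Sylow subgroups of automorphisms
of `R` (`isSaturated_of_forall_isGood`). By Bass–Serre theory the orbit graph is a tree
(`incidenceGraph_isTree`), so finite subgroups fix vertices, and the index hypothesis moves finite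
`p`-subgroups towards the root: each is conjugate into `S` (`exists_conj_le_sylow`). Their orders
are thus bounded, and `R` is treated by descending induction on its order.

If `R` is centric, a Sylow `p`-subgroup of the finite group `N(R)/C(R)` acts on the tree of
hypothesis (b), hence fixes a vertex of it and is induced by a finite vertex stabilizer. Paths in
that tree lift modulo `C(R)`, because centricity makes `R` the only obstruction
(`exists_smul_le_stabilizer_of_incident`); this gives the required conjugacy
(`isGood_of_isMultiTree`).

If `R` is not centric, hypothesis (a) says that no conjugate of `R` is essential in a vertex group.
As in Alperin's fusion theorem, the `p`-subgroups above `R` in one vertex stabilizer are then joined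
by chains of links (`isLinkConnected_of_not_isEssential`), and these chains are continued along the
`R`-fixed subtree (`isLinkConnected_of_isNowhereEssential`). For a largest finite `p`-subgroup `B`
of `N(R)`, the group `Q = R(B ∩ C(R))` is larger than `R`, and link connectedness yields the
Frattini-type factorisation `N(R) = (N(R) ∩ N(Q)) C(R)`. So `R` inherits well-placedness from `Q`
(`isGood_of_isLinkConnected`). -/

open Pointwise


/-! ### Conjugates, normalisers and centralizers of subgroups. -/

section ConjugateSubgroups

variable {G : Type*} [Group G]

theorem mem_conj_smul {g x : G} {A : Subgroup G} :
    x ∈ MulAut.conj g • A ↔ g⁻¹ * x * g ∈ A := by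
  rw [Subgroup.mem_pointwise_smul_iff_inv_smul_mem, ← map_inv, MulAut.smul_def, MulAut.conj_apply,
    inv_inv]

theorem conj_mul_smul (g h : G) (A : Subgroup G) :
    MulAut.conj (g * h) • A = MulAut.conj g • MulAut.conj h • A := by
  rw [map_mul, mul_smul]

theorem conj_one_smul (A : Subgroup G) : MulAut.conj (1 : G) • A = A := by
  rw [map_one, one_smul]

theorem conj_inv_smul_le {g : G} {A B : Subgroup G} :
    MulAut.conj g⁻¹ • A ≤ B ↔ A ≤ MulAut.conj g • B := by
  rw [map_inv, Subgroup.subset_pointwise_smul_iff]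

theorem conj_smul_le_iff {g : G} {A B : Subgroup G} :
    MulAut.conj g • A ≤ B ↔ A ≤ MulAut.conj g⁻¹ • B := by
  rw [map_inv, Subgroup.pointwise_smul_subset_iff]

theorem conj_smul_mono {g : G} {A B : Subgroup G} (h : A ≤ B) :
    MulAut.conj g • A ≤ MulAut.conj g • B :=
  Subgroup.pointwise_smul_le_pointwise_smul_iff.2 h

theorem conj_smul_lt {g : G} {A B : Subgroup G} (h : A < B) :
    MulAut.conj g • A < MulAut.conj g • B :=
  lt_of_le_not_ge (conj_smul_mono h.le)
    fun h' => h.not_ge (Subgroup.pointwise_smul_le_pointwise_smul_iff.1 h')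

theorem mem_normalizer_iff_conj {g : G} {A : Subgroup G} :
    g ∈ Subgroup.normalizer (A : Set G) ↔ MulAut.conj g • A = A := by
  rw [Subgroup.mem_normalizer_iff'']
  constructor
  · intro h
    ext x
    rw [mem_conj_smul, ← h]
  · intro h x
    rw [← mem_conj_smul, h]

theorem conj_smul_eq_of_mem {g : G} {A : Subgroup G} (h : g ∈ A) : MulAut.conj g • A = A :=
  mem_normalizer_iff_conj.1 (Subgroup.le_normalizer h)

theorem conj_smul_le_of_mem {g : G} {A L : Subgroup G} (h : g ∈ L) (hA : A ≤ L) :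
    MulAut.conj g • A ≤ L := by
  rw [← conj_smul_eq_of_mem h]
  exact conj_smul_mono hA

theorem mem_centralizer_iff_conj {g : G} {A : Subgroup G} :
    g ∈ Subgroup.centralizer (A : Set G) ↔ ∀ x ∈ A, g * x * g⁻¹ = x := by
  rw [Subgroup.mem_centralizer_iff]
  refine forall₂_congr fun x _ => ?_
  rw [mul_inv_eq_iff_eq_mul, eq_comm]

theorem centralizer_le_normalizer (A : Subgroup G) :
    Subgroup.centralizer (A : Set G) ≤ Subgroup.normalizer (A : Set G) := by
  intro g hg
  rw [Subgroup.mem_normalizer_iff'']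
  have hg' := Subgroup.mem_centralizer_iff.1 hg
  have hg'' := Subgroup.mem_centralizer_iff.1 (inv_mem hg)
  intro x
  constructor
  · intro hx
    have := hg' x hx
    rwa [mul_assoc, this, inv_mul_cancel_left]
  · intro hx
    have := hg'' _ hx
    have h2 : x = g⁻¹ * x * g := by
      have h3 : g * (g⁻¹ * x * g * g⁻¹) = g * (g⁻¹ * (g⁻¹ * x * g)) := by rw [this]
      simpa [mul_assoc] using h3
    rwa [h2]

theorem conj_smul_normalizer (g : G) (A : Subgroup G) :
    MulAut.conj g • Subgroup.normalizer (A : Set G) =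
      Subgroup.normalizer ((MulAut.conj g • A : Subgroup G) : Set G) := by
  ext x
  rw [mem_conj_smul, mem_normalizer_iff_conj, mem_normalizer_iff_conj, conj_mul_smul,
    conj_mul_smul, map_inv, inv_smul_eq_iff]

theorem conj_smul_centralizer (g : G) (A : Subgroup G) :
    MulAut.conj g • Subgroup.centralizer (A : Set G) =
      Subgroup.centralizer ((MulAut.conj g • A : Subgroup G) : Set G) := by
  ext x
  rw [mem_conj_smul, mem_centralizer_iff_conj, mem_centralizer_iff_conj]
  constructor
  · intro h y hy
    have := h _ (mem_conj_smul.1 hy)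
    calc x * y * x⁻¹ = g * (g⁻¹ * x * g * (g⁻¹ * y * g) * (g⁻¹ * x * g)⁻¹) * g⁻¹ := by group
      _ = y := by rw [this]; group
  · intro h y hy
    have := h (g * y * g⁻¹) (mem_conj_smul.2 (by simpa [mul_assoc] using hy))
    calc g⁻¹ * x * g * y * (g⁻¹ * x * g)⁻¹ = g⁻¹ * (x * (g * y * g⁻¹) * x⁻¹) * g := by group
      _ = y := by rw [this]; group

theorem conj_smul_eq_map (g : G) (A : Subgroup G) :
    MulAut.conj g • A = A.map (MulAut.conj g).toMonoidHom := rfl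

theorem card_conj_smul (g : G) (A : Subgroup G) :
    Nat.card (MulAut.conj g • A : Subgroup G) = Nat.card A :=
  (Nat.card_congr (Subgroup.equivSMul (MulAut.conj g) A).toEquiv).symm

theorem conj_smul_centralizer_eq_of_mem_normalizer {n : G} {P : Subgroup G}
    (hn : n ∈ Subgroup.normalizer (P : Set G)) :
    MulAut.conj n • Subgroup.centralizer (P : Set G) = Subgroup.centralizer (P : Set G) := by
  rw [conj_smul_centralizer, mem_normalizer_iff_conj.1 hn]

/-- Elements of the join with a subgroup that is normalised. -/
theorem exists_mul_of_mem_sup {A C : Subgroup G} (h : A ≤ Subgroup.normalizer (C : Set G)) {x : G}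
    (hx : x ∈ A ⊔ C) : ∃ a ∈ A, ∃ c ∈ C, a * c = x := by
  have : x ∈ ((A ⊔ C : Subgroup G) : Set G) := hx
  rw [Subgroup.coe_mul_of_left_le_normalizer_right A C h] at this
  obtain ⟨a, ha, c, hc, rfl⟩ := Set.mem_mul.1 this
  exact ⟨a, ha, c, hc, rfl⟩

theorem exists_mul_of_mem_sup' {A C : Subgroup G} (h : A ≤ Subgroup.normalizer (C : Set G)) {x : G}
    (hx : x ∈ A ⊔ C) : ∃ c ∈ C, ∃ a ∈ A, c * a = x := by
  obtain ⟨a, ha, c, hc, rfl⟩ := exists_mul_of_mem_sup h hx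
  refine ⟨a * c * a⁻¹, ((Subgroup.mem_normalizer_iff.1 (h ha)) c).1 hc, a, ha, by group⟩

theorem le_normalizer_centralizer_of_le {A P : Subgroup G}
    (h : A ≤ Subgroup.normalizer (P : Set G)) :
    A ≤ Subgroup.normalizer ((Subgroup.centralizer (P : Set G) : Subgroup G) : Set G) := fun _ ha =>
  mem_normalizer_iff_conj.2 (conj_smul_centralizer_eq_of_mem_normalizer (h ha))

end ConjugateSubgroups

/-! ### Sylow theory for finite `p`-subgroups of an arbitrary group. -/

section FinitePSubgroups

variable {G : Type*} [Group G] {p : ℕ}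

/-- `A` is a finite `p`-subgroup. -/
def IsFinP (p : ℕ) (A : Subgroup G) : Prop := Finite A ∧ IsPGroup p A

/-- `B` is a finite `p`-subgroup of `L` which contains an `L`-conjugate of each finite `p`-subgroup
of `L`. -/
def IsSyl (p : ℕ) (L B : Subgroup G) : Prop :=
  B ≤ L ∧ IsFinP p B ∧ ∀ A ≤ L, IsFinP p A → ∃ l ∈ L, MulAut.conj l • A ≤ B

theorem IsFinP.mono {A B : Subgroup G} (hB : IsFinP p B) (h : A ≤ B) : IsFinP p A :=
  ⟨have := hB.1; Finite.of_injective _ (Subgroup.inclusion_injective h), hB.2.to_le h⟩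

theorem IsFinP.conj {A : Subgroup G} (hA : IsFinP p A) (g : G) : IsFinP p (MulAut.conj g • A) :=
  ⟨have := hA.1; Finite.of_equiv _ (Subgroup.equivSMul (MulAut.conj g) A).toEquiv,
    hA.2.of_equiv (Subgroup.equivSMul (MulAut.conj g) A)⟩

theorem IsFinP.map {H : Type*} [Group H] {A : Subgroup G} (hA : IsFinP p A) (f : G →* H) :
    IsFinP p (A.map f) := by
  have := hA.1
  exact ⟨Finite.of_surjective _ (f.subgroupMap_surjective A), hA.2.map f⟩

theorem finite_sup {A C : Subgroup G} (h : A ≤ Subgroup.normalizer (C : Set G)) [Finite A]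
    [Finite C] : Finite (A ⊔ C : Subgroup G) := by
  have : ((A ⊔ C : Subgroup G) : Set G) = (A : Set G) * C :=
    Subgroup.coe_mul_of_left_le_normalizer_right A C h
  have hf : ((A ⊔ C : Subgroup G) : Set G).Finite := by
    rw [this]
    exact (Set.toFinite (A : Set G)).mul (Set.toFinite (C : Set G))
  exact hf.to_subtype

theorem IsFinP.sup {A C : Subgroup G} (hA : IsFinP p A) (hC : IsFinP p C)
    (h : A ≤ Subgroup.normalizer (C : Set G)) : IsFinP p (A ⊔ C) := by
  have := hA.1
  have := hC.1
  exact ⟨finite_sup h, hA.2.to_sup_of_normal_right' hC.2 h⟩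

theorem IsSyl.conj {L B : Subgroup G} (h : IsSyl p L B) {l : G} (hl : l ∈ L) :
    IsSyl p L (MulAut.conj l • B) := by
  refine ⟨conj_smul_le_of_mem hl h.1, h.2.1.conj l, fun A hA hAp => ?_⟩
  obtain ⟨k, hk, hkA⟩ := h.2.2 A hA hAp
  exact ⟨l * k, mul_mem hl hk, by rw [conj_mul_smul]; exact conj_smul_mono hkA⟩

theorem IsSyl.exists_ge {L B A : Subgroup G} (h : IsSyl p L B) (hA : A ≤ L) (hAp : IsFinP p A) :
    ∃ l ∈ L, A ≤ MulAut.conj l • B ∧ IsSyl p L (MulAut.conj l • B) := by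
  obtain ⟨k, hk, hkA⟩ := h.2.2 A hA hAp
  exact ⟨k⁻¹, inv_mem hk, conj_smul_le_iff.1 hkA, h.conj (inv_mem hk)⟩

theorem IsSyl.le_of_le {L B A : Subgroup G} (h : IsSyl p L B) (hA : A ≤ L) (hAp : IsFinP p A)
    (hBA : B ≤ A) : A = B := by
  obtain ⟨k, hk, hkA⟩ := h.2.2 A hA hAp
  have := h.2.1.1
  have := hAp.1
  have h1 : Nat.card A ≤ Nat.card B := by
    rw [← card_conj_smul k A]
    exact Subgroup.card_le_of_le hkA
  exact (Subgroup.eq_of_le_of_card_ge hBA h1).symm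

theorem IsSyl.of_card_le {L B A : Subgroup G} (h : IsSyl p L B) (hA : A ≤ L) (hAp : IsFinP p A)
    (hc : Nat.card B ≤ Nat.card A) : IsSyl p L A := by
  obtain ⟨k, hk, hkA⟩ := h.2.2 A hA hAp
  have := h.2.1.1
  have h1 : MulAut.conj k • A = B := Subgroup.eq_of_le_of_card_ge hkA (by rwa [card_conj_smul])
  have h2 : A = MulAut.conj k⁻¹ • B := by rw [← h1, ← conj_mul_smul, inv_mul_cancel, conj_one_smul]
  rw [h2]
  exact h.conj (inv_mem hk)

theorem exists_isSyl [Fact p.Prime] (L : Subgroup G) [Finite L] : ∃ B, IsSyl p L B := by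
  obtain ⟨B⟩ : Nonempty (Sylow p L) := inferInstance
  refine ⟨(B : Subgroup L).map L.subtype, Subgroup.map_subtype_le _,
    IsFinP.map ⟨inferInstance, B.isPGroup'⟩ _, fun A hA hAp => ?_⟩
  obtain ⟨Q, hQ⟩ := (hAp.2.comap_subtype (K := L)).exists_le_sylow
  obtain ⟨l, hl⟩ := MulAction.exists_smul_eq L Q B
  refine ⟨l, l.2, fun x hx => ?_⟩
  rw [mem_conj_smul] at hx
  have hx' : (⟨(l : G)⁻¹ * x * l, hA hx⟩ : L) ∈ (Q : Subgroup L) := hQ hx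
  have hxL : x ∈ L := by
    have := mul_mem (mul_mem l.2 (hA hx)) (inv_mem l.2)
    simpa [mul_assoc] using this
  refine ⟨⟨x, hxL⟩, ?_, rfl⟩
  rw [← hl]
  change _ ∈ MulAut.conj l • (Q : Subgroup L)
  rw [mem_conj_smul]
  exact hx'

/-- Normalisers grow in finite `p`-groups. -/
theorem lt_inf_normalizer [Fact p.Prime] {A U : Subgroup G} (hA : IsFinP p A) (h : U < A) :
    U < A ⊓ Subgroup.normalizer (U : Set G) := by
  have := hA.1
  have : Group.IsNilpotent A := hA.2.isNilpotent
  have h1 : U.subgroupOf A < ⊤ := by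
    rw [lt_top_iff_ne_top]
    intro h2
    exact h.not_ge (Subgroup.subgroupOf_eq_top.1 h2)
  have h2 := Group.normalizerCondition_of_isNilpotent (G := A) _ h1
  refine lt_of_le_not_ge (le_inf h.le Subgroup.le_normalizer) fun h3 => h2.not_ge ?_
  intro x hx
  have hxN : (x : G) ∈ Subgroup.normalizer (U : Set G) := by
    rw [Subgroup.mem_normalizer_iff]
    intro y
    constructor
    · intro hy
      exact (Subgroup.mem_normalizer_iff.1 hx ⟨y, h.le hy⟩).1 hy
    · intro hy
      have hyA : y ∈ A := by
        have := mul_mem (mul_mem (inv_mem x.2) (h.le hy)) x.2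
        simpa [mul_assoc] using this
      exact (Subgroup.mem_normalizer_iff.1 hx ⟨y, hyA⟩).2 hy
  exact h3 ⟨x.2, hxN⟩

theorem card_lt_of_lt {A B : Subgroup G} [Finite B] (h : A < B) : Nat.card A < Nat.card B := by
  by_contra h'
  exact h.ne (Subgroup.eq_of_le_of_card_ge h.le (not_lt.1 h'))

end FinitePSubgroups

/-! ### Well placed subgroups and chains of links. -/

section Linking

variable {G : Type*} [Group G] {p : ℕ}

/-- `U` is well placed: every group between the centralizer and the normalizer of `U` has Sylow
`p`-subgroups, and they cover the `p`-part of the automorphism group induced on `U`. -/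
def IsGood (p : ℕ) (U : Subgroup G) : Prop :=
  ∀ L : Subgroup G, Subgroup.centralizer (U : Set G) ≤ L → L ≤ Subgroup.normalizer (U : Set G) →
    ∃ B, IsSyl p L B ∧ ¬ p ∣ (B ⊔ Subgroup.centralizer (U : Set G)).relIndex L

/-- Finite `p`-subgroups properly containing `P` are linked if their intersection properly contains
`P`, or if they are conjugate under the centralizer of `P`. -/
def Link (p : ℕ) (P A B : Subgroup G) : Prop :=
  (IsFinP p A ∧ P < A) ∧ (IsFinP p B ∧ P < B) ∧
    (P < A ⊓ B ∨ ∃ c ∈ Subgroup.centralizer (P : Set G), B = MulAut.conj c • A)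

/-- Any two finite `p`-subgroups properly containing `P` are joined by a chain of links. -/
def IsLinkConnected (p : ℕ) (P : Subgroup G) : Prop :=
  ∀ A B : Subgroup G, IsFinP p A → IsFinP p B → P < A → P < B → Relation.ReflTransGen (Link p P) A B

theorem Link.symm {P A B : Subgroup G} (h : Link p P A B) : Link p P B A := by
  obtain ⟨hA, hB, h⟩ := h
  refine ⟨hB, hA, ?_⟩
  rcases h with h | ⟨c, hc, rfl⟩
  · exact Or.inl (by rwa [inf_comm])
  · exact Or.inr ⟨c⁻¹, inv_mem hc, by rw [← conj_mul_smul, inv_mul_cancel, conj_one_smul]⟩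

theorem reflTransGen_link_symm {P A B : Subgroup G} (h : Relation.ReflTransGen (Link p P) A B) :
    Relation.ReflTransGen (Link p P) B A := by
  induction h with
  | refl => exact .refl
  | tail _ h ih => exact .head h.symm ih

theorem Link.of_le {P A B : Subgroup G} (hA : IsFinP p A) (hB : IsFinP p B) (hPA : P < A)
    (h : A ≤ B) : Link p P A B :=
  ⟨⟨hA, hPA⟩, ⟨hB, hPA.trans_le h⟩, Or.inl (by rwa [inf_eq_left.2 h])⟩

theorem Link.of_conj {P A : Subgroup G} (hA : IsFinP p A) (hPA : P < A) {c : G}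
    (hc : c ∈ Subgroup.centralizer (P : Set G)) : Link p P A (MulAut.conj c • A) := by
  refine ⟨⟨hA, hPA⟩, ⟨hA.conj c, ?_⟩, Or.inr ⟨c, hc, rfl⟩⟩
  have h := mem_normalizer_iff_conj.1 (centralizer_le_normalizer P hc)
  rw [← h]
  exact conj_smul_lt hPA

theorem Link.map {H : Type*} [Group H] {f : G →* H} (hf : Function.Injective f)
    {P A B : Subgroup G} (h : Link p P A B) : Link p (P.map f) (A.map f) (B.map f) := by
  have hlt : ∀ {A B : Subgroup G}, A < B → A.map f < B.map f := fun h =>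
    lt_of_le_not_ge (Subgroup.map_mono h.le)
      fun h' => h.not_ge ((Subgroup.map_le_map_iff_of_injective hf).1 h')
  obtain ⟨⟨hA, hPA⟩, ⟨hB, hPB⟩, h⟩ := h
  refine ⟨⟨hA.map f, hlt hPA⟩, ⟨hB.map f, hlt hPB⟩, ?_⟩
  rcases h with h | ⟨c, hc, rfl⟩
  · left
    rw [← Subgroup.map_inf _ _ f hf]
    exact hlt h
  · right
    refine ⟨f c, ?_, ?_⟩
    · rw [mem_centralizer_iff_conj] at hc ⊢
      rintro _ ⟨x, hx, rfl⟩
      rw [← map_mul, ← map_inv, ← map_mul, hc x hx]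
    · ext y
      rw [mem_conj_smul]
      constructor
      · rintro ⟨x, hx, rfl⟩
        exact ⟨c⁻¹ * x * c, mem_conj_smul.1 hx, by simp⟩
      · rintro ⟨x, hx, hxy⟩
        refine ⟨c * x * c⁻¹, mem_conj_smul.2 (by simpa [mul_assoc] using hx), ?_⟩
        rw [map_mul, map_mul, hxy, map_inv]
        group

theorem Link.conj {P A B : Subgroup G} (h : Link p P A B) (g : G) :
    Link p (MulAut.conj g • P) (MulAut.conj g • A) (MulAut.conj g • B) :=
  h.map (f := (MulAut.conj g).toMonoidHom) (MulAut.conj g).injective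

theorem reflTransGen_link_conj {P A B : Subgroup G} (h : Relation.ReflTransGen (Link p P) A B)
    (g : G) : Relation.ReflTransGen (Link p (MulAut.conj g • P)) (MulAut.conj g • A)
      (MulAut.conj g • B) :=
  h.lift _ fun _ _ h => h.conj g

variable [Fact p.Prime]

/-- Normalisers grow inside `A ⊓ B`, so a proper intersection stays proper after both groups are cut
down to the normaliser of `P`. -/
theorem lt_inf_inf_normalizer {P A B : Subgroup G} (hA : IsFinP p A) (h : P < A ⊓ B) :
    P < A ⊓ Subgroup.normalizer (P : Set G) ⊓ (B ⊓ Subgroup.normalizer (P : Set G)) := by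
  have := lt_inf_normalizer (hA.mono inf_le_left) h
  rwa [← inf_inf_distrib_right]

theorem normalizer_inf_le_conj {P A : Subgroup G} {n : G}
    (hn : n ∈ Subgroup.normalizer (P : Set G)) :
    MulAut.conj n • (A ⊓ Subgroup.normalizer (P : Set G)) =
      MulAut.conj n • A ⊓ Subgroup.normalizer (P : Set G) := by
  rw [Subgroup.smul_inf, conj_smul_eq_of_mem hn]

theorem conj_smul_lt_of_mem_normalizer {P A : Subgroup G} {n : G}
    (hn : n ∈ Subgroup.normalizer (P : Set G)) (h : P < A) : P < MulAut.conj n • A := by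
  have := conj_smul_lt (g := n) h
  rwa [mem_normalizer_iff_conj.1 hn] at this

theorem conj_inv_smul_smul (n : G) (A : Subgroup G) :
    MulAut.conj n⁻¹ • MulAut.conj n • A = A := by
  rw [← conj_mul_smul, inv_mul_cancel, conj_one_smul]

/-- Finite `p`-subgroups meeting the largest one in more than `P` are conjugate into it. -/
theorem exists_conj_le_of_lt_inf {P B : Subgroup G}
    (hgood : ∀ U : Subgroup G, IsFinP p U → P < U → IsGood p U)
    (hBN : B ≤ Subgroup.normalizer (P : Set G)) (hB : IsFinP p B)
    (hmax : ∀ A ≤ Subgroup.normalizer (P : Set G), IsFinP p A → Nat.card A ≤ Nat.card B) :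
    ∀ (k : ℕ) (A : Subgroup G), A ≤ Subgroup.normalizer (P : Set G) → IsFinP p A → P < A ⊓ B →
      Nat.card B ≤ Nat.card (A ⊓ B : Subgroup G) + k →
      ∃ n ∈ Subgroup.normalizer (P : Set G), MulAut.conj n • A ≤ B := by
  have := hB.1
  intro k
  -- `k` bounds the defect `|B| - |A ⊓ B|`.
  induction k using Nat.strong_induction_on with
  | _ k ih =>
  intro A hAN hA hlt hk
  have := hA.1
  set U := A ⊓ B with hU
  by_cases hUA : U = A
  · exact ⟨1, one_mem _, by rw [conj_one_smul]; exact inf_eq_left.1 hUA⟩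
  by_cases hUB : U = B
  · have hBA : B ≤ A := inf_eq_right.1 hUB
    have := Subgroup.eq_of_le_of_card_ge hBA (hmax A hAN hA)
    exact ⟨1, one_mem _, by rw [conj_one_smul, this]⟩
  have hUfin : IsFinP p U := hA.mono inf_le_left
  have hUA' := lt_inf_normalizer hA (lt_of_le_of_ne inf_le_left hUA)
  have hUB' := lt_inf_normalizer hB (lt_of_le_of_ne inf_le_right hUB)
  -- `U` is well placed, so `N(U) ⊓ N(P)` has a Sylow subgroup `K`. It serves as a bridge: up to
  -- conjugacy it contains both `N_A(U)` and `N_B(U)`, each larger than `U`. First a conjugate of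
  -- `K` that contains `N_B(U)` is moved into `B`; this carries along a conjugate of `N_A(U)`, and
  -- then `A` follows.
  have hcP : Subgroup.centralizer (U : Set G) ≤ Subgroup.normalizer (P : Set G) :=
    (Subgroup.centralizer_le hlt.le).trans (centralizer_le_normalizer P)
  obtain ⟨K, hK, -⟩ := hgood U hUfin hlt
    (Subgroup.normalizer (U : Set G) ⊓ Subgroup.normalizer (P : Set G))
    (le_inf (centralizer_le_normalizer U) hcP) inf_le_left
  obtain ⟨l₁, hl₁, h₁⟩ := hK.2.2 (B ⊓ Subgroup.normalizer (U : Set G))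
    (le_inf inf_le_right (inf_le_left.trans hBN)) (hB.mono inf_le_left)
  obtain ⟨l₂, hl₂, h₂⟩ := hK.2.2 (A ⊓ Subgroup.normalizer (U : Set G))
    (le_inf inf_le_right (inf_le_left.trans hAN)) (hA.mono inf_le_left)
  have hKN : K ≤ Subgroup.normalizer (P : Set G) := hK.1.trans inf_le_right
  -- The induction hypothesis: a group meeting `B` in a conjugate of some `W > U` has smaller
  -- defect.
  have step : ∀ (A' : Subgroup G) , A' ≤ Subgroup.normalizer (P : Set G) → IsFinP p A' →
      ∀ m ∈ Subgroup.normalizer (P : Set G), ∀ W : Subgroup G, U < W → MulAut.conj m • W ≤ A' ⊓ B →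
      ∃ n ∈ Subgroup.normalizer (P : Set G), MulAut.conj n • A' ≤ B := by
    intro A' hA'N hA' m hm W hW hle
    have hle2 : Nat.card W ≤ Nat.card (A' ⊓ B : Subgroup G) := by
      have := (hA'.mono (inf_le_left : A' ⊓ B ≤ A')).1
      rw [← card_conj_smul m W]
      exact Subgroup.card_le_of_le hle
    have hWfin : Finite W := by
      have := (hA'.mono (inf_le_left : A' ⊓ B ≤ A')).1
      have : IsFinP p (MulAut.conj m • W) := hA'.mono (hle.trans inf_le_left)
      have := this.conj m⁻¹
      rw [conj_inv_smul_smul] at this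
      exact this.1
    have hlt3 := card_lt_of_lt hW
    have hk0 : 0 < k := by
      rcases Nat.eq_zero_or_pos k with h0 | h0
      · exfalso
        have : Nat.card (A' ⊓ B : Subgroup G) ≤ Nat.card B := Subgroup.card_le_of_le inf_le_right
        omega
      · exact h0
    exact ih (k - 1) (by omega) A' hA'N hA'
      ((conj_smul_lt_of_mem_normalizer hm (hlt.trans hW)).trans_le hle) (by omega)
  have hKl : MulAut.conj l₁⁻¹ • K ≤ Subgroup.normalizer (P : Set G) :=
    conj_smul_le_of_mem (inv_mem hl₁.2) hKN
  obtain ⟨n, hn, hnK⟩ := step (MulAut.conj l₁⁻¹ • K) hKl (hK.2.1.conj _) 1 (one_mem _) _ hUB'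
    (by rw [conj_one_smul]; exact le_inf (by rw [← conj_smul_le_iff]; exact h₁) inf_le_left)
  rw [← conj_mul_smul] at hnK
  have hn' : n * l₁⁻¹ ∈ Subgroup.normalizer (P : Set G) := mul_mem hn (inv_mem hl₁.2)
  set n' := n * l₁⁻¹ with hn'_def
  have hm : n' * l₂ ∈ Subgroup.normalizer (P : Set G) := mul_mem hn' hl₂.2
  obtain ⟨n'', hn'', hA''⟩ := step (MulAut.conj (n' * l₂) • A) (conj_smul_le_of_mem hm hAN)
    (hA.conj _) (n' * l₂) hm _ hUA' (le_inf (conj_smul_mono inf_le_left)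
      (by rw [conj_mul_smul]; exact (conj_smul_mono h₂).trans hnK))
  exact ⟨n'' * (n' * l₂), mul_mem hn'' hm, by rwa [conj_mul_smul]⟩

/-- The property of being conjugate into `B` passes along a chain starting at `B`. Across a proper
intersection, the conjugate of the next group meets `B` in more than `P`, so
`exists_conj_le_of_lt_inf` applies; across a conjugation by `c`, the conjugator is multiplied by
`c⁻¹`. -/
theorem exists_conj_le_of_isLinkConnected {P B : Subgroup G}
    (hgood : ∀ U : Subgroup G, IsFinP p U → P < U → IsGood p U)
    (hBN : B ≤ Subgroup.normalizer (P : Set G)) (hB : IsFinP p B) (hPB : P < B)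
    (hmax : ∀ A ≤ Subgroup.normalizer (P : Set G), IsFinP p A → Nat.card A ≤ Nat.card B)
    (hconn : IsLinkConnected p P) (A : Subgroup G) (hA : IsFinP p A) (hPA : P < A) :
    ∃ n ∈ Subgroup.normalizer (P : Set G),
      MulAut.conj n • (A ⊓ Subgroup.normalizer (P : Set G)) ≤ B := by
  induction hconn B A hB hA hPB hPA with
  | refl => exact ⟨1, one_mem _, by rw [conj_one_smul]; exact inf_le_left⟩
  | @tail A A' _ hlink ih =>
    obtain ⟨n, hn, hnA⟩ := ih hlink.1.1 hlink.1.2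
    rcases hlink.2.2 with h | ⟨c, hc, rfl⟩
    · have h1 := conj_smul_lt_of_mem_normalizer hn (lt_inf_inf_normalizer hlink.1.1 h)
      rw [Subgroup.smul_inf] at h1
      have h2 : P < MulAut.conj n • (A' ⊓ Subgroup.normalizer (P : Set G)) ⊓ B :=
        h1.trans_le (le_inf inf_le_right (inf_le_left.trans hnA))
      obtain ⟨m, hm, hmA⟩ := exists_conj_le_of_lt_inf hgood hBN hB hmax (Nat.card B)
        (MulAut.conj n • (A' ⊓ Subgroup.normalizer (P : Set G)))
        (conj_smul_le_of_mem hn inf_le_right) ((hA.mono inf_le_left).conj n) h2 (by omega)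
      exact ⟨m * n, mul_mem hm hn, by rwa [conj_mul_smul]⟩
    · have hcN := centralizer_le_normalizer P hc
      refine ⟨n * c⁻¹, mul_mem hn (inv_mem hcN), ?_⟩
      rw [← normalizer_inf_le_conj hcN, conj_mul_smul, conj_inv_smul_smul]
      exact hnA

end Linking

/-! ### From link connectedness to a Frattini factorisation of the normaliser. -/

section Extension

variable {G : Type*} [Group G] {p : ℕ} [Fact p.Prime]

theorem sup_centralizer_le_normalizer (P : Subgroup G) :
    P ⊔ Subgroup.centralizer (P : Set G) ≤ Subgroup.normalizer (P : Set G) :=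
  sup_le Subgroup.le_normalizer (centralizer_le_normalizer P)

theorem conj_smul_sup_centralizer {P : Subgroup G} {n : G}
    (hn : n ∈ Subgroup.normalizer (P : Set G)) :
    MulAut.conj n • (P ⊔ Subgroup.centralizer (P : Set G)) =
      P ⊔ Subgroup.centralizer (P : Set G) := by
  rw [Subgroup.smul_sup, mem_normalizer_iff_conj.1 hn,
    conj_smul_centralizer_eq_of_mem_normalizer hn]

/-- The modular law for `P ⊔ C(P)` and a group containing `P`. -/
theorem sup_centralizer_inf {P B : Subgroup G} (hPB : P ≤ B) :
    (P ⊔ Subgroup.centralizer (P : Set G)) ⊓ B ≤ P ⊔ B ⊓ Subgroup.centralizer (P : Set G) := by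
  rintro x ⟨hx, hxB⟩
  obtain ⟨a, ha, c, hc, rfl⟩ :=
    exists_mul_of_mem_sup (le_normalizer_centralizer_of_le Subgroup.le_normalizer) hx
  exact Subgroup.mul_mem_sup ha ⟨(Subgroup.mul_mem_cancel_left _ (hPB ha)).1 hxB, hc⟩

/-- If `Q` is not inside `U`, the normaliser of `U` grows in the `p`-group `UQ`. A new element `uq`
contributes a factor `q` in `Q ⊓ N(U)`, which cannot lie in `P` since `P ≤ U`. -/
theorem lt_inf_normalizer_of_le {P Q U B : Subgroup G} (hB : IsFinP p B) (hPQ : P < Q)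
    (hQB : Q ≤ B) (hUB : U ≤ B) (hPU : P ≤ U) (hBQ : B ≤ Subgroup.normalizer (Q : Set G)) :
    P < Q ⊓ Subgroup.normalizer (U : Set G) := by
  by_cases hQU : Q ≤ U
  · rwa [inf_eq_left.2 (hQU.trans Subgroup.le_normalizer)]
  have hUQ := hUB.trans hBQ
  have h1 : U < U ⊔ Q := lt_of_le_of_ne le_sup_left fun h => hQU (by rw [h]; exact le_sup_right)
  have h2 := lt_inf_normalizer ((hB.mono hUB).sup (hB.mono hQB) hUQ) h1
  obtain ⟨y, hy, hyU⟩ := SetLike.exists_of_lt h2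
  obtain ⟨u, hu, q, hq, rfl⟩ := exists_mul_of_mem_sup hUQ hy.1
  refine lt_of_le_of_ne (le_inf hPQ.le (hPU.trans Subgroup.le_normalizer)) fun h => hyU ?_
  refine mul_mem hu (hPU ?_)
  rw [h]
  exact ⟨hq, (Subgroup.mul_mem_cancel_left _ (Subgroup.le_normalizer hu)).1 hy.2⟩

omit [Fact p.Prime] in
-- Both `V` and `V'` can be moved into one Sylow subgroup `K` of `N(U) ⊓ P C(P)` by elements `l₁`,
-- `l₂` of `P C(P) ≤ J`, and `K` can be moved into `B` by some `y`. The two hypotheses put `y l₁ x`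
-- and `y l₂` in `J`, so `x` is in `J`. It is used with `U` replaced by `x U x⁻¹`, `V = x N_Q(U)
-- x⁻¹` and `V' = N_Q(x U x⁻¹)`.
theorem mem_of_sylow_exchange {P U B J V V' : Subgroup G} {x : G}
    (hU : IsGood p U) (hPU : P < U)
    (hJ : P ⊔ Subgroup.centralizer (P : Set G) ≤ J)
    (hinto : ∀ A ≤ Subgroup.normalizer (P : Set G), IsFinP p A →
      ∃ n ∈ Subgroup.normalizer (P : Set G), MulAut.conj n • A ≤ B)
    (hV : V ≤ Subgroup.normalizer (U : Set G) ⊓ (P ⊔ Subgroup.centralizer (P : Set G)))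
    (hV' : V' ≤ Subgroup.normalizer (U : Set G) ⊓ (P ⊔ Subgroup.centralizer (P : Set G)))
    (hVp : IsFinP p V) (hVp' : IsFinP p V')
    (h₁ : ∀ y ∈ Subgroup.normalizer (P : Set G), MulAut.conj y • V ≤ B → y * x ∈ J)
    (h₂ : ∀ y ∈ Subgroup.normalizer (P : Set G), MulAut.conj y • V' ≤ B → y ∈ J) : x ∈ J := by
  obtain ⟨K, hK, -⟩ := hU (Subgroup.normalizer (U : Set G) ⊓
    (P ⊔ Subgroup.centralizer (P : Set G)))
    (le_inf (centralizer_le_normalizer U) ((Subgroup.centralizer_le hPU.le).trans le_sup_right))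
    inf_le_left
  have hN := sup_centralizer_le_normalizer P
  obtain ⟨l₁, hl₁, hk₁⟩ := hK.2.2 V hV hVp
  obtain ⟨l₂, hl₂, hk₂⟩ := hK.2.2 V' hV' hVp'
  obtain ⟨y, hy, hyK⟩ := hinto K (hK.1.trans (inf_le_right.trans hN)) hK.2.1
  have e₁ := h₁ (y * l₁) (mul_mem hy (hN hl₁.2))
    (by rw [conj_mul_smul]; exact (conj_smul_mono hk₁).trans hyK)
  have e₂ := h₂ (y * l₂) (mul_mem hy (hN hl₂.2))
    (by rw [conj_mul_smul]; exact (conj_smul_mono hk₂).trans hyK)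
  have e₃ : (y * l₂ * l₂⁻¹ * l₁)⁻¹ * (y * l₁ * x) ∈ J :=
    mul_mem (inv_mem (mul_mem (mul_mem e₂ (inv_mem (hJ hl₂.2))) (hJ hl₁.2))) e₁
  simpa [mul_assoc] using e₃

theorem sup_inf_centralizer_le_normalizer {P B : Subgroup G}
    (hBN : B ≤ Subgroup.normalizer (P : Set G)) :
    B ≤ Subgroup.normalizer
      ((P ⊔ B ⊓ Subgroup.centralizer (P : Set G) : Subgroup G) : Set G) := by
  intro b hb
  rw [mem_normalizer_iff_conj, Subgroup.smul_sup, Subgroup.smul_inf, conj_smul_eq_of_mem hb,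
    mem_normalizer_iff_conj.1 (hBN hb), conj_smul_centralizer_eq_of_mem_normalizer (hBN hb)]

/-- Descending induction on `|U|` for `U` inside `Q`. Since `P C(P)` is normal in `N(P)` and meets
`B` in `Q`, the conjugate of `U` stays in `Q`. For `U = Q` the element `x` normalises `Q`; otherwise
the exchange lemma replaces `U` and its conjugate by their larger normalisers in `Q`. -/
theorem mem_of_conj_le_of_le {P B Q J : Subgroup G}
    (hgood : ∀ U : Subgroup G, IsFinP p U → P < U → IsGood p U)
    (hB : IsFinP p B) (hPB : P ≤ B)
    (hQ : Q = P ⊔ B ⊓ Subgroup.centralizer (P : Set G))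
    (hJ : P ⊔ Subgroup.centralizer (P : Set G) ≤ J)
    (hJQ : Subgroup.normalizer (Q : Set G) ⊓ Subgroup.normalizer (P : Set G) ≤ J)
    (hinto : ∀ A ≤ Subgroup.normalizer (P : Set G), IsFinP p A →
      ∃ n ∈ Subgroup.normalizer (P : Set G), MulAut.conj n • A ≤ B) :
    ∀ (k : ℕ) (U : Subgroup G) (x : G), Nat.card Q ≤ Nat.card U + k → P < U → U ≤ Q →
      x ∈ Subgroup.normalizer (P : Set G) → MulAut.conj x • U ≤ B → x ∈ J := by
  have hQB : Q ≤ B := hQ ▸ sup_le hPB inf_le_left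
  have hQC : Q ≤ P ⊔ Subgroup.centralizer (P : Set G) := hQ ▸ sup_le_sup_left inf_le_right _
  have hQp := hB.mono hQB
  have := hQp.1
  have hle : ∀ x ∈ Subgroup.normalizer (P : Set G), ∀ U ≤ Q, MulAut.conj x • U ≤ B →
      MulAut.conj x • U ≤ Q := by
    intro x hx U hU h
    have h1 := conj_smul_mono (g := x) (hU.trans hQC)
    rw [conj_smul_sup_centralizer hx] at h1
    rw [hQ]
    exact (le_inf h1 h).trans (sup_centralizer_inf hPB)
  intro k
  induction k using Nat.strong_induction_on with
  | _ k ih =>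
  intro U x hk hPU hUQ hx hxU
  have hxQ := hle x hx U hUQ hxU
  have hUp := hQp.mono hUQ
  by_cases hU : U = Q
  · subst hU
    have h1 : MulAut.conj x • U = U :=
      Subgroup.eq_of_le_of_card_ge hxQ (by rw [card_conj_smul])
    exact hJQ ⟨mem_normalizer_iff_conj.2 h1, hx⟩
  have hUlt := lt_of_le_of_ne hUQ hU
  have hcard := card_lt_of_lt hUlt
  have hxlt : MulAut.conj x • U < Q := lt_of_le_of_ne hxQ fun h => by
    rw [← h, card_conj_smul] at hcard
    exact lt_irrefl _ hcard
  have hV := lt_inf_normalizer hQp hUlt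
  have hV' := lt_inf_normalizer hQp hxlt
  have hPxU := conj_smul_lt_of_mem_normalizer hx hPU
  have hfin : ∀ W : Subgroup G, Finite (Q ⊓ W : Subgroup G) := fun W => (hQp.mono inf_le_left).1
  refine mem_of_sylow_exchange (V := MulAut.conj x • (Q ⊓ Subgroup.normalizer (U : Set G)))
    (V' := Q ⊓ Subgroup.normalizer ((MulAut.conj x • U : Subgroup G) : Set G))
    (hgood _ (hUp.conj x) hPxU) hPxU hJ hinto ?_ (le_inf inf_le_right (inf_le_left.trans hQC))
    ((hQp.mono inf_le_left).conj x) (hQp.mono inf_le_left) ?_ ?_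
  · rw [Subgroup.smul_inf, conj_smul_normalizer, ← conj_smul_sup_centralizer hx]
    exact le_inf inf_le_right (inf_le_left.trans (conj_smul_mono hQC))
  · intro y hy hyV
    have := hfin (Subgroup.normalizer (U : Set G))
    have h1 := card_lt_of_lt hV
    exact ih (k - 1) (by omega) _ (y * x) (by omega) (hPU.trans hV) inf_le_left (mul_mem hy hx)
      (by rwa [conj_mul_smul])
  · intro y hy hyV
    have := hfin (Subgroup.normalizer ((MulAut.conj x • U : Subgroup G) : Set G))
    have h1 := card_lt_of_lt hV'
    rw [card_conj_smul] at h1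
    exact ih (k - 1) (by omega) _ y (by omega) (hPxU.trans hV') inf_le_left hy hyV

/-- One further exchange removes the restriction `U ≤ Q`: the normalisers in `Q` of `U` and of its
conjugate still exceed `P` by `lt_inf_normalizer_of_le`, and to them the case inside `Q` applies. -/
theorem mem_of_conj_le {P B Q J : Subgroup G}
    (hgood : ∀ U : Subgroup G, IsFinP p U → P < U → IsGood p U)
    (hBN : B ≤ Subgroup.normalizer (P : Set G)) (hB : IsFinP p B) (hPB : P ≤ B)
    (hQ : Q = P ⊔ B ⊓ Subgroup.centralizer (P : Set G)) (hPQ : P < Q)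
    (hJ : P ⊔ Subgroup.centralizer (P : Set G) ≤ J)
    (hJQ : Subgroup.normalizer (Q : Set G) ⊓ Subgroup.normalizer (P : Set G) ≤ J)
    (hinto : ∀ A ≤ Subgroup.normalizer (P : Set G), IsFinP p A →
      ∃ n ∈ Subgroup.normalizer (P : Set G), MulAut.conj n • A ≤ B)
    {U : Subgroup G} {x : G} (hPU : P < U) (hUB : U ≤ B)
    (hx : x ∈ Subgroup.normalizer (P : Set G)) (hxU : MulAut.conj x • U ≤ B) : x ∈ J := by
  have hQB : Q ≤ B := hQ ▸ sup_le hPB inf_le_left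
  have hQC : Q ≤ P ⊔ Subgroup.centralizer (P : Set G) := hQ ▸ sup_le_sup_left inf_le_right _
  have hBQ : B ≤ Subgroup.normalizer (Q : Set G) := hQ ▸ sup_inf_centralizer_le_normalizer hBN
  have hQp := hB.mono hQB
  have key := mem_of_conj_le_of_le hgood hB hPB hQ hJ hJQ hinto (Nat.card Q)
  have hPxU := conj_smul_lt_of_mem_normalizer hx hPU
  refine mem_of_sylow_exchange (V := MulAut.conj x • (Q ⊓ Subgroup.normalizer (U : Set G)))
    (V' := Q ⊓ Subgroup.normalizer ((MulAut.conj x • U : Subgroup G) : Set G))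
    (hgood _ ((hB.mono hUB).conj x) hPxU) hPxU hJ hinto ?_
    (le_inf inf_le_right (inf_le_left.trans hQC))
    ((hQp.mono inf_le_left).conj x) (hQp.mono inf_le_left) ?_ ?_
  · rw [Subgroup.smul_inf, conj_smul_normalizer, ← conj_smul_sup_centralizer hx]
    exact le_inf inf_le_right (inf_le_left.trans (conj_smul_mono hQC))
  · intro y hy hyV
    exact key _ (y * x) (by omega) (lt_inf_normalizer_of_le hB hPQ hQB hUB hPU.le hBQ) inf_le_left
      (mul_mem hy hx) (by rwa [conj_mul_smul])
  · intro y hy hyV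
    exact key _ y (by omega) (lt_inf_normalizer_of_le hB hPQ hQB hxU hPxU.le hBQ) inf_le_left
      hy hyV

/-- For `n` in the normaliser, a chain of links joins `B` to `n⁻¹ B n`. Along the chain, every
element of `N(P)` conjugating the part of the current group in `N(P)` into `B` stays in `J`; at the
end this applies to `n`. -/
theorem normalizer_le_of_isLinkConnected {P B Q J : Subgroup G}
    (hgood : ∀ U : Subgroup G, IsFinP p U → P < U → IsGood p U)
    (hBN : B ≤ Subgroup.normalizer (P : Set G)) (hB : IsFinP p B) (hPB : P < B)
    (hQ : Q = P ⊔ B ⊓ Subgroup.centralizer (P : Set G)) (hPQ : P < Q)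
    (hJ : P ⊔ Subgroup.centralizer (P : Set G) ≤ J)
    (hJQ : Subgroup.normalizer (Q : Set G) ⊓ Subgroup.normalizer (P : Set G) ≤ J)
    (hinto : ∀ A ≤ Subgroup.normalizer (P : Set G), IsFinP p A →
      ∃ n ∈ Subgroup.normalizer (P : Set G), MulAut.conj n • A ≤ B)
    (hconn : IsLinkConnected p P) : Subgroup.normalizer (P : Set G) ≤ J := by
  have key : ∀ A : Subgroup G, Relation.ReflTransGen (Link p P) B A →
      ∀ n ∈ Subgroup.normalizer (P : Set G),
        MulAut.conj n • (A ⊓ Subgroup.normalizer (P : Set G)) ≤ B → n ∈ J := by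
    intro A hA
    induction hA with
    | refl =>
      intro n hn h
      rw [inf_eq_left.2 hBN] at h
      exact mem_of_conj_le hgood hBN hB hPB.le hQ hPQ hJ hJQ hinto hPB le_rfl hn h
    | @tail A A' _ hlink ih =>
      intro n' hn' h'
      rcases hlink.2.2 with h | ⟨c, hc, rfl⟩
      · obtain ⟨n, hn, hnA⟩ := hinto (A ⊓ Subgroup.normalizer (P : Set G)) inf_le_right
          (hlink.1.1.mono inf_le_left)
        have h1 := conj_smul_lt_of_mem_normalizer hn (lt_inf_inf_normalizer hlink.1.1 h)
        have h2 := mem_of_conj_le hgood hBN hB hPB.le hQ hPQ hJ hJQ hinto (x := n' * n⁻¹) h1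
          ((conj_smul_mono inf_le_left).trans hnA) (mul_mem hn' (inv_mem hn))
          (by rw [conj_mul_smul, conj_inv_smul_smul]
              exact (conj_smul_mono inf_le_right).trans h')
        have h3 := mul_mem h2 (ih n hn hnA)
        simpa using h3
      · have hcN := centralizer_le_normalizer P hc
        have h1 := ih (n' * c) (mul_mem hn' hcN)
          (by rwa [conj_mul_smul, normalizer_inf_le_conj hcN])
        exact (Subgroup.mul_mem_cancel_right _ (hJ (Subgroup.mem_sup_right hc))).1 h1
  intro n hn
  have h1 := key (MulAut.conj n⁻¹ • B) (hconn _ _ hB (hB.conj _) hPB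
    (conj_smul_lt_of_mem_normalizer (inv_mem hn) hPB)) n hn
  refine h1 (le_trans (conj_smul_mono inf_le_left) ?_)
  rw [← conj_mul_smul, mul_inv_cancel, conj_one_smul]

theorem relIndex_eq_of_forall_exists_mul {H K L : Subgroup G} (hKL : K ≤ L)
    (h : ∀ l ∈ L, ∃ k ∈ K, ∃ x ∈ H, l = k * x) : H.relIndex L = H.relIndex K := by
  symm
  refine Nat.card_congr (Equiv.ofBijective _
    ⟨(Subgroup.quotientSubgroupOfEmbeddingOfLE H hKL).injective, ?_⟩)
  rintro ⟨l, hl⟩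
  obtain ⟨k, hk, x, hx, rfl⟩ := h l hl
  refine ⟨QuotientGroup.mk ⟨k, hk⟩, ?_⟩
  refine QuotientGroup.eq.2 ?_
  change k⁻¹ * (k * x) ∈ H
  rwa [inv_mul_cancel_left]

/-- A finite `p`-subgroup whose centralizer has a `p`-subgroup outside of it is well placed if all
larger `p`-subgroups are, and if it is link connected. -/
theorem isGood_of_isLinkConnected {P : Subgroup G} (hP : IsFinP p P) {k : ℕ}
    (hbdd : ∀ A : Subgroup G, IsFinP p A → Nat.card A ≤ k)
    (hgood : ∀ U : Subgroup G, IsFinP p U → P < U → IsGood p U)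
    (hconn : IsLinkConnected p P)
    {A : Subgroup G} (hA : IsFinP p A) (hAC : A ≤ Subgroup.centralizer (P : Set G))
    (hAP : ¬ A ≤ P) : IsGood p P := by
  obtain ⟨B, hBN, hB, hmax⟩ : ∃ B ≤ Subgroup.normalizer (P : Set G), IsFinP p B ∧
      ∀ A ≤ Subgroup.normalizer (P : Set G), IsFinP p A → Nat.card A ≤ Nat.card B := by
    set s : Set ℕ := {n | ∃ A ≤ Subgroup.normalizer (P : Set G), IsFinP p A ∧ Nat.card A = n}
    have hs : BddAbove s := ⟨k, by rintro _ ⟨A, -, hA, rfl⟩; exact hbdd A hA⟩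
    obtain ⟨B, hBN, hB, hc⟩ := Nat.sSup_mem (s := s) ⟨_, P, Subgroup.le_normalizer, hP, rfl⟩ hs
    exact ⟨B, hBN, hB, fun A hAN hA => by rw [hc]; exact le_csSup hs ⟨A, hAN, hA, rfl⟩⟩
  have hAN := hAC.trans (centralizer_le_normalizer P)
  have := hB.1
  have hPB : P ≤ B := by
    have h1 := hB.sup hP hBN
    have := h1.1
    have h2 := Subgroup.eq_of_le_of_card_ge le_sup_left
      (hmax (B ⊔ P) (sup_le hBN Subgroup.le_normalizer) h1)
    rw [h2]
    exact le_sup_right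
  have hPB' : P < B := by
    refine lt_of_le_of_ne hPB fun h => hAP ?_
    subst h
    have h1 := hA.sup hP hAN
    have := h1.1
    rw [Subgroup.eq_of_le_of_card_ge le_sup_right (hmax (A ⊔ P) (sup_le hAN hBN) h1)]
    exact le_sup_left
  have hinto : ∀ A ≤ Subgroup.normalizer (P : Set G), IsFinP p A →
      ∃ n ∈ Subgroup.normalizer (P : Set G), MulAut.conj n • A ≤ B := by
    intro A hAN hA
    by_cases hAP : A ≤ P
    · exact ⟨1, one_mem _, by rw [conj_one_smul]; exact hAP.trans hPB⟩
    · obtain ⟨n, hn, h⟩ := exists_conj_le_of_isLinkConnected hgood hBN hB hPB' hmax hconn (A ⊔ P)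
        (hA.sup hP hAN) (lt_of_le_of_ne le_sup_right fun h => hAP (h ▸ le_sup_left))
      exact ⟨n, hn, (conj_smul_mono (le_inf le_sup_left hAN)).trans h⟩
  -- `Q` exceeds `P` because the subgroup `A` of `C(P)` outside `P` is conjugate into `B` under
  -- `N(P)`, which normalises `P` and `C(P)`.
  obtain ⟨Q, hQ⟩ : ∃ Q, Q = P ⊔ B ⊓ Subgroup.centralizer (P : Set G) := ⟨_, rfl⟩
  have hPQ : P < Q := by
    refine lt_of_le_of_ne (hQ ▸ le_sup_left) fun h => hAP ?_
    obtain ⟨n, hn, hnA⟩ := hinto A hAN hA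
    have h1 : MulAut.conj n • A ≤ P := by
      rw [h, hQ]
      refine le_trans (le_inf hnA ?_) le_sup_right
      rw [← conj_smul_centralizer_eq_of_mem_normalizer hn]
      exact conj_smul_mono hAC
    rw [conj_smul_le_iff] at h1
    rwa [mem_normalizer_iff_conj.1 (inv_mem hn)] at h1
  have hQB : Q ≤ B := hQ ▸ sup_le hPB inf_le_left
  have hBQ : B ≤ Subgroup.normalizer (Q : Set G) := hQ ▸ sup_inf_centralizer_le_normalizer hBN
  set M := Subgroup.normalizer (Q : Set G) ⊓ Subgroup.normalizer (P : Set G) with hM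
  have hMC : M ≤ Subgroup.normalizer
      ((Subgroup.centralizer (P : Set G) : Subgroup G) : Set G) :=
    le_normalizer_centralizer_of_le inf_le_right
  -- The Frattini factorisation, obtained with `J = M C(P)`.
  have hNJ : Subgroup.normalizer (P : Set G) ≤ M ⊔ Subgroup.centralizer (P : Set G) :=
    normalizer_le_of_isLinkConnected hgood hBN hB hPB' hQ hPQ
      (sup_le (le_trans (le_inf (hPB.trans hBQ) Subgroup.le_normalizer) le_sup_left) le_sup_right)
      le_sup_left hinto hconn
  intro L hCL hLN
  have hCC := Subgroup.centralizer_le (G := G) (SetLike.coe_subset_coe.2 hPQ.le)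
  -- A Sylow subgroup of `L ⊓ N(Q)` also serves `L`: writing a conjugator into `B` as `m c`, the
  -- factor `c` lies in `L` and already moves the `p`-subgroup into `N(Q)`.
  obtain ⟨K, hK, hindex⟩ := hgood Q (hB.mono hQB) hPQ (L ⊓ Subgroup.normalizer (Q : Set G))
    (le_inf (hCC.trans hCL) (centralizer_le_normalizer Q)) inf_le_right
  refine ⟨K, ⟨hK.1.trans inf_le_left, hK.2.1, fun A hAL hA => ?_⟩, fun hp => hindex ?_⟩
  · obtain ⟨n, hn, hnA⟩ := hinto A (hAL.trans hLN) hA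
    obtain ⟨m, hm, c, hc, rfl⟩ := exists_mul_of_mem_sup hMC (hNJ hn)
    rw [conj_mul_smul, conj_smul_le_iff] at hnA
    obtain ⟨l, hl, hlA⟩ := hK.2.2 (MulAut.conj c • A)
      (le_inf (conj_smul_le_of_mem (hCL hc) hAL)
        (hnA.trans (conj_smul_le_of_mem (inv_mem hm.1) hBQ))) (hA.conj c)
    exact ⟨l * c, mul_mem hl.1 (hCL hc), by rwa [conj_mul_smul]⟩
  · rw [relIndex_eq_of_forall_exists_mul (K := L ⊓ Subgroup.normalizer (Q : Set G)) inf_le_left]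
      at hp
    · exact hp.trans (Subgroup.relIndex_dvd_of_le_left _ (sup_le_sup_left hCC _))
    · intro l hl
      obtain ⟨m, hm, c, hc, rfl⟩ := exists_mul_of_mem_sup hMC (hNJ (hLN hl))
      exact ⟨m, ⟨(Subgroup.mul_mem_cancel_right _ (hCL hc)).1 hl, hm.1⟩, c,
        Subgroup.mem_sup_right hc, rfl⟩

end Extension

/-! ### Essential subgroups of finite groups and Alperin's fusion theorem. -/

section StronglyEmbedded

/-- The image of `H` is strongly embedded: the last hypothesis makes `P` a Sylow `p`-subgroup of the
intersection of `H` with its conjugate, and `P` dies in `O`, so the image of this intersection has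
order prime to `p`. -/
theorem hasStronglyEmbedded_of_surjective {p : ℕ} [Fact p.Prime] {N O : Type*} [Group N] [Finite N]
    [Group O] (f : N →* O) (hf : Function.Surjective f) {H P : Subgroup N} [P.Normal]
    (hP : IsPGroup p P) (hPf : P ≤ f.ker) (hfH : f.ker ≤ H) (hH : H ≠ ⊤)
    (hB : ∃ B : Sylow p N, (B : Subgroup N) ≤ H)
    (hU : ∀ n ∉ H, ∀ U : Subgroup N, IsPGroup p U → P ≤ U → U ≤ H → U ≤ MulAut.conj n • H → U ≤ P) :
    HasStronglyEmbedded p O := by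
  have hcomap : (H.map f).comap f = H := Subgroup.comap_map_eq_self hfH
  refine ⟨H.map f, lt_top_iff_ne_top.2 fun h => hH ?_, ?_, fun g hg hdvd => ?_⟩
  · rw [← hcomap, h, Subgroup.comap_top]
  · obtain ⟨B, hB⟩ := hB
    exact ⟨B.mapSurjective hf, by rw [Sylow.coe_mapSurjective]; exact Subgroup.map_mono hB⟩
  · obtain ⟨n, rfl⟩ := hf g
    have hn : n⁻¹ ∉ H := fun h => hg ⟨n, by simpa using inv_mem h, rfl⟩
    set W := H ⊓ MulAut.conj n⁻¹ • H with hW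
    have hker : f.ker ≤ MulAut.conj n⁻¹ • H := by
      rw [← conj_smul_le_iff, Subgroup.Normal.conj_smul_eq_self]
      exact hfH
    have hmap : H.map f ⊓ (H.map f).map (MulAut.conj (f n)⁻¹).toMonoidHom = W.map f := by
      apply le_antisymm
      · rintro _ ⟨⟨x, hx, rfl⟩, _, ⟨y, hy, rfl⟩, hxy⟩
        refine ⟨x, ⟨hx, ?_⟩, rfl⟩
        have h1 : f (n⁻¹ * y * n) = f x := by
          rw [← hxy]; simp
        have h2 : (n⁻¹ * y * n)⁻¹ * x ∈ f.ker := by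
          rw [MonoidHom.mem_ker, map_mul, map_inv, h1, inv_mul_cancel]
        have h3 := mul_mem (mem_conj_smul.2 (by simpa [mul_assoc] using hy) :
          n⁻¹ * y * n ∈ MulAut.conj n⁻¹ • H) (hker h2)
        rwa [mul_inv_cancel_left] at h3
      · rintro _ ⟨x, ⟨hx, hx'⟩, rfl⟩
        refine ⟨⟨x, hx, rfl⟩, f (n * x * n⁻¹), ⟨n * x * n⁻¹, ?_, rfl⟩, by simp [mul_assoc]⟩
        simpa using mem_conj_smul.1 hx'
    rw [hmap, ← Subgroup.relIndex_ker] at hdvd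
    have hPW : P ≤ W := hPf.trans (le_inf hfH hker)
    obtain ⟨Q, hQ⟩ := (hP.comap_subtype (K := W)).exists_le_sylow
    have hQP : (Q : Subgroup W) = P.subgroupOf W := by
      refine le_antisymm (Subgroup.map_le_iff_le_comap.1 ?_) hQ
      refine hU n⁻¹ hn _ (Q.isPGroup'.map W.subtype) ?_ ?_ ?_
      · intro x hx
        exact ⟨⟨x, hPW hx⟩, hQ (show _ ∈ P from hx), rfl⟩
      · exact (Subgroup.map_subtype_le _).trans inf_le_left
      · exact (Subgroup.map_subtype_le _).trans inf_le_right
    have h2 := Q.not_dvd_index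
    rw [hQP] at h2
    exact h2 (hdvd.trans (Subgroup.relIndex_dvd_of_le_left W hPf))

end StronglyEmbedded

section Essential

variable {p : ℕ} [Fact p.Prime] {X : Type*} [Group X]

theorem mem_map_subtype_normalizer {A : Subgroup X} {Q : Subgroup A} {g : X}
    (h : ∀ x : Q, g * ((x : A) : X) * g⁻¹ ∈ Q.map A.subtype)
    (h' : ∀ x : Q, g⁻¹ * ((x : A) : X) * g ∈ Q.map A.subtype) :
    g ∈ Subgroup.normalizer ((Q.map A.subtype : Subgroup X) : Set X) := by
  rw [Subgroup.mem_normalizer_iff]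
  intro x
  constructor
  · rintro ⟨y, hy, rfl⟩
    exact h ⟨y, hy⟩
  · rintro ⟨y, hy, hxy⟩
    have h1 := h' ⟨y, hy⟩
    change g⁻¹ * (A.subtype y) * g ∈ _ at h1
    rw [hxy] at h1
    simpa [mul_assoc] using h1

/-- The action of the normalizer of `Q` on `Q` by automorphisms of the fusion system. -/
theorem exists_normalizer_hom_aut (A : Subgroup X) (Q : Subgroup A) :
    ∃ f : Subgroup.normalizer ((Q.map A.subtype : Subgroup X) : Set X) →* (groupFusion X A).aut Q,
      Function.Surjective f ∧
      ∀ n (x : Q), ((((f n : MulAut Q) x : Q) : A) : X) = n * ((x : A) : X) * (n : X)⁻¹ := by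
  let e : Q ≃* Q.map A.subtype := Q.equivMapOfInjective A.subtype A.subtype_injective
  have he : ∀ x, ((e x : Q.map A.subtype) : X) = ((x : A) : X) := fun x => rfl
  let θ : Subgroup.normalizer ((Q.map A.subtype : Subgroup X) : Set X) →* MulAut Q :=
    (MulAut.congr e.symm).toMonoidHom.comp (Q.map A.subtype).normalizerMonoidHom
  have hθ : ∀ n (x : Q), (((θ n x : Q) : A) : X) = n * ((x : A) : X) * (n : X)⁻¹ := by
    intro n x
    rw [← he]
    change ((e (e.symm ((Q.map A.subtype).normalizerMonoidHom n (e x))) : Q.map A.subtype) : X) = _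
    rw [e.apply_symm_apply]
    rfl
  have hmem : ∀ n, θ n ∈ (groupFusion X A).aut Q := by
    intro n
    -- Morphisms of `groupFusion` have the form `x ↦ g⁻¹ x g`, so left conjugation by `n` is
    -- witnessed by `n⁻¹`.
    refine ⟨⟨(n : X)⁻¹, fun x => ?_⟩, ⟨n, fun x => ?_⟩⟩
    · rw [inv_inv]; exact hθ n x
    · have := hθ n ((θ n).symm x)
      rw [show θ n ((θ n).symm x) = x from (θ n).apply_symm_apply x] at this
      change ((((θ n).symm x : Q) : A) : X) = _
      rw [this]
      group
  refine ⟨θ.codRestrict _ hmem, ?_, hθ⟩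
  rintro ⟨α, ⟨g, hg⟩, ⟨k, hk⟩⟩
  have hg' : ∀ x : Q, (((α x : Q) : A) : X) = g⁻¹ * ((x : A) : X) * g := hg
  have hginv : ∀ x : Q, (((α.symm x : Q) : A) : X) = g * ((x : A) : X) * g⁻¹ := by
    intro x
    have := hg' (α.symm x)
    rw [α.apply_symm_apply] at this
    rw [this]; group
  have hN : g⁻¹ ∈ Subgroup.normalizer ((Q.map A.subtype : Subgroup X) : Set X) := by
    refine mem_map_subtype_normalizer (fun x => ?_) fun x => ?_
    · rw [inv_inv, ← hg']
      exact ⟨_, (α x).2, rfl⟩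
    · rw [inv_inv, ← hginv]
      exact ⟨_, (α.symm x).2, rfl⟩
  refine ⟨⟨g⁻¹, hN⟩, Subtype.ext (MulEquiv.ext fun x => ?_)⟩
  apply Subtype.ext
  apply Subtype.ext
  change (((θ ⟨g⁻¹, hN⟩ x : Q) : A) : X) = _
  rw [hθ, hg', inv_inv]

omit [Fact p.Prime] in
theorem isCentric_of_forall_le {A : Subgroup X} [Finite A] (hA : IsPGroup p A) {Q : Subgroup A}
    (h : ∀ D : Subgroup X, IsFinP p D →
      D ≤ Subgroup.centralizer ((Q.map A.subtype : Subgroup X) : Set X) → D ≤ Q.map A.subtype) :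
    (groupFusion X A).IsCentric Q := by
  rintro R ⟨φ, ⟨g, hg⟩, -⟩
  have hg' : ∀ x : Q, (((φ x : R) : A) : X) = g⁻¹ * ((x : A) : X) * g := hg
  intro y hy
  set D := (Subgroup.centralizer (R : Set A)).map A.subtype with hD
  have hDp : IsFinP p D := IsFinP.map ⟨inferInstance, hA.to_subgroup _⟩ _
  have h1 : MulAut.conj g • D ≤ Q.map A.subtype := by
    refine h _ (hDp.conj g) fun z hz => ?_
    obtain ⟨d, hd, hdz⟩ := mem_conj_smul.1 hz
    rw [Subgroup.mem_centralizer_iff]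
    rintro _ ⟨x, hx, rfl⟩
    have h2 := congrArg (Subtype.val : A → X) (Subgroup.mem_centralizer_iff.1 hd (φ ⟨x, hx⟩)
      (φ ⟨x, hx⟩).2)
    have hdz' : (d : X) = g⁻¹ * z * g := hdz
    rw [Subgroup.coe_mul, Subgroup.coe_mul, hg', hdz'] at h2
    have h3 : g⁻¹ * ((x : X) * z) * g = g⁻¹ * (z * (x : X)) * g := by
      simpa [mul_assoc] using h2
    exact mul_left_cancel (mul_right_cancel h3)
  have hyD : (y : X) ∈ D := ⟨y, hy, rfl⟩
  obtain ⟨x, hx, hxy⟩ := h1 (mem_conj_smul.2 (by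
    rwa [show g⁻¹ * (g * (y : X) * g⁻¹) * g = y by group]) : g * y * g⁻¹ ∈ MulAut.conj g • D)
  have h4 : y = φ ⟨x, hx⟩ := by
    apply Subtype.ext
    rw [hg']
    change (y : X) = g⁻¹ * A.subtype x * g
    rw [hxy]; group
  rw [h4]
  exact (φ ⟨x, hx⟩).2

/-- Converts a subgroup of `N(P)` with the strong embedding property relative to `P` into one of
`Out(P)`. The kernel of `N(P) → Out(P)` is contained in `P C(P)`, hence in `H`. -/
theorem isEssential_of_le [Finite X] {A : Subgroup X} (hA : IsPGroup p A) {Q : Subgroup A}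
    {P H B : Subgroup X} (hP : P = Q.map A.subtype)
    (hPH : P ⊔ Subgroup.centralizer (P : Set X) ≤ H)
    (hHN : ¬ Subgroup.normalizer (P : Set X) ≤ H)
    (hB : IsSyl p (Subgroup.normalizer (P : Set X)) B) (hBH : B ≤ H)
    (hU : ∀ n ∈ Subgroup.normalizer (P : Set X), n ∉ H → ∀ U : Subgroup X, IsFinP p U → P ≤ U →
      U ≤ H → U ≤ MulAut.conj n • H → U ≤ P)
    (hC : ∀ D : Subgroup X, IsFinP p D → D ≤ Subgroup.centralizer (P : Set X) → D ≤ P) :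
    (groupFusion X A).IsEssential p Q := by
  subst hP
  refine ⟨isCentric_of_forall_le hA hC, ?_⟩
  obtain ⟨f, hf, hfn⟩ := exists_normalizer_hom_aut A Q
  let P := Q.map A.subtype
  let N := Subgroup.normalizer (P : Set X)
  let π := QuotientGroup.mk' ((innerAut Q).subgroupOf ((groupFusion X A).aut Q))
  have hQp : IsPGroup p P := (hA.to_subgroup Q).map A.subtype
  have hPker : P.subgroupOf N ≤ (π.comp f).ker := by
    rintro ⟨n, hn⟩ ⟨q, hq, rfl⟩
    rw [MonoidHom.mem_ker, MonoidHom.comp_apply, QuotientGroup.mk'_apply, QuotientGroup.eq_one_iff]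
    refine ⟨⟨q, hq⟩, MulEquiv.ext fun x => ?_⟩
    apply Subtype.ext
    apply Subtype.ext
    change _ = (((((f ⟨A.subtype q, hn⟩ : (groupFusion X A).aut Q) : MulAut Q) x : Q) : A) : X)
    rw [hfn]
    rfl
  have hkerH : (π.comp f).ker ≤ H.subgroupOf N := by
    intro n hn
    rw [MonoidHom.mem_ker, MonoidHom.comp_apply, QuotientGroup.mk'_apply,
      QuotientGroup.eq_one_iff] at hn
    obtain ⟨q, hq⟩ := hn
    have hq' : ∀ x : Q, ((q : A) : X) * ((x : A) : X) * ((q : A) : X)⁻¹ =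
        n * ((x : A) : X) * (n : X)⁻¹ := by
      intro x
      rw [← hfn n x]
      have := congrArg (fun α : MulAut Q => (((α x : Q) : A) : X)) hq
      exact this
    have hc : ((q : A) : X)⁻¹ * n ∈ Subgroup.centralizer (P : Set X) := by
      rw [mem_centralizer_iff_conj]
      rintro _ ⟨x, hx, rfl⟩
      have := hq' ⟨x, hx⟩
      calc ((q : A) : X)⁻¹ * n * A.subtype x * (((q : A) : X)⁻¹ * n)⁻¹
          = ((q : A) : X)⁻¹ * (n * (x : X) * (n : X)⁻¹) * ((q : A) : X) := by
            rw [mul_inv_rev, inv_inv]; simp [mul_assoc]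
        _ = A.subtype x := by rw [← this]; simp [mul_assoc]
    have := mul_mem (hPH (Subgroup.mem_sup_left (⟨q, q.2, rfl⟩ : ((q : A) : X) ∈ P)))
      (hPH (Subgroup.mem_sup_right hc))
    rw [mul_inv_cancel_left] at this
    exact this
  have : (P.subgroupOf N).Normal := Subgroup.normal_in_normalizer
  refine hasStronglyEmbedded_of_surjective (P := P.subgroupOf N) (π.comp f) ((QuotientGroup.mk'_surjective _).comp hf)
    (hQp.comap_subtype (K := N)) hPker hkerH (fun h => hHN (Subgroup.subgroupOf_eq_top.1 h)) ?_ ?_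
  · obtain ⟨S, hS⟩ := (hB.2.1.2.comap_subtype (K := N)).exists_le_sylow
    refine ⟨S, ?_⟩
    refine Subgroup.map_le_iff_le_comap.1 ?_
    refine le_trans (le_of_eq (hB.le_of_le (Subgroup.map_subtype_le _)
      (IsFinP.map ⟨inferInstance, S.isPGroup'⟩ _) fun x hx => ?_)) hBH
    exact ⟨⟨x, hB.1 hx⟩, hS (show x ∈ B from hx), rfl⟩
  · intro n hn U hUp hPU hUH hUn
    refine Subgroup.map_le_iff_le_comap.1 ?_
    refine hU n n.2 hn _ (IsFinP.map ⟨inferInstance, hUp⟩ _) ?_ ?_ ?_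
    · intro x hx
      exact ⟨⟨x, Subgroup.le_normalizer hx⟩, hPU (show x ∈ P from hx), rfl⟩
    · rw [Subgroup.map_le_iff_le_comap]
      exact hUH
    · rintro _ ⟨u, hu, rfl⟩
      have h1 := mem_conj_smul.1 (hUn hu)
      exact mem_conj_smul.2 h1

theorem isSyl_of_le_of_le [Finite X] {N H B : Subgroup X} (hB : IsSyl p N B) (hBH : B ≤ H)
    (hHN : H ≤ N) : IsSyl p H B := by
  obtain ⟨K, hK⟩ := exists_isSyl (p := p) H
  refine hK.of_card_le hBH hB.2.1 ?_
  obtain ⟨n, -, hn⟩ := hB.2.2 K (hK.1.trans hHN) hK.2.1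
  rw [← card_conj_smul n]
  exact Subgroup.card_le_of_le hn

/-- Sylow subgroups containing a non-essential subgroup are linked (Alperin's fusion theorem). -/
theorem isLinkConnected_of_not_isEssential [Finite X] {A : Subgroup X} (hA : IsPGroup p A)
    {Q : Subgroup A} (hQ : ¬ (groupFusion X A).IsEssential p Q) :
    IsLinkConnected p (Q.map A.subtype) := by
  by_contra hconn
  obtain ⟨P, hP⟩ : ∃ P, P = Q.map A.subtype := ⟨_, rfl⟩
  rw [← hP] at hconn
  have hPp : IsFinP p P := hP ▸ IsFinP.map ⟨inferInstance, hA.to_subgroup Q⟩ _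
  obtain ⟨B, hB⟩ := exists_isSyl (p := p) (Subgroup.normalizer (P : Set X))
  have hlink : ∀ {D E : Subgroup X}, IsFinP p D → IsFinP p E → P < D → D ≤ E →
      Relation.ReflTransGen (Link p P) D E := fun hD hE hPD h =>
    .single (Link.of_le hD hE hPD h)
  have hconj : ∀ {n : X} {D E : Subgroup X}, n ∈ Subgroup.normalizer (P : Set X) →
      Relation.ReflTransGen (Link p P) D E →
      Relation.ReflTransGen (Link p P) (MulAut.conj n • D) (MulAut.conj n • E) := by
    intro n D E hn h
    have := reflTransGen_link_conj h n
    rwa [mem_normalizer_iff_conj.1 hn] at this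
  have hPB : P < B := by
    unfold IsLinkConnected at hconn
    push Not at hconn
    obtain ⟨D, -, hD, -, hPD, -, -⟩ := hconn
    have h1 := lt_inf_normalizer hD hPD
    obtain ⟨n, hn, h⟩ := hB.2.2 _ inf_le_right (hD.mono inf_le_left)
    exact (conj_smul_lt_of_mem_normalizer hn h1).trans_le h
  have hPn : ∀ {n : X}, n ∈ Subgroup.normalizer (P : Set X) → P < MulAut.conj n • B :=
    fun hn => conj_smul_lt_of_mem_normalizer hn hPB
  -- `H` is the stabilizer of the link component of `B`. It is proper because not everything is
  -- linked, and a `p`-subgroup above `P` in `H` and in a conjugate `n H n⁻¹` would link `B` with `n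
  -- B n⁻¹`. So `H` has the strong embedding property unless `P` fails to be centric.
  let H : Subgroup X :=
    { carrier := {n | n ∈ Subgroup.normalizer (P : Set X) ∧
        Relation.ReflTransGen (Link p P) (MulAut.conj n • B) B}
      mul_mem' := by
        rintro n m ⟨hn, hnB⟩ ⟨hm, hmB⟩
        refine ⟨mul_mem hn hm, ?_⟩
        rw [conj_mul_smul]
        exact (hconj hn hmB).trans hnB
      one_mem' := ⟨one_mem _, by rw [conj_one_smul]⟩
      inv_mem' := by
        rintro n ⟨hn, hnB⟩
        refine ⟨inv_mem hn, ?_⟩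
        have := hconj (inv_mem hn) hnB
        rw [conj_inv_smul_smul] at this
        exact reflTransGen_link_symm this }
  have hHN : H ≤ Subgroup.normalizer (P : Set X) := fun n hn => hn.1
  have hmemH : ∀ {n}, n ∈ H → Relation.ReflTransGen (Link p P) (MulAut.conj n • B) B :=
    fun hn => hn.2
  have hBH : B ≤ H := fun b hb => ⟨hB.1 hb, by rw [conj_smul_eq_of_mem hb]⟩
  have hCH : P ⊔ Subgroup.centralizer (P : Set X) ≤ H :=
    sup_le (hPB.le.trans hBH) fun c hc => ⟨centralizer_le_normalizer P hc,
      reflTransGen_link_symm (.single (Link.of_conj hB.2.1 hPB hc))⟩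
  have hBsyl := isSyl_of_le_of_le hB hBH hHN
  have hNH : ¬ Subgroup.normalizer (P : Set X) ≤ H := by
    intro h
    refine hconn fun D E hD hE hPD hPE => ?_
    have key : ∀ D : Subgroup X, IsFinP p D → P < D → Relation.ReflTransGen (Link p P) D B := by
      intro D hD hPD
      obtain ⟨n, hn, hnD⟩ := hB.2.2 _ inf_le_right (hD.mono inf_le_left :
        IsFinP p (D ⊓ Subgroup.normalizer (P : Set X)))
      rw [conj_smul_le_iff] at hnD
      have h1 := lt_inf_normalizer hD hPD
      exact ((reflTransGen_link_symm (hlink (hD.mono inf_le_left) hD h1 inf_le_left)).trans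
        (hlink (hD.mono inf_le_left) (hB.2.1.conj _) h1 hnD)).trans (hmemH (h (inv_mem hn)))
    exact (key D hD hPD).trans (reflTransGen_link_symm (key E hE hPE))
  have hUB : ∀ U : Subgroup X, IsFinP p U → P < U → U ≤ H →
      Relation.ReflTransGen (Link p P) U B := by
    intro U hU hPU hUH
    obtain ⟨k, hk, hkU⟩ := hBsyl.2.2 U hUH hU
    rw [conj_smul_le_iff] at hkU
    exact (hlink hU (hB.2.1.conj _) hPU hkU).trans (hmemH (inv_mem hk))
  refine hQ (isEssential_of_le hA hP hCH hNH hB hBH ?_ ?_)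
  · intro n hn hnH U hU hPU hUH hUn
    by_contra hUP
    have hPU' : P < U := lt_of_le_not_ge hPU hUP
    rw [← conj_inv_smul_le] at hUn
    have h1 := hUB _ (hU.conj n⁻¹) (conj_smul_lt_of_mem_normalizer (inv_mem hn) hPU') hUn
    have h2 := hconj hn h1
    rw [← conj_mul_smul, mul_inv_cancel, conj_one_smul] at h2
    exact hnH ⟨hn, (reflTransGen_link_symm h2).trans (hUB U hU hPU' hUH)⟩
  · intro D hD hDC
    by_contra hDP
    have hCN := sup_centralizer_le_normalizer P
    -- The non-centric case is a Frattini argument: a Sylow subgroup `E` of `P C(P)` exceeds `P`, so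
    -- the elements of `N(P)` that normalise a conjugate of `E` inside `B` preserve the link
    -- component of `B`. Together with `P C(P)` they generate `N(P)`, which contradicts `H < N(P)`.
    obtain ⟨E, hE⟩ := exists_isSyl (p := p) (P ⊔ Subgroup.centralizer (P : Set X))
    have hPE : P < E := by
      obtain ⟨l, hl, hlD⟩ := hE.2.2 (D ⊔ P) (sup_le (hDC.trans le_sup_right) le_sup_left)
        (hD.sup hPp (hDC.trans (centralizer_le_normalizer P)))
      exact (conj_smul_lt_of_mem_normalizer (hCN hl)
        (lt_of_le_of_ne le_sup_right fun h => hDP (h ▸ le_sup_left))).trans_le hlD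
    obtain ⟨k, hk, hkE⟩ := hB.2.2 E (hE.1.trans hCN) hE.2.1
    have hPkE := conj_smul_lt_of_mem_normalizer hk hPE
    have key : ∀ n ∈ Subgroup.normalizer (P : Set X), k * n ∈ H := by
      intro n hn
      obtain ⟨x, hx, hxE⟩ := hE.2.2 (MulAut.conj n • MulAut.conj k • E)
        (by rw [← conj_mul_smul, ← conj_smul_sup_centralizer (mul_mem hn hk)]
            exact conj_smul_mono hE.1) ((hE.2.1.conj _).conj _)
      have h1 : MulAut.conj (k * (x * n)) • MulAut.conj k • E ≤ MulAut.conj k • E := by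
        rw [conj_mul_smul, conj_mul_smul x]
        exact conj_smul_mono hxE
      have h2 := conj_smul_mono (g := k * (x * n)) hkE
      have h3 := Subgroup.eq_of_le_of_card_ge h1 (card_conj_smul _ _).ge
      rw [h3] at h2
      have h4 : k * (x * n) ∈ H := ⟨mul_mem hk (mul_mem (hCN hx) hn),
        (reflTransGen_link_symm (hlink (hE.2.1.conj k) (hB.2.1.conj _) hPkE h2)).trans
          (hlink (hE.2.1.conj k) hB.2.1 hPkE hkE)⟩
      have h5 : k * x * k⁻¹ ∈ H := by
        apply hCH
        rw [← conj_smul_sup_centralizer hk, mem_conj_smul]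
        simpa [mul_assoc] using hx
      have h6 := mul_mem (inv_mem h5) h4
      rwa [show (k * x * k⁻¹)⁻¹ * (k * (x * n)) = k * n by group] at h6
    refine hNH fun n hn => ?_
    have h1 := key 1 (one_mem _)
    rw [mul_one] at h1
    exact (Subgroup.mul_mem_cancel_left _ h1).1 (key n hn)

/-- If a Sylow subgroup is not essential, then its automorphisms induced by conjugation are inner. -/
theorem normalizer_le_of_not_isEssential [Finite X] {A : Subgroup X} (hA : IsPGroup p A)
    {Q : Subgroup A} (hQ : ¬ (groupFusion X A).IsEssential p Q)
    (hsyl : IsSyl p ⊤ (Q.map A.subtype)) :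
    Subgroup.normalizer ((Q.map A.subtype : Subgroup X) : Set X) ≤
      Q.map A.subtype ⊔ Subgroup.centralizer ((Q.map A.subtype : Subgroup X) : Set X) := by
  by_contra h
  -- Here `H = P C(P)`, whose image in `Out(P)` is trivial. The trivial subgroup counts as strongly
  -- embedded in a nontrivial `p'`-group, as `p` need not divide its order.
  refine hQ (isEssential_of_le hA rfl le_rfl h
    (isSyl_of_le_of_le hsyl Subgroup.le_normalizer le_top) le_sup_left ?_ ?_)
  · intro n _ _ U hU hPU _ _
    exact (hsyl.le_of_le le_top hU hPU).le
  · intro D hD hDC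
    rw [← hsyl.le_of_le le_top (hD.sup hsyl.2.1 (hDC.trans (centralizer_le_normalizer _)))
      le_sup_right]
    exact le_sup_left

end Essential

/-! ### Trees: potentials, fixed points and fixed paths. -/

section Trees

variable {Y : Type*} {T : SimpleGraph Y}

theorem SimpleGraph.IsTree.eq_of_dist_eq_dist_add_one (hT : T.IsTree) {r v v' w : Y}
    (hv : T.Adj v w) (hv' : T.Adj v' w) (h : T.dist r w = T.dist r v + 1)
    (h' : T.dist r w = T.dist r v' + 1) : v = v' := by
  obtain ⟨q, hq⟩ := hT.1.exists_walk_length_eq_dist r v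
  obtain ⟨q', hq'⟩ := hT.1.exists_walk_length_eq_dist r v'
  have h1 : (q.concat hv).IsPath := SimpleGraph.Walk.isPath_of_length_eq_dist _ (by simp [hq, h])
  have h2 : (q'.concat hv').IsPath :=
    SimpleGraph.Walk.isPath_of_length_eq_dist _ (by simp [hq', h'])
  have h3 := (hT.existsUnique_path r w).unique h1 h2
  have h4 := congrArg SimpleGraph.Walk.penultimate h3
  simpa using h4

/-- The product of the labels along a walk. -/
def SimpleGraph.Walk.labelProd {Γ : Type*} [Group Γ] (σ : Y → Y → Γ) :
    ∀ {v w : Y}, T.Walk v w → Γ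
  | _, _, .nil => 1
  | w, _, .cons (v := v) _ q => σ v w * q.labelProd σ

/-- A potential on a rooted tree with prescribed increments along the edges leading away from the
root. -/
theorem SimpleGraph.IsTree.exists_potential (hT : T.IsTree) (r : Y) {Γ : Type*} [Group Γ]
    (σ : Y → Y → Γ) : ∃ τ : Y → Γ, ∀ v w, T.Adj v w → T.dist r w = T.dist r v + 1 →
      τ w = σ v w * τ v := by
  choose q hq using fun w => hT.1.exists_walk_length_eq_dist w r
  refine ⟨fun w => (q w).labelProd σ, fun v w hvw h => ?_⟩
  have h1 : (q w).IsPath := SimpleGraph.Walk.isPath_of_length_eq_dist _ (hq w)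
  have h2 : (SimpleGraph.Walk.cons hvw.symm (q v)).IsPath :=
    SimpleGraph.Walk.isPath_of_length_eq_dist _ (by
      rw [SimpleGraph.Walk.length_cons, hq, T.dist_comm, T.dist_comm (u := w), h])
  dsimp only
  rw [(hT.existsUnique_path w r).unique h1 h2]
  rfl

/-- A path that has begun to move away from `o` never turns back, since each vertex has at most one
neighbour nearer to `o`. -/
theorem SimpleGraph.IsTree.dist_add_length_le (hT : T.IsTree) (o : Y) {z y' : Y}
    (q : T.Walk z y') : ∀ (y : Y) (h : T.Adj y z), (SimpleGraph.Walk.cons h q).IsPath →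
      T.dist o z = T.dist o y + 1 → T.dist o z + q.length ≤ T.dist o y' := by
  induction q with
  | nil => intro y h _ _; simp
  | @cons z w y' hzw q ih =>
    intro y h hp hd
    have hwy : w ≠ y := by
      rintro rfl
      rw [SimpleGraph.Walk.cons_isPath_iff] at hp
      exact hp.2 (by simp)
    rcases hT.dist_eq_dist_add_one_of_adj o hzw with h1 | h1
    · exact absurd (hT.eq_of_dist_eq_dist_add_one hzw.symm h h1 hd) hwy
    · have := ih z hzw hp.of_cons h1
      rw [SimpleGraph.Walk.length_cons]
      omega

theorem SimpleGraph.Hom.dist_le (f : T →g T) (hT : T.IsTree) (x y : Y) :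
    T.dist (f x) (f y) ≤ T.dist x y := by
  obtain ⟨q, hq⟩ := hT.1.exists_walk_length_eq_dist x y
  rw [← hq, ← SimpleGraph.Walk.length_map f]
  exact SimpleGraph.dist_le _

/-- A group acting on a tree with a finite orbit and preserving a proper colouring fixes a
vertex. -/
theorem SimpleGraph.IsTree.exists_fixed (hT : T.IsTree) {A : Type*} [Group A] (f : A → T →g T)
    (hmul : ∀ a b x, f (a * b) x = f a (f b x)) (x₀ : Y)
    (hfin : (Set.range fun a => f a x₀).Finite) {κ : Type*} (c : Y → κ)
    (hc : ∀ x y, T.Adj x y → c x ≠ c y) (hcf : ∀ a x, c (f a x) = c x) :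
    ∃ x, ∀ a, f a x = x := by
  classical
  -- A centre of the orbit, that is a vertex minimising the greatest distance to it, is fixed. If
  -- `y` and its image `y'` were two centres, the first step from `y` towards `y'` would be strictly
  -- closer to every orbit point.
  have hex : ∃ n : ℕ, ∃ y, ∀ a, T.dist y (f a x₀) ≤ n := by
    obtain ⟨n, hn⟩ := (hfin.image (T.dist x₀)).bddAbove
    exact ⟨n, x₀, fun a => hn ⟨_, ⟨a, rfl⟩, rfl⟩⟩
  obtain ⟨y, hy⟩ := Nat.find_spec hex
  refine ⟨y, fun b => by_contra fun hb => ?_⟩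
  have hy' : ∀ a, T.dist (f b y) (f a x₀) ≤ Nat.find hex := by
    intro a
    have h1 := (f b).dist_le hT y (f (b⁻¹ * a) x₀)
    rw [← hmul, mul_inv_cancel_left] at h1
    exact h1.trans (hy _)
  have hcb := hcf b y
  generalize f b y = y' at hb hy' hcb
  obtain ⟨q, hq, -⟩ := hT.existsUnique_path y y'
  cases q with
  | nil => exact hb rfl
  | @cons _ z _ h q =>
    have hz : ∀ a, T.dist z (f a x₀) < Nat.find hex := by
      intro a
      have h1 := hy a
      have h2 := hy' a
      rw [T.dist_comm] at h1 h2 ⊢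
      rcases hT.dist_eq_dist_add_one_of_adj (f a x₀) h with h3 | h3
      · omega
      · have h4 := hT.dist_add_length_le (f a x₀) q y h hq h3
        -- The colouring prevents `y'` from being adjacent to `y`; this excludes the inversion of an
        -- edge.
        have h5 : 0 < q.length := by
          rw [Nat.pos_iff_ne_zero]
          intro h0
          have := SimpleGraph.Walk.eq_of_length_eq_zero h0
          exact hc _ _ h (by rw [this, hcb])
        omega
    have h0 := hz 1
    have h1 : Nat.find hex ≤ Nat.find hex - 1 :=
      Nat.find_min' hex ⟨z, fun a => Nat.le_sub_one_of_lt (hz a)⟩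
    omega

/-- Induction along the path between two fixed vertices of a tree. -/
theorem SimpleGraph.IsTree.fixed_induction (hT : T.IsTree) {ι : Type*} (f : ι → T →g T)
    (Q : Y → Prop) (hstep : ∀ u w, T.Adj u w → (∀ i, f i u = u) → (∀ i, f i w = w) → Q u → Q w)
    {x y : Y} (hx : ∀ i, f i x = x) (hy : ∀ i, f i y = y) (hinj : ∀ i, Function.Injective (f i))
    (hQ : Q x) : Q y := by
  obtain ⟨q, hq, huniq⟩ := hT.existsUnique_path x y
  -- The image of the path is again a path between the same ends, so by uniqueness it is the same
  -- path, vertex by vertex.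
  have hfix : ∀ u ∈ q.support, ∀ i, f i u = u := by
    intro u hu i
    have h1 := huniq ((q.map (f i)).copy (hx i) (hy i)) (by
      refine (SimpleGraph.Walk.isPath_copy _ _ _).2 ?_
      exact SimpleGraph.Walk.IsPath.map (hinj i) hq)
    have h2 := congrArg SimpleGraph.Walk.support h1
    rw [SimpleGraph.Walk.support_copy, SimpleGraph.Walk.support_map] at h2
    exact List.map_inj_left.1 (h2.trans (List.map_id _).symm) u hu
  clear huniq hq hx hy
  induction q with
  | nil => exact hQ
  | cons h q ih =>
    exact ih (hstep _ _ h (hfix _ (by simp)) (hfix _ (by simp)) hQ)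
      fun u hu => hfix u (by simp [hu])

end Trees

/-! ### Free actions of a group with infinitely many orbits. -/

section FreeActions

/-- Two free actions with infinitely many orbits of a countable group are isomorphic; here the
regular action of an overgroup is compared with that of the subgroup. -/
theorem exists_equiv_prod_nat {K H : Type*} [Group K] [Group H] [Countable H] (i : K →* H)
    (hi : Function.Injective i) :
    ∃ e : H × ℕ ≃ K × ℕ, ∀ k h n, e (i k * h, n) = (k * (e (h, n)).1, (e (h, n)).2) := by
  classical
  have hmem : ∀ h : H, ∃ k : K, i k = h * ((h⁻¹ : H) : H ⧸ i.range).out := by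
    intro h
    obtain ⟨k, hk⟩ := QuotientGroup.mk_out_eq_mul i.range h⁻¹
    obtain ⟨k', hk'⟩ := k.2
    exact ⟨k', by rw [hk, hk', mul_inv_cancel_left]⟩
  choose κ hκ using hmem
  let e₁ : H ≃ (H ⧸ i.range) × K :=
    { toFun := fun h => (((h⁻¹ : H) : H ⧸ i.range), κ h)
      invFun := fun x => i x.2 * x.1.out⁻¹
      left_inv := fun h => by simp [hκ]
      right_inv := by
        rintro ⟨c, k⟩
        have h1 : (((i k * c.out⁻¹)⁻¹ : H) : H ⧸ i.range) = c := by
          conv_rhs => rw [← QuotientGroup.out_eq' c]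
          rw [QuotientGroup.eq]
          exact ⟨k, by group⟩
        refine Prod.ext h1 (hi ?_)
        dsimp only
        rw [hκ, h1]
        group }
  have he₁ : ∀ k h, e₁ (i k * h) = ((e₁ h).1, k * (e₁ h).2) := by
    intro k h
    have h1 : (((i k * h)⁻¹ : H) : H ⧸ i.range) = ((h⁻¹ : H) : H ⧸ i.range) :=
      QuotientGroup.eq.2 ⟨k, by group⟩
    refine Prod.ext h1 (hi ?_)
    change i (κ (i k * h)) = i (k * κ h)
    rw [map_mul, hκ, hκ, h1, mul_assoc]
  -- The factor `ℕ` makes the number of orbits countably infinite on both sides, whatever the index.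
  obtain ⟨d⟩ : Nonempty (((H ⧸ i.range) × ℕ) ≃ ℕ) := by
    have : Countable (H ⧸ i.range) := Quotient.countable
    exact nonempty_equiv_of_countable
  refine ⟨{ toFun := fun x => ((e₁ x.1).2, d ((e₁ x.1).1, x.2))
            invFun := fun y => (e₁.symm ((d.symm y.2).1, y.1), (d.symm y.2).2)
            left_inv := fun x => by simp
            right_inv := fun y => by simp }, fun k h n => ?_⟩
  simp [he₁]

end FreeActions

/-! ### The completion, its vertex groups and the connectedness of the orbit graph. -/

namespace TreeOfGroups

variable {V : Type u₁} {T : SimpleGraph V} (𝒢 : TreeOfGroups.{u₁, u₂, u₃} T)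

theorem exists_lift {Γ : Type*} [Group Γ] (ψ : ∀ v, 𝒢.vertexGroup v →* Γ)
    (h : ∀ (v w : V) (hvw : T.Adj v w) (x : 𝒢.edgeGroup ⟨s(v, w), hvw⟩),
      ψ v (𝒢.hom ⟨s(v, w), hvw⟩ v (Sym2.mem_mk_left v w) x) =
        ψ w (𝒢.hom ⟨s(v, w), hvw⟩ w (Sym2.mem_mk_right v w) x)) :
    ∃ Ψ : 𝒢.Completion →* Γ, ∀ v x, Ψ (𝒢.vertexMap v x) = ψ v x := by
  have hle : Subgroup.normalClosure 𝒢.relators ≤ (Monoid.CoprodI.lift ψ).ker := by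
    refine Subgroup.normalClosure_le_normal ?_
    rintro _ ⟨⟨e, he⟩, v, w, hv, hw, x, rfl⟩
    rw [SetLike.mem_coe, MonoidHom.mem_ker, map_mul, map_inv, Monoid.CoprodI.lift_of,
      Monoid.CoprodI.lift_of, mul_inv_eq_one]
    by_cases hvw : v = w
    · subst hvw; rfl
    · obtain rfl : e = s(v, w) := ((Sym2.mem_and_mem_iff hvw).1 ⟨hv, hw⟩)
      exact h v w he x
  refine ⟨QuotientGroup.lift _ (Monoid.CoprodI.lift ψ) hle, fun v x => ?_⟩
  change Monoid.CoprodI.lift ψ (Monoid.CoprodI.of x) = _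
  rw [Monoid.CoprodI.lift_of]

theorem completion_induction {q : 𝒢.Completion → Prop} (one : q 1)
    (of : ∀ v x, q (𝒢.vertexMap v x)) (mul : ∀ x y, q x → q y → q (x * y)) (g : 𝒢.Completion) :
    q g := by
  obtain ⟨g, rfl⟩ := QuotientGroup.mk_surjective (s := Subgroup.normalClosure 𝒢.relators) g
  induction g using Monoid.CoprodI.induction_on with
  | one => exact one
  | of v x => exact of v x
  | mul x y hx hy => exact mul _ _ hx hy

theorem vertexMap_hom_eq {e : T.edgeSet} {v w : V} (hv : v ∈ (e : Sym2 V)) (hw : w ∈ (e : Sym2 V))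
    (x : 𝒢.edgeGroup e) :
    𝒢.vertexMap v (𝒢.hom e v hv x) = 𝒢.vertexMap w (𝒢.hom e w hw x) := by
  rw [← 𝒢.edgeMap_apply, ← 𝒢.edgeMap_apply]

/-- It suffices to check compatibility along the edges leading away from a root. -/
theorem exists_lift_of_dist {Γ : Type*} [Group Γ] (r : V) (ψ : ∀ v, 𝒢.vertexGroup v →* Γ)
    (h : ∀ (v w : V), T.Adj v w → T.dist r w = T.dist r v + 1 →
      ∀ (e : T.edgeSet) (_ : (e : Sym2 V) = s(v, w)) (hv : v ∈ (e : Sym2 V)) (hw : w ∈ (e : Sym2 V))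
        (x : 𝒢.edgeGroup e), ψ v (𝒢.hom e v hv x) = ψ w (𝒢.hom e w hw x)) :
    ∃ Ψ : 𝒢.Completion →* Γ, ∀ v x, Ψ (𝒢.vertexMap v x) = ψ v x := by
  refine 𝒢.exists_lift ψ fun v w hvw x => ?_
  rcases 𝒢.isTree.dist_eq_dist_add_one_of_adj r hvw with h1 | h1
  · exact (h w v hvw.symm h1 _ Sym2.eq_swap _ _ x).symm
  · exact h v w hvw h1 _ rfl _ _ x

/-- Each vertex group acts on `ℕ` by countably many copies of its regular action. Restricted to an
edge group, the actions of the two ends are isomorphic. Conjugating by products of intertwiners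
along paths makes all of them compatible, so the completion acts on `ℕ`, faithfully on each vertex
group. -/
theorem vertexMap_injective [∀ v, Finite (𝒢.vertexGroup v)] (v : V) :
    Function.Injective (𝒢.vertexMap v) := by
  have hex : ∀ v, ∃ (ε : 𝒢.vertexGroup v × ℕ ≃ ℕ) (ρ : 𝒢.vertexGroup v →* Equiv.Perm ℕ),
      ∀ g h n, ρ g (ε (h, n)) = ε (g * h, n) := by
    intro v
    obtain ⟨ε⟩ : Nonempty (𝒢.vertexGroup v × ℕ ≃ ℕ) := nonempty_equiv_of_countable
    refine ⟨ε, MonoidHom.mk' (fun g => (ε.symm.trans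
      (Equiv.prodCongr (Equiv.mulLeft g) (Equiv.refl ℕ))).trans ε) fun a b => ?_, fun g h n => ?_⟩
    · ext n
      obtain ⟨⟨h, m⟩, rfl⟩ := ε.surjective n
      simp [mul_assoc]
    · simp
  choose ε ρ hρ using hex
  have hedge : ∀ v w, T.Adj v w → ∃ s : Equiv.Perm ℕ, ∀ (e : T.edgeSet) (_ : (e : Sym2 V) = s(v, w))
      (hv : v ∈ (e : Sym2 V)) (hw : w ∈ (e : Sym2 V)) (x : 𝒢.edgeGroup e) (n : ℕ),
        s (ρ v (𝒢.hom e v hv x) n) = ρ w (𝒢.hom e w hw x) (s n) := by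
    intro v w hvw
    obtain ⟨e₁, he₁⟩ := exists_equiv_prod_nat (𝒢.hom ⟨s(v, w), hvw⟩ v (Sym2.mem_mk_left v w))
      (𝒢.hom_injective _ _ _)
    obtain ⟨e₂, he₂⟩ := exists_equiv_prod_nat (𝒢.hom ⟨s(v, w), hvw⟩ w (Sym2.mem_mk_right v w))
      (𝒢.hom_injective _ _ _)
    refine ⟨(ε v).symm.trans ((e₁.trans e₂.symm).trans (ε w)), ?_⟩
    rintro ⟨_, he⟩ rfl hv hw x n
    obtain ⟨⟨h, m⟩, rfl⟩ := (ε v).surjective n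
    rw [hρ]
    simp only [Equiv.trans_apply, Equiv.symm_apply_apply]
    obtain ⟨⟨h', m'⟩, hh'⟩ := e₂.surjective (e₁ (h, m))
    rw [he₁, ← hh', Equiv.symm_apply_apply, hρ, ← he₂, Equiv.symm_apply_apply]
  classical
  choose s hs using hedge
  obtain ⟨τ, hτ⟩ := 𝒢.isTree.exists_potential v
    (fun v w => if h : T.Adj v w then s v w h else 1)
  obtain ⟨Ψ, hΨ⟩ := 𝒢.exists_lift_of_dist v
    (fun w => (MulAut.conj (τ w)⁻¹).toMonoidHom.comp (ρ w)) (by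
      intro v w hvw hd e he hv hw x
      have h1 := hτ v w hvw hd
      rw [dif_pos hvw] at h1
      have h2 : s v w hvw * ρ v (𝒢.hom e v hv x) = ρ w (𝒢.hom e w hw x) * s v w hvw :=
        Equiv.ext fun n => hs v w hvw e he hv hw x n
      change (τ v)⁻¹ * ρ v _ * ((τ v)⁻¹)⁻¹ = (τ w)⁻¹ * ρ w _ * ((τ w)⁻¹)⁻¹
      rw [h1, inv_inv, inv_inv, mul_inv_rev]
      calc _ = (τ v)⁻¹ * (s v w hvw)⁻¹ * (s v w hvw * ρ v (𝒢.hom e v hv x)) * τ v := by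
            simp [mul_assoc]
        _ = _ := by rw [h2]; simp [mul_assoc])
  intro x y hxy
  have h1 : MulAut.conj (τ v)⁻¹ (ρ v x) = MulAut.conj (τ v)⁻¹ (ρ v y) := by
    have := congrArg Ψ hxy
    rw [hΨ, hΨ] at this
    exact this
  have h2 := (MulAut.conj (τ v)⁻¹).injective h1
  have h3 := congrArg (fun π : Equiv.Perm ℕ => π (ε v (1, 0))) h2
  simpa [hρ] using h3

/-- The incidence relation of the orbit graph. -/
def Incident (i : 𝒢.OrbitEdge) (x : 𝒢.OrbitVertex) : Prop :=
  x.1 ∈ (i.1 : Sym2 V) ∧ ∃ g : 𝒢.Completion,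
    i.2 = (g : 𝒢.Completion ⧸ (𝒢.edgeMap i.1).range) ∧
    x.2 = (g : 𝒢.Completion ⧸ (𝒢.vertexMap x.1).range)

variable {𝒢}

theorem mk_eq_of_edge {e : T.edgeSet} {v : V} (hv : v ∈ (e : Sym2 V)) {g h : 𝒢.Completion}
    (hgh : (g : 𝒢.Completion ⧸ (𝒢.edgeMap e).range) = h) :
    (g : 𝒢.Completion ⧸ (𝒢.vertexMap v).range) = h := by
  obtain ⟨k, hk⟩ := QuotientGroup.eq.1 hgh
  exact QuotientGroup.eq.2 ⟨𝒢.hom e v hv k, by rw [← 𝒢.edgeMap_apply, hk]⟩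

theorem incident_mk_iff {e : T.edgeSet} {v : V} {g h : 𝒢.Completion} :
    𝒢.Incident ⟨e, g⟩ ⟨v, h⟩ ↔ v ∈ (e : Sym2 V) ∧
      (h : 𝒢.Completion ⧸ (𝒢.vertexMap v).range) = g := by
  constructor
  · rintro ⟨hv, k, hg, hh⟩
    exact ⟨hv, hh.trans (mk_eq_of_edge hv hg).symm⟩
  · rintro ⟨hv, h⟩
    exact ⟨hv, g, rfl, h⟩

theorem Incident.eq_of_fst_eq {i : 𝒢.OrbitEdge} {x y : 𝒢.OrbitVertex} (hx : 𝒢.Incident i x)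
    (hy : 𝒢.Incident i y) (h : x.1 = y.1) : x = y := by
  obtain ⟨e, q⟩ := i
  obtain ⟨v, a⟩ := x
  obtain ⟨w, b⟩ := y
  obtain rfl : v = w := h
  obtain ⟨g, rfl⟩ := QuotientGroup.mk_surjective q
  obtain ⟨a, rfl⟩ := QuotientGroup.mk_surjective a
  obtain ⟨b, rfl⟩ := QuotientGroup.mk_surjective b
  rw [(incident_mk_iff.1 hx).2, (incident_mk_iff.1 hy).2]

theorem Incident.smul {i : 𝒢.OrbitEdge} {x : 𝒢.OrbitVertex} (h : 𝒢.Incident i x)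
    (g : 𝒢.Completion) : 𝒢.Incident (g • i) (g • x) := by
  obtain ⟨hv, k, hi, hx⟩ := h
  exact ⟨hv, g * k, congrArg (g • ·) hi, congrArg (g • ·) hx⟩

variable (𝒢)

theorem orbitGraph_inc_iff {i : 𝒢.OrbitEdge} {x : 𝒢.OrbitVertex} :
    𝒢.orbitGraph.Inc i x ↔ 𝒢.Incident i x := by
  constructor
  · rintro ⟨y, h, g, hi, hx, hy⟩
    exact ⟨by rw [← h]; exact Sym2.mem_mk_left _ _, g, hi, hx⟩
  · rintro ⟨hv, g, hi, hx⟩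
    obtain ⟨w, hw⟩ := hv
    exact ⟨⟨w, g⟩, hw.symm, g, hi, hx, rfl⟩

/-- The bipartite incidence graph of the orbit graph. -/
def incidenceGraph : SimpleGraph (𝒢.OrbitVertex ⊕ 𝒢.OrbitEdge) :=
  SimpleGraph.fromRel fun a b => ∃ x i, a = Sum.inl x ∧ b = Sum.inr i ∧ 𝒢.Incident i x

variable {𝒢}

theorem incidenceGraph_adj_iff {a b : 𝒢.OrbitVertex ⊕ 𝒢.OrbitEdge} :
    𝒢.incidenceGraph.Adj a b ↔ (∃ x i, a = Sum.inl x ∧ b = Sum.inr i ∧ 𝒢.Incident i x) ∨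
      ∃ x i, b = Sum.inl x ∧ a = Sum.inr i ∧ 𝒢.Incident i x := by
  rw [incidenceGraph, SimpleGraph.fromRel_adj, and_iff_right_iff_imp]
  rintro (⟨x, i, rfl, rfl, -⟩ | ⟨x, i, rfl, rfl, -⟩) <;> simp

theorem incidenceGraph_adj_inl_inr {x : 𝒢.OrbitVertex} {i : 𝒢.OrbitEdge} :
    𝒢.incidenceGraph.Adj (Sum.inl x) (Sum.inr i) ↔ 𝒢.Incident i x := by
  rw [incidenceGraph_adj_iff]
  constructor
  · rintro (⟨x, i, h, h', hi⟩ | ⟨x, i, h, -⟩)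
    · cases h; cases h'; exact hi
    · cases h
  · exact fun h => Or.inl ⟨x, i, rfl, rfl, h⟩

/-- The cosets of a fixed `g` form a copy of `T`. The copies of `g` and `g k`, with `k` in a vertex
group, share a vertex, and the vertex groups generate the completion. -/
theorem incidenceGraph_connected : 𝒢.incidenceGraph.Connected := by
  have h1 : ∀ (g : 𝒢.Completion) (v w : V), 𝒢.incidenceGraph.Reachable
      (Sum.inl ⟨v, g⟩) (Sum.inl ⟨w, g⟩) := by
    intro g v w
    obtain ⟨q⟩ := 𝒢.isTree.1 v w
    induction q with
    | nil => exact .rfl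
    | @cons v u w h q ih =>
      refine .trans ?_ ih
      have h2 : 𝒢.incidenceGraph.Adj (Sum.inl ⟨v, g⟩) (Sum.inr ⟨⟨s(v, u), h⟩, g⟩) :=
        incidenceGraph_adj_inl_inr.2 (incident_mk_iff.2 ⟨Sym2.mem_mk_left _ _, rfl⟩)
      have h3 : 𝒢.incidenceGraph.Adj (Sum.inl ⟨u, g⟩) (Sum.inr ⟨⟨s(v, u), h⟩, g⟩) :=
        incidenceGraph_adj_inl_inr.2 (incident_mk_iff.2 ⟨Sym2.mem_mk_right _ _, rfl⟩)
      exact h2.reachable.trans h3.symm.reachable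
  have h2 : ∀ (k g : 𝒢.Completion) (w : V), 𝒢.incidenceGraph.Reachable
      (Sum.inl ⟨w, ((g * k : 𝒢.Completion) : 𝒢.Completion ⧸ (𝒢.vertexMap w).range)⟩)
      (Sum.inl ⟨w, (g : 𝒢.Completion ⧸ (𝒢.vertexMap w).range)⟩) := by
    intro k
    induction k using 𝒢.completion_induction with
    | one => intro g w; rw [mul_one]
    | of v x =>
      intro g w
      have h3 : ((g * 𝒢.vertexMap v x : 𝒢.Completion) : 𝒢.Completion ⧸ (𝒢.vertexMap v).range) = g :=
        QuotientGroup.eq.2 ⟨x⁻¹, by simp⟩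
      have h4 := h1 (g * 𝒢.vertexMap v x) w v
      rw [h3] at h4
      exact h4.trans (h1 g v w)
    | mul x y hx hy =>
      intro g w
      rw [← mul_assoc]
      exact (hy _ w).trans (hx g w)
  obtain ⟨v₀⟩ := 𝒢.isTree.1.nonempty
  have h3 : ∀ x : 𝒢.OrbitVertex, 𝒢.incidenceGraph.Reachable (Sum.inl x)
      (Sum.inl ⟨v₀, ((1 : 𝒢.Completion) : 𝒢.Completion ⧸ (𝒢.vertexMap v₀).range)⟩) := by
    rintro ⟨v, q⟩
    obtain ⟨g, rfl⟩ := QuotientGroup.mk_surjective q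
    have h4 := h2 g 1 v
    rw [one_mul] at h4
    exact h4.trans (h1 1 v v₀)
  have h4 : ∀ a, 𝒢.incidenceGraph.Reachable a
      (Sum.inl ⟨v₀, ((1 : 𝒢.Completion) : 𝒢.Completion ⧸ (𝒢.vertexMap v₀).range)⟩) := by
    rintro (x | ⟨e, q⟩)
    · exact h3 x
    · obtain ⟨g, rfl⟩ := QuotientGroup.mk_surjective q
      have h5 : 𝒢.incidenceGraph.Adj (Sum.inl ⟨(e : Sym2 V).out.1, g⟩) (Sum.inr ⟨e, g⟩) :=
        incidenceGraph_adj_inl_inr.2 (incident_mk_iff.2 ⟨Sym2.out_fst_mem _, rfl⟩)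
      exact h5.symm.reachable.trans (h3 _)
  exact { preconnected := fun a b => (h4 a).trans (h4 b).symm
          nonempty := ⟨Sum.inl ⟨v₀, (1 : 𝒢.Completion)⟩⟩ }

end TreeOfGroups

/-! ### The orbit graph is a tree. -/

namespace TreeOfGroups

variable {V : Type u₁} {T : SimpleGraph V} {𝒢 : TreeOfGroups.{u₁, u₂, u₃} T}

/-- A function on the vertices of the orbit graph that changes exactly along one edge. -/
theorem exists_cut_one (e₀ : T.edgeSet) : ∃ f : 𝒢.OrbitVertex → ZMod 2,
    ∀ (i : 𝒢.OrbitEdge) (x y : 𝒢.OrbitVertex), 𝒢.Incident i x → 𝒢.Incident i y → x.1 ≠ y.1 →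
      (f x = f y ↔ i ≠ ⟨e₀, ((1 : 𝒢.Completion) : 𝒢.Completion ⧸ (𝒢.edgeMap e₀).range)⟩) := by
  classical
  obtain ⟨r⟩ := 𝒢.isTree.1.nonempty
  set χ : 𝒢.Completion → ZMod 2 := fun g => if g ∈ (𝒢.edgeMap e₀).range then 1 else 0 with hχ
  obtain ⟨τ, hτ⟩ := 𝒢.isTree.exists_potential r (Γ := Multiplicative (𝒢.Completion → ZMod 2))
    (fun v w => if s(v, w) = (e₀ : Sym2 V) then Multiplicative.ofAdd χ else 1)
  -- `m` jumps by the indicator `χ` of the edge group across `e₀` and is constant across all other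
  -- edges of `T`.
  obtain ⟨m, hm⟩ : ∃ m : V → 𝒢.Completion → ZMod 2, ∀ v w, T.Adj v w →
      T.dist r w = T.dist r v + 1 →
      ∀ g, m w g = (if s(v, w) = (e₀ : Sym2 V) then χ g else 0) + m v g := by
    refine ⟨fun v => Multiplicative.toAdd (τ v), fun v w h hd g => ?_⟩
    dsimp only
    rw [hτ v w h hd]
    split_ifs <;> simp
  -- Left multiplication twisted by the coboundary of `m v`. Along `e₀` the twists differ by the
  -- coboundary of `χ`, which vanishes on the edge group, so the actions glue to the completion.
  let ψ : ∀ v, 𝒢.vertexGroup v →* Equiv.Perm (𝒢.Completion × ZMod 2) := fun v =>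
    MonoidHom.mk' (fun k =>
      { toFun := fun x => (𝒢.vertexMap v k * x.1, x.2 + m v (𝒢.vertexMap v k * x.1) - m v x.1)
        invFun := fun x => ((𝒢.vertexMap v k)⁻¹ * x.1,
          x.2 - m v x.1 + m v ((𝒢.vertexMap v k)⁻¹ * x.1))
        left_inv := fun x => Prod.ext (by simp) (by
          simp only [inv_mul_cancel_left]; ring)
        right_inv := fun x => Prod.ext (by simp) (by
          simp only [mul_inv_cancel_left]; ring) }) (fun a b => by
          refine Equiv.ext fun x => Prod.ext (by simp [mul_assoc]) ?_
          simp only [map_mul, mul_assoc, Equiv.Perm.mul_apply, Equiv.coe_fn_mk]; ring)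
  have hψ : ∀ v k x, ψ v k x =
    (𝒢.vertexMap v k * x.1, x.2 + m v (𝒢.vertexMap v k * x.1) - m v x.1) := fun _ _ _ => rfl
  obtain ⟨Ψ, hΨ⟩ := 𝒢.exists_lift_of_dist r ψ (by
    intro v w hvw hd e he hv hw x
    ext1 y
    rw [hψ, hψ, 𝒢.vertexMap_hom_eq hw hv, hm v w hvw hd, hm v w hvw hd]
    refine Prod.ext rfl ?_
    dsimp only
    split_ifs with h
    · obtain rfl : e = e₀ := Subtype.ext (he.trans h)
      have h1 : χ (𝒢.vertexMap v (𝒢.hom e v hv x) * y.1) = χ y.1 := by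
        rw [← 𝒢.edgeMap_apply]
        simp only [hχ]
        rw [Subgroup.mul_mem_cancel_left (𝒢.edgeMap e).range (MonoidHom.mem_range.2 ⟨x, rfl⟩)]
      rw [h1]; ring
    · ring)
  have hfst : ∀ g x, (Ψ g x).1 = g * x.1 := by
    intro g
    induction g using 𝒢.completion_induction with
    | one => intro x; simp
    | of v k => intro x; rw [hΨ, hψ]
    | mul a b ha hb => intro x; rw [map_mul, Equiv.Perm.mul_apply, ha, hb, mul_assoc]
  -- `F - m v` is invariant under left multiplication by the group of `v`, so evaluating it at
  -- inverses gives a function on the cosets at `v`. Across the edge `g𝒢(e)` it changes as `m` does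
  -- at `g⁻¹`.
  set F : 𝒢.Completion → ZMod 2 := fun g => (Ψ g (1, 0)).2 with hF
  have hFm : ∀ v k g, F (𝒢.vertexMap v k * g) - m v (𝒢.vertexMap v k * g) = F g - m v g := by
    intro v k g
    simp only [hF]
    rw [map_mul, Equiv.Perm.mul_apply, hΨ, hψ, hfst, mul_one]
    ring
  have hwd : ∀ (v : V) (g h : 𝒢.Completion),
      (g : 𝒢.Completion ⧸ (𝒢.vertexMap v).range) = h → F g⁻¹ - m v g⁻¹ = F h⁻¹ - m v h⁻¹ := by
    intro v g h hgh
    obtain ⟨k, hk⟩ := QuotientGroup.eq.1 hgh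
    have h1 := hFm v k h⁻¹
    rwa [hk, mul_inv_cancel_right] at h1
  refine ⟨fun x => F x.2.out⁻¹ - m x.1 x.2.out⁻¹, ?_⟩
  have hval : ∀ (e : T.edgeSet) (g : 𝒢.Completion) (x : 𝒢.OrbitVertex), 𝒢.Incident ⟨e, g⟩ x →
      F x.2.out⁻¹ - m x.1 x.2.out⁻¹ = F g⁻¹ - m x.1 g⁻¹ := by
    rintro e g ⟨v, q⟩ hx
    obtain ⟨h, rfl⟩ := QuotientGroup.mk_surjective q
    refine hwd v _ _ ?_
    rw [QuotientGroup.out_eq']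
    exact (incident_mk_iff.1 hx).2
  have hval' : ∀ (e : T.edgeSet) (g : 𝒢.Completion) (x y : 𝒢.OrbitVertex), 𝒢.Incident ⟨e, g⟩ x →
      𝒢.Incident ⟨e, g⟩ y → x.1 ≠ y.1 → T.dist r y.1 = T.dist r x.1 + 1 →
      (F x.2.out⁻¹ - m x.1 x.2.out⁻¹ = F y.2.out⁻¹ - m y.1 y.2.out⁻¹ ↔
        (⟨e, g⟩ : 𝒢.OrbitEdge) ≠
          ⟨e₀, ((1 : 𝒢.Completion) : 𝒢.Completion ⧸ (𝒢.edgeMap e₀).range)⟩) := by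
    intro e g x y hx hy hxy hd
    rw [hval e g x hx, hval e g y hy]
    have he : (e : Sym2 V) = s(x.1, y.1) := (Sym2.mem_and_mem_iff hxy).1 ⟨hx.1, hy.1⟩
    have hadj : T.Adj x.1 y.1 := by
      have := e.2
      rwa [he] at this
    rw [hm _ _ hadj hd, ← he]
    split_ifs with h
    · obtain rfl : e = e₀ := Subtype.ext h
      have h1 : (⟨e, g⟩ : 𝒢.OrbitEdge) = ⟨e, ((1 : 𝒢.Completion) :
          𝒢.Completion ⧸ (𝒢.edgeMap e).range)⟩ ↔ g⁻¹ ∈ (𝒢.edgeMap e).range := by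
        constructor
        · intro h
          have h2 := eq_of_heq (Sigma.mk.inj h).2
          have h3 := QuotientGroup.eq.1 h2
          rwa [mul_one] at h3
        · intro h
          exact congrArg (Sigma.mk e) (QuotientGroup.eq.2 (by rwa [mul_one]))
      rw [Ne, h1]
      simp only [hχ]
      split_ifs with h2
      · simp only [h2, not_true_eq_false, iff_false]
        intro h3
        have : (1 : ZMod 2) = 0 := by linear_combination h3
        exact one_ne_zero this
      · simp [h2]
    · rw [zero_add]
      refine iff_of_true rfl fun h' => h ?_
      exact congrArg Subtype.val (Sigma.mk.inj h').1
  rintro ⟨e, q⟩ x y hx hy hxy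
  obtain ⟨g, rfl⟩ := QuotientGroup.mk_surjective q
  have he : (e : Sym2 V) = s(x.1, y.1) := (Sym2.mem_and_mem_iff hxy).1 ⟨hx.1, hy.1⟩
  have hadj : T.Adj x.1 y.1 := by
    have := e.2
    rwa [he] at this
  rcases 𝒢.isTree.dist_eq_dist_add_one_of_adj r hadj with h1 | h1
  · rw [eq_comm]
    exact hval' e g y x hy hx hxy.symm h1
  · exact hval' e g x y hx hy hxy h1

theorem exists_cut (j : 𝒢.OrbitEdge) : ∃ f : 𝒢.OrbitVertex → ZMod 2,
    ∀ (i : 𝒢.OrbitEdge) (x y : 𝒢.OrbitVertex), 𝒢.Incident i x → 𝒢.Incident i y → x.1 ≠ y.1 →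
      (f x = f y ↔ i ≠ j) := by
  obtain ⟨e, q⟩ := j
  obtain ⟨g, rfl⟩ := QuotientGroup.mk_surjective q
  obtain ⟨f, hf⟩ := exists_cut_one (𝒢 := 𝒢) e
  refine ⟨fun x => f (g⁻¹ • x), fun i x y hx hy hxy => ?_⟩
  rw [hf (g⁻¹ • i) _ _ (hx.smul _) (hy.smul _) hxy, Ne, Ne, inv_smul_eq_iff]
  have : g • (⟨e, ((1 : 𝒢.Completion) : 𝒢.Completion ⧸ (𝒢.edgeMap e).range)⟩ : 𝒢.OrbitEdge) =
      ⟨e, g⟩ := congrArg (Sigma.mk e) (congrArg QuotientGroup.mk (mul_one g))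
  rw [this]

theorem exists_incident (i : 𝒢.OrbitEdge) : ∃ x, 𝒢.Incident i x := by
  obtain ⟨e, q⟩ := i
  obtain ⟨g, rfl⟩ := QuotientGroup.mk_surjective q
  exact ⟨⟨(e : Sym2 V).out.1, g⟩, incident_mk_iff.2 ⟨Sym2.out_fst_mem _, rfl⟩⟩

/-- The orbit graph of a tree of groups is a tree. -/
theorem incidenceGraph_isTree : 𝒢.incidenceGraph.IsTree := by
  refine ⟨incidenceGraph_connected, ?_⟩
  -- Each incidence is a bridge, since a cut function extended to the edges changes only there. The
  -- value at `j` is `f x₀ + 1`, the value of `f` at the other end of `j`.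
  have key : ∀ (x₀ : 𝒢.OrbitVertex) (j : 𝒢.OrbitEdge), 𝒢.Incident j x₀ →
      ∃ F : 𝒢.OrbitVertex ⊕ 𝒢.OrbitEdge → ZMod 2, F (Sum.inl x₀) ≠ F (Sum.inr j) ∧
        ∀ x i, 𝒢.Incident i x → (x = x₀ ∧ i = j) ∨ F (Sum.inl x) = F (Sum.inr i) := by
    intro x₀ j hj
    obtain ⟨f, hf⟩ := exists_cut j
    choose t ht using exists_incident (𝒢 := 𝒢)
    classical
    refine ⟨Sum.elim f fun i => if i = j then f x₀ + 1 else f (t i), by simp, fun x i hx => ?_⟩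
    rw [Sum.elim_inl, Sum.elim_inr]
    split_ifs with h
    · subst h
      by_cases h1 : x.1 = x₀.1
      · exact Or.inl ⟨hx.eq_of_fst_eq hj h1, rfl⟩
      · right
        have h2 := (hf i x x₀ hx hj h1).not.2 (by simp)
        revert h2
        generalize f x = a
        generalize f x₀ = b
        revert a b
        decide
    · right
      by_cases h1 : x.1 = (t i).1
      · rw [hx.eq_of_fst_eq (ht i) h1]
      · exact (hf i x (t i) hx (ht i) h1).2 h
  have hb : ∀ (x₀ : 𝒢.OrbitVertex) (j : 𝒢.OrbitEdge), 𝒢.Incident j x₀ →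
      𝒢.incidenceGraph.IsBridge s(Sum.inl x₀, Sum.inr j) := by
    intro x₀ j hj
    rw [SimpleGraph.isBridge_iff]
    obtain ⟨F, hF, hF'⟩ := key x₀ j hj
    have hwalk : ∀ {a b} (_ : (𝒢.incidenceGraph.deleteEdges
        {s(Sum.inl x₀, Sum.inr j)}).Walk a b), F a = F b := by
      intro a b q
      induction q with
      | nil => rfl
      | cons h q ih =>
        refine Eq.trans ?_ ih
        rw [SimpleGraph.deleteEdges_adj, Set.mem_singleton_iff] at h
        obtain ⟨h, hne⟩ := h
        rcases incidenceGraph_adj_iff.1 h with ⟨x, i, rfl, rfl, hi⟩ | ⟨x, i, rfl, rfl, hi⟩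
        · rcases hF' x i hi with ⟨rfl, rfl⟩ | h
          · exact absurd rfl hne
          · exact h
        · rcases hF' x i hi with ⟨rfl, rfl⟩ | h
          · exact absurd Sym2.eq_swap hne
          · exact h.symm
    exact fun ⟨q⟩ => hF (hwalk q)
  rw [SimpleGraph.isAcyclic_iff_forall_adj_isBridge]
  intro a b hab
  rcases incidenceGraph_adj_iff.1 hab with ⟨x, i, rfl, rfl, h⟩ | ⟨x, i, rfl, rfl, h⟩
  · exact hb x i h
  · rw [Sym2.eq_swap]
    exact hb x i h

end TreeOfGroups

/-! ### Stabilizers, and conjugation of finite `p`-subgroups towards the root. -/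

section SylowFacts

variable {X : Type*} [Group X] {p : ℕ} [Fact p.Prime]

theorem isSyl_top_of_sylow [Finite X] (S : Sylow p X) : IsSyl p ⊤ (S : Subgroup X) := by
  refine ⟨le_top, ⟨inferInstance, S.isPGroup'⟩, fun A _ hA => ?_⟩
  obtain ⟨Q, hQ⟩ := hA.2.exists_le_sylow
  obtain ⟨g, hg⟩ := MulAction.exists_smul_eq X Q S
  refine ⟨g, Subgroup.mem_top _, (conj_smul_mono hQ).trans (le_of_eq ?_)⟩
  rw [← hg]
  rfl

/-- A finite `p`-group acting on a coset space of size prime to `p` has a fixed point. -/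
theorem exists_conj_le_of_not_dvd_relIndex {A K L : Subgroup X} (hA : IsFinP p A)
    (hAL : A ≤ L) (hp : ¬ p ∣ K.relIndex L) : ∃ l ∈ L, MulAut.conj l • A ≤ K := by
  have : Finite A := hA.1
  -- An infinite index is recorded as `0`, which `p` divides; so the index is finite.
  have : Finite (L ⧸ K.subgroupOf L) := by
    apply Nat.finite_of_card_ne_zero
    rintro h
    exact hp (by rw [Subgroup.relIndex, Subgroup.index, h]; exact dvd_zero _)
  have hAp : IsPGroup p (A.subgroupOf L) := hA.2.comap_subtype
  obtain ⟨q, hq⟩ := hAp.nonempty_fixed_point_of_prime_not_dvd_card (L ⧸ K.subgroupOf L) hp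
  obtain ⟨l, rfl⟩ := QuotientGroup.mk_surjective q
  refine ⟨(l : X)⁻¹, inv_mem l.2, fun x hx => ?_⟩
  rw [mem_conj_smul, inv_inv] at hx
  have h1 := hq ⟨⟨l * x * (l : X)⁻¹, hAL hx⟩, hx⟩
  have h2 := QuotientGroup.eq.1 h1
  have h3 : ((l : X) * x * (l : X)⁻¹ * l)⁻¹ * l ∈ K := h2
  rw [← inv_mem_iff]
  simpa [mul_assoc] using h3

end SylowFacts

namespace TreeOfGroups

variable {V : Type u₁} {T : SimpleGraph V} {𝒢 : TreeOfGroups.{u₁, u₂, u₃} T}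

theorem incidenceGraph_adj_smul (g : 𝒢.Completion) {a b : 𝒢.OrbitVertex ⊕ 𝒢.OrbitEdge}
    (h : 𝒢.incidenceGraph.Adj a b) : 𝒢.incidenceGraph.Adj (g • a) (g • b) := by
  rw [incidenceGraph_adj_iff] at h ⊢
  rcases h with ⟨x, i, rfl, rfl, hi⟩ | ⟨x, i, rfl, rfl, hi⟩
  · exact Or.inl ⟨g • x, g • i, rfl, rfl, hi.smul g⟩
  · exact Or.inr ⟨g • x, g • i, rfl, rfl, hi.smul g⟩

/-- The action of the completion on the incidence graph. -/
noncomputable def smulHom (g : 𝒢.Completion) : 𝒢.incidenceGraph →g 𝒢.incidenceGraph where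
  toFun a := g • a
  map_rel' h := incidenceGraph_adj_smul g h

theorem stabilizer_vertex (v : V) (g : 𝒢.Completion) :
    MulAction.stabilizer 𝒢.Completion (⟨v, g⟩ : 𝒢.OrbitVertex) =
      MulAut.conj g • (𝒢.vertexMap v).range := by
  ext h
  rw [MulAction.mem_stabilizer_iff, mem_conj_smul]
  constructor
  · intro h1
    have h2 : ((h * g : 𝒢.Completion) : 𝒢.Completion ⧸ (𝒢.vertexMap v).range) = g :=
      eq_of_heq (Sigma.mk.inj h1).2
    have h3 := QuotientGroup.eq.1 h2.symm
    rwa [mul_assoc]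
  · intro h1
    refine congrArg (Sigma.mk v) (QuotientGroup.eq.2 ?_).symm
    change g⁻¹ * (h * g) ∈ _
    rwa [← mul_assoc]

theorem stabilizer_edge (e : T.edgeSet) (g : 𝒢.Completion) :
    MulAction.stabilizer 𝒢.Completion (⟨e, g⟩ : 𝒢.OrbitEdge) =
      MulAut.conj g • (𝒢.edgeMap e).range := by
  ext h
  rw [MulAction.mem_stabilizer_iff, mem_conj_smul]
  constructor
  · intro h1
    have h2 : ((h * g : 𝒢.Completion) : 𝒢.Completion ⧸ (𝒢.edgeMap e).range) = g :=
      eq_of_heq (Sigma.mk.inj h1).2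
    have h3 := QuotientGroup.eq.1 h2.symm
    rwa [mul_assoc]
  · intro h1
    refine congrArg (Sigma.mk e) (QuotientGroup.eq.2 ?_).symm
    change g⁻¹ * (h * g) ∈ _
    rwa [← mul_assoc]

theorem stabilizer_inl (x : 𝒢.OrbitVertex) :
    MulAction.stabilizer 𝒢.Completion (Sum.inl x : 𝒢.OrbitVertex ⊕ 𝒢.OrbitEdge) =
      MulAction.stabilizer 𝒢.Completion x := by
  ext g
  simp [MulAction.mem_stabilizer_iff]

theorem stabilizer_inr (i : 𝒢.OrbitEdge) :
    MulAction.stabilizer 𝒢.Completion (Sum.inr i : 𝒢.OrbitVertex ⊕ 𝒢.OrbitEdge) =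
      MulAction.stabilizer 𝒢.Completion i := by
  ext g
  simp [MulAction.mem_stabilizer_iff]

theorem Incident.stabilizer_le {i : 𝒢.OrbitEdge} {x : 𝒢.OrbitVertex} (h : 𝒢.Incident i x) :
    MulAction.stabilizer 𝒢.Completion i ≤ MulAction.stabilizer 𝒢.Completion x := by
  intro g hg
  rw [MulAction.mem_stabilizer_iff] at hg ⊢
  have h1 := h.smul g
  rw [hg] at h1
  exact h1.eq_of_fst_eq h rfl

theorem stabilizer_smul_eq {α : Type*} [MulAction 𝒢.Completion α] (g : 𝒢.Completion) (a : α) :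
    MulAction.stabilizer 𝒢.Completion (g • a) =
      MulAut.conj g • MulAction.stabilizer 𝒢.Completion a :=
  MulAction.stabilizer_smul_eq_stabilizer_map_conj g a

instance finite_stabilizer_vertex [∀ v, Finite (𝒢.vertexGroup v)] (x : 𝒢.OrbitVertex) :
    Finite (MulAction.stabilizer 𝒢.Completion x) := by
  obtain ⟨v, q⟩ := x
  obtain ⟨g, rfl⟩ := QuotientGroup.mk_surjective q
  rw [stabilizer_vertex]
  have : Finite (𝒢.vertexMap v).range := Finite.of_surjective _ (𝒢.vertexMap v).rangeRestrict_surjective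
  exact Finite.of_equiv _ (Subgroup.equivSMul (MulAut.conj g) _).toEquiv

instance finite_stabilizer_edge [∀ v, Finite (𝒢.vertexGroup v)] (i : 𝒢.OrbitEdge) :
    Finite (MulAction.stabilizer 𝒢.Completion i) := by
  obtain ⟨x, hx⟩ := exists_incident i
  exact Finite.of_injective _ (Subgroup.inclusion_injective hx.stabilizer_le)

instance finite_stabilizer_sum [∀ v, Finite (𝒢.vertexGroup v)]
    (a : 𝒢.OrbitVertex ⊕ 𝒢.OrbitEdge) : Finite (MulAction.stabilizer 𝒢.Completion a) := by
  rcases a with x | i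
  · rw [stabilizer_inl]; infer_instance
  · rw [stabilizer_inr]; infer_instance

/-- Finite subgroups of the completion fix a vertex of the orbit graph. -/
theorem exists_le_stabilizer (A : Subgroup 𝒢.Completion) [Finite A] :
    ∃ x : 𝒢.OrbitVertex, A ≤ MulAction.stabilizer 𝒢.Completion x := by
  obtain ⟨x₀⟩ := (incidenceGraph_isTree (𝒢 := 𝒢)).1.nonempty
  obtain ⟨a, ha⟩ := (incidenceGraph_isTree (𝒢 := 𝒢)).exists_fixed
    (A := A) (fun g => smulHom (g : 𝒢.Completion)) (fun g h a => mul_smul (g : 𝒢.Completion) h a)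
    x₀ (Set.finite_range _) Sum.isLeft (by
      intro a b h
      rcases incidenceGraph_adj_iff.1 h with ⟨x, i, rfl, rfl, -⟩ | ⟨x, i, rfl, rfl, -⟩ <;> simp)
    (by rintro g (x | i) <;> rfl)
  have hA : A ≤ MulAction.stabilizer 𝒢.Completion a := fun g hg => ha ⟨g, hg⟩
  rcases a with x | i
  · exact ⟨x, by rwa [stabilizer_inl] at hA⟩
  · obtain ⟨x, hx⟩ := exists_incident i
    rw [stabilizer_inr] at hA
    exact ⟨x, hA.trans hx.stabilizer_le⟩

/-- The group of the first edge of the path to `r` has index prime to `p` in each vertex group. -/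
def HasPrimeToIndex (𝒢 : TreeOfGroups.{u₁, u₂, u₃} T) (p : ℕ) (r : V) : Prop :=
  ∀ (i : 𝒢.OrbitEdge) (x y : 𝒢.OrbitVertex), 𝒢.Incident i x → 𝒢.Incident i y →
    T.dist r x.1 = T.dist r y.1 + 1 →
    ¬ p ∣ (MulAction.stabilizer 𝒢.Completion i).relIndex (MulAction.stabilizer 𝒢.Completion x)

theorem hasPrimeToIndex_of_index [∀ v, Finite (𝒢.vertexGroup v)] {p : ℕ} {r : V}
    (h : ∀ (v w : V) (h : T.Adj v w) (q : T.Walk w r), (SimpleGraph.Walk.cons h q).IsPath →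
      ¬ p ∣ (𝒢.hom ⟨s(v, w), h⟩ v (Sym2.mem_mk_left v w)).range.index) :
    𝒢.HasPrimeToIndex p r := by
  rintro ⟨⟨e, he⟩, a⟩ ⟨v, b⟩ ⟨w, c⟩ hx hy hd
  dsimp only at hd
  have hvw : v ≠ w := by rintro rfl; omega
  obtain rfl : e = s(v, w) := (Sym2.mem_and_mem_iff hvw).1 ⟨hx.1, hy.1⟩
  have hadj : T.Adj v w := he
  obtain ⟨q, hq⟩ := 𝒢.isTree.1.exists_walk_length_eq_dist w r
  have h1 := h v w hadj q (SimpleGraph.Walk.isPath_of_length_eq_dist _ (by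
    rw [SimpleGraph.Walk.length_cons, hq, T.dist_comm, T.dist_comm (u := v), hd]))
  obtain ⟨g, rfl⟩ := QuotientGroup.mk_surjective a
  obtain ⟨k, rfl⟩ := QuotientGroup.mk_surjective b
  rw [(incident_mk_iff.1 hx).2, stabilizer_vertex, stabilizer_edge,
    Subgroup.relIndex_pointwise_smul]
  have h2 : (𝒢.edgeMap ⟨s(v, w), he⟩).range =
      ((𝒢.hom ⟨s(v, w), he⟩ v (Sym2.mem_mk_left v w)).range).map (𝒢.vertexMap v) := by
    rw [MonoidHom.map_range]
    congr 1
    ext x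
    exact 𝒢.edgeMap_apply _ _ _ _
  rw [h2, MonoidHom.range_eq_map (𝒢.vertexMap v),
    Subgroup.relIndex_map_map_of_injective _ _ (𝒢.vertexMap_injective v),
    Subgroup.relIndex_top_right]
  exact h1

/-- The first edge of a path towards `r` and its other end. -/
theorem exists_incident_closer (r : V) (x : 𝒢.OrbitVertex) (hx : x.1 ≠ r) :
    ∃ i y, 𝒢.Incident i x ∧ 𝒢.Incident i y ∧ T.dist r x.1 = T.dist r y.1 + 1 := by
  obtain ⟨v, q⟩ := x
  obtain ⟨g, rfl⟩ := QuotientGroup.mk_surjective q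
  obtain ⟨q, hq⟩ := 𝒢.isTree.1.exists_walk_length_eq_dist v r
  cases q with
  | nil => exact absurd rfl hx
  | @cons _ w _ h q =>
    refine ⟨⟨⟨s(v, w), h⟩, g⟩, ⟨w, g⟩, incident_mk_iff.2 ⟨Sym2.mem_mk_left _ _, rfl⟩,
      incident_mk_iff.2 ⟨Sym2.mem_mk_right _ _, rfl⟩, ?_⟩
    dsimp only
    rcases 𝒢.isTree.dist_eq_dist_add_one_of_adj r h with h1 | h1
    · exact h1
    · exfalso
      have h2 := SimpleGraph.dist_le q
      rw [SimpleGraph.Walk.length_cons] at hq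
      rw [T.dist_comm, T.dist_comm (u := r) (v := v)] at h1
      omega

/-- Every finite `p`-subgroup of the completion is conjugate to a subgroup of the Sylow subgroup of
the vertex group of the root. -/
theorem exists_conj_le_sylow [∀ v, Finite (𝒢.vertexGroup v)] {p : ℕ} [Fact p.Prime] {r : V}
    (hindex : 𝒢.HasPrimeToIndex p r) (S : Sylow p (𝒢.vertexGroup r)) {A : Subgroup 𝒢.Completion}
    (hA : IsFinP p A) :
    ∃ g : 𝒢.Completion, MulAut.conj g • A ≤ (S : Subgroup (𝒢.vertexGroup r)).map (𝒢.vertexMap r) := by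
  -- Induction on the distance of the fixed vertex from the root: the index hypothesis conjugates
  -- `A` into the stabilizer of an edge leading one step closer.
  have key : ∀ (n : ℕ) (x : 𝒢.OrbitVertex) (A : Subgroup 𝒢.Completion), IsFinP p A →
      T.dist r x.1 = n → A ≤ MulAction.stabilizer 𝒢.Completion x →
      ∃ g : 𝒢.Completion, MulAut.conj g • A ≤ (S : Subgroup (𝒢.vertexGroup r)).map (𝒢.vertexMap r) := by
    intro n
    induction n with
    | zero =>
      rintro ⟨v, q⟩ A hA hd hAx
      obtain ⟨g, rfl⟩ := QuotientGroup.mk_surjective q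
      obtain rfl : r = v := 𝒢.isTree.1.dist_eq_zero_iff.1 hd
      rw [stabilizer_vertex, ← conj_inv_smul_le] at hAx
      obtain ⟨B, hB⟩ : ∃ B : Subgroup (𝒢.vertexGroup r),
          B.map (𝒢.vertexMap r) = MulAut.conj g⁻¹ • A :=
        ⟨(MulAut.conj g⁻¹ • A).comap (𝒢.vertexMap r), Subgroup.map_comap_eq_self hAx⟩
      have hBp : IsFinP p B := by
        refine ⟨inferInstance, ?_⟩
        have h1 := (hA.conj g⁻¹).2
        rw [← hB] at h1
        exact h1.of_equiv (B.equivMapOfInjective _ (𝒢.vertexMap_injective r)).symm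
      obtain ⟨k, -, hk⟩ := (isSyl_top_of_sylow S).2.2 B le_top hBp
      refine ⟨𝒢.vertexMap r k * g⁻¹, ?_⟩
      rw [conj_mul_smul, ← hB]
      refine le_trans ?_ (Subgroup.map_mono hk)
      intro y hy
      obtain ⟨b, hb, hby⟩ := mem_conj_smul.1 hy
      refine ⟨k * b * k⁻¹, mem_conj_smul.2 (by simpa [mul_assoc] using hb), ?_⟩
      rw [map_mul, map_mul, hby, map_inv]
      group
    | succ n ih =>
      intro x A hA hd hAx
      obtain ⟨i, y, hx, hy, hxy⟩ := exists_incident_closer r x (by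
        intro h
        rw [h, SimpleGraph.dist_self] at hd
        omega)
      obtain ⟨l, hl, hlA⟩ := exists_conj_le_of_not_dvd_relIndex hA hAx (hindex i x y hx hy hxy)
      obtain ⟨g, hg⟩ := ih y _ (hA.conj l) (by omega) (hlA.trans hy.stabilizer_le)
      exact ⟨g * l, by rwa [conj_mul_smul]⟩
  have := hA.1
  obtain ⟨x, hx⟩ := exists_le_stabilizer A
  exact key _ x A hA rfl hx

end TreeOfGroups

/-! ### Automorphisms induced on a subgroup. -/

section AutomorphismImage

variable {G : Type*} [Group G] {p : ℕ}

/-- The group of automorphisms of `R` induced by the elements of `A` normalising `R`. -/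
def inducedAut (R A : Subgroup G) : Subgroup (MulAut R) :=
  (A.subgroupOf (Subgroup.normalizer (R : Set G))).map R.normalizerMonoidHom

theorem inducedAut_mono (R : Subgroup G) {A B : Subgroup G} (h : A ≤ B) :
    inducedAut R A ≤ inducedAut R B :=
  Subgroup.map_mono (Subgroup.comap_mono h)

theorem mem_ker_normalizerMonoidHom {R : Subgroup G}
    {n : Subgroup.normalizer (R : Set G)} :
    n ∈ R.normalizerMonoidHom.ker ↔ (n : G) ∈ Subgroup.centralizer (R : Set G) := by
  rw [Subgroup.normalizerMonoidHom_ker]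
  rfl

theorem comap_inducedAut {R B : Subgroup G} (hB : B ≤ Subgroup.normalizer (R : Set G)) :
    (inducedAut R B).comap R.normalizerMonoidHom =
      (B ⊔ Subgroup.centralizer (R : Set G)).subgroupOf (Subgroup.normalizer (R : Set G)) := by
  rw [inducedAut, Subgroup.comap_map_eq, Subgroup.normalizerMonoidHom_ker,
    Subgroup.subgroupOf_sup hB (centralizer_le_normalizer R)]

theorem inducedAut_le_iff {R A B : Subgroup G} (hA : A ≤ Subgroup.normalizer (R : Set G))
    (hB : B ≤ Subgroup.normalizer (R : Set G)) :
    inducedAut R A ≤ inducedAut R B ↔ A ≤ B ⊔ Subgroup.centralizer (R : Set G) := by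
  rw [inducedAut, Subgroup.map_le_iff_le_comap, comap_inducedAut hB]
  constructor
  · intro h x hx
    exact h (show (⟨x, hA hx⟩ : Subgroup.normalizer (R : Set G)) ∈ A.subgroupOf _ from hx)
  · exact fun h => Subgroup.comap_mono h

theorem relIndex_inducedAut {R A B : Subgroup G} (hA : A ≤ Subgroup.normalizer (R : Set G))
    (hB : B ≤ Subgroup.normalizer (R : Set G)) :
    (inducedAut R B).relIndex (inducedAut R A) =
      (B ⊔ Subgroup.centralizer (R : Set G)).relIndex A := by
  rw [← Subgroup.relIndex_subgroupOf hA, ← comap_inducedAut hB, Subgroup.relIndex_comap]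
  rfl

theorem inducedAut_conj {R A : Subgroup G} (n : Subgroup.normalizer (R : Set G)) :
    inducedAut R (MulAut.conj (n : G) • A) =
      MulAut.conj (R.normalizerMonoidHom n) • inducedAut R A := by
  ext α
  rw [mem_conj_smul]
  constructor
  · rintro ⟨x, hx, rfl⟩
    have h1 : (n : G)⁻¹ * x * n ∈ A :=
      mem_conj_smul.1 (show (x : G) ∈ MulAut.conj (n : G) • A from hx)
    exact ⟨n⁻¹ * x * n, h1, by simp⟩
  · rintro ⟨x, hx, hxα⟩
    refine ⟨n * x * n⁻¹, mem_conj_smul.2 ?_, by rw [map_mul, map_mul, hxα, map_inv]; group⟩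
    have h1 : (x : G) ∈ A := hx
    simpa [mul_assoc] using h1

theorem IsFinP.inducedAut {A : Subgroup G} (hA : IsFinP p A) (R : Subgroup G) :
    IsFinP p (inducedAut R A) := by
  have := hA.1
  refine IsFinP.map ⟨?_, hA.2.comap_subtype⟩ _
  exact Finite.of_injective (fun x : A.subgroupOf (Subgroup.normalizer (R : Set G)) =>
    (⟨((x : Subgroup.normalizer (R : Set G)) : G), x.2⟩ : A)) fun x y h =>
      Subtype.ext (Subtype.ext (congrArg (fun z : A => (z : G)) h))

instance finite_mulAut {R : Type*} [Group R] [Finite R] : Finite (MulAut R) :=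
  Finite.of_injective (fun α : MulAut R => (α : R → R)) DFunLike.coe_injective

theorem IsSyl.le_of_le_normalizer {L B R : Subgroup G} (h : IsSyl p L B) (hR : IsFinP p R)
    (hRL : R ≤ L) (hLN : L ≤ Subgroup.normalizer (R : Set G)) : R ≤ B := by
  obtain ⟨l, hl, hlR⟩ := h.2.2 R hRL hR
  rwa [mem_normalizer_iff_conj.1 (hLN hl)] at hlR

variable [Fact p.Prime]

theorem IsSyl.not_dvd_relIndex {L B : Subgroup G} [Finite L] (h : IsSyl p L B) :
    ¬ p ∣ B.relIndex L := by
  obtain ⟨Q, hQ⟩ := (h.2.1.2.comap_subtype (K := L)).exists_le_sylow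
  have h1 : (Q : Subgroup L).map L.subtype = B :=
    h.le_of_le (Subgroup.map_subtype_le _) (IsFinP.map ⟨inferInstance, Q.isPGroup'⟩ _)
      fun x hx => ⟨⟨x, h.1 hx⟩, hQ (show x ∈ B from hx), rfl⟩
  have h2 : B.subgroupOf L = Q := by
    rw [← h1]
    exact Subgroup.comap_map_eq_self_of_injective L.subtype_injective _
  rw [Subgroup.relIndex, h2]
  exact Q.not_dvd_index

/-- A Sylow subgroup covers every `p`-group quotient. -/
theorem IsSyl.le_sup_centralizer {R L B : Subgroup G} [Finite L] (h : IsSyl p L B)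
    (hL : L ≤ Subgroup.normalizer (R : Set G)) (hp : IsFinP p (inducedAut R L)) :
    L ≤ B ⊔ Subgroup.centralizer (R : Set G) := by
  have := hp.1
  rw [← Subgroup.relIndex_eq_one, ← relIndex_inducedAut hL (h.1.trans hL)]
  obtain ⟨n, hn⟩ := hp.2.index ((inducedAut R B).subgroupOf (inducedAut R L))
  change (inducedAut R B).relIndex (inducedAut R L) = p ^ n at hn
  rcases Nat.eq_zero_or_pos n with rfl | hn0
  · rw [hn, pow_zero]
  · exfalso
    refine h.not_dvd_relIndex ((dvd_pow_self p hn0.ne').trans ?_)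
    rw [← hn, relIndex_inducedAut hL (h.1.trans hL)]
    exact Subgroup.relIndex_dvd_of_le_left _ le_sup_left

/-- It suffices to find one `p`-subgroup that induces a Sylow subgroup of automorphisms and to which
the centralizer conjugates the `p`-subgroups of its product with the centralizer. -/
theorem isGood_of_isSyl_inducedAut {R B : Subgroup G} [Finite R]
    (hBN : B ≤ Subgroup.normalizer (R : Set G)) (hB : IsFinP p B)
    (hsyl : IsSyl p (inducedAut R (Subgroup.normalizer (R : Set G))) (inducedAut R B))
    (hconj : ∀ A ≤ B ⊔ Subgroup.centralizer (R : Set G), IsFinP p A →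
      ∃ c ∈ Subgroup.centralizer (R : Set G), MulAut.conj c • A ≤ B) : IsGood p R := by
  intro L hCL hLN
  obtain ⟨W, hW⟩ := exists_isSyl (p := p) (inducedAut R L)
  obtain ⟨_, ⟨n, -, rfl⟩, hnW⟩ := hsyl.2.2 W (hW.1.trans (inducedAut_mono R hLN)) hW.2.1
  have hn := mem_normalizer_iff_conj.1 n.2
  set K := MulAut.conj (n : G)⁻¹ • B ⊓ L with hK
  have hKp : IsFinP p K := (hB.conj _).mono inf_le_left
  have hKN : K ≤ Subgroup.normalizer (R : Set G) := inf_le_right.trans hLN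
  -- `W` is a Sylow subgroup of `Aut_L(R)` that `n` carries into `Aut_B(R)`; a subgroup of `L`
  -- inducing automorphisms in `W` is carried into `B C(R)`.
  have hlift : ∀ A ≤ L, inducedAut R A ≤ W →
      MulAut.conj (n : G) • A ≤ B ⊔ Subgroup.centralizer (R : Set G) := by
    intro A hA hAW
    have h1 : inducedAut R (MulAut.conj (n : G) • A) ≤ inducedAut R B := by
      rw [inducedAut_conj]
      exact (conj_smul_mono hAW).trans hnW
    exact (inducedAut_le_iff (conj_smul_le_of_mem n.2 (hA.trans hLN)) hBN).1 h1
  -- An element of `L` inducing an automorphism in `W` is, after conjugation by `n`, a product `b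
  -- c`. Dropping the centralizing factor, which lies in `L` after conjugating back, leaves an
  -- element of `K` with the same action on `R`.
  have hWK : W = inducedAut R K := by
    refine (hW.le_of_le (inducedAut_mono R inf_le_right) (hKp.inducedAut R) ?_).symm
    intro α hα
    obtain ⟨x, hx, rfl⟩ := hW.1 hα
    have hxL : (x : G) ∈ L := hx
    set A := Subgroup.zpowers (x : G)
    have hAL : A ≤ L := (Subgroup.zpowers_le).2 hxL
    have hAW : inducedAut R A ≤ W := by
      rintro _ ⟨y, hy, rfl⟩
      obtain ⟨k, hk⟩ := Subgroup.mem_zpowers_iff.1 (show (y : G) ∈ A from hy)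
      have : y = x ^ k := Subtype.ext (by rw [← hk]; simp)
      rw [this, map_zpow]
      exact zpow_mem hα k
    have h1 := hlift A hAL hAW
    have h2 : MulAut.conj (n : G) • (x : G) ∈ MulAut.conj (n : G) • A :=
      Subgroup.smul_mem_pointwise_smul _ _ _ (Subgroup.mem_zpowers _)
    obtain ⟨b, hb, c, hc, hbc⟩ := exists_mul_of_mem_sup (le_normalizer_centralizer_of_le hBN)
      (h1 h2)
    rw [MulAut.smul_def, MulAut.conj_apply] at hbc
    have hc' : (n : G)⁻¹ * c * n ∈ Subgroup.centralizer (R : Set G) := by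
      rw [← mem_conj_smul, conj_smul_centralizer_eq_of_mem_normalizer n.2]
      exact hc
    have hx' : (x : G) = ((n : G)⁻¹ * b * n) * ((n : G)⁻¹ * c * n) := by
      calc (x : G) = (n : G)⁻¹ * (n * x * (n : G)⁻¹) * n := by group
        _ = _ := by rw [← hbc]; group
    have hbK : (n : G)⁻¹ * b * n ∈ K := by
      refine ⟨mem_conj_smul.2 (by simpa [mul_assoc] using hb), ?_⟩
      rw [hx'] at hxL
      exact (Subgroup.mul_mem_cancel_right _ (hCL hc')).1 hxL
    refine ⟨⟨(n : G)⁻¹ * b * n, hKN hbK⟩, hbK, ?_⟩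
    have h3 : x = ⟨(n : G)⁻¹ * b * n, hKN hbK⟩ *
        ⟨(n : G)⁻¹ * c * n, centralizer_le_normalizer R hc'⟩ := Subtype.ext hx'
    rw [h3, map_mul, (MonoidHom.mem_ker.1 (mem_ker_normalizerMonoidHom.2 hc') :
      R.normalizerMonoidHom ⟨(n : G)⁻¹ * c * n, centralizer_le_normalizer R hc'⟩ = 1), mul_one]
  refine ⟨K, ⟨inf_le_right, hKp, fun A hAL hA => ?_⟩, ?_⟩
  · obtain ⟨_, ⟨l, hl, rfl⟩, hlA⟩ := hW.2.2 (inducedAut R A) (inducedAut_mono R hAL)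
      (hA.inducedAut R)
    have hlL : (l : G) ∈ L := hl
    rw [← inducedAut_conj] at hlA
    have hlAL := conj_smul_le_of_mem hlL hAL
    obtain ⟨c, hc, hcA⟩ := hconj _ (hlift _ hlAL hlA) ((hA.conj _).conj _)
    have hc' : (n : G)⁻¹ * c * n ∈ Subgroup.centralizer (R : Set G) := by
      rw [← mem_conj_smul, conj_smul_centralizer_eq_of_mem_normalizer n.2]
      exact hc
    refine ⟨(n : G)⁻¹ * c * n * l, mul_mem (hCL hc') hlL, le_inf ?_ ?_⟩
    · rw [conj_mul_smul, conj_mul_smul, conj_mul_smul]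
      exact conj_smul_mono hcA
    · exact conj_smul_le_of_mem (mul_mem (hCL hc') hlL) hAL
  · rw [← relIndex_inducedAut hLN hKN, ← hWK]
    exact hW.not_dvd_relIndex

end AutomorphismImage

/-! ### Centric subgroups and the quotient of the fixed graph by the centralizer. -/

namespace TreeOfGroups

section CentralizerQuotient

variable {V : Type u₁} {T : SimpleGraph V} {𝒢 : TreeOfGroups.{u₁, u₂, u₃} T}
  {R : Subgroup 𝒢.Completion}

/-- A vertex or edge of the orbit graph fixed by `R` lies over a vertex or edge of the quotient of
the fixed graph by the centralizer. -/
def LiesOver (R : Subgroup 𝒢.Completion) : 𝒢.OrbitVertex ⊕ 𝒢.OrbitEdge →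
    (𝒢.centralizerQuotient R).vertexSet ⊕ (𝒢.centralizerQuotient R).edgeSet → Prop
  | .inl x, .inl a => R ≤ MulAction.stabilizer _ x ∧ Quotient.mk'' x = a.1
  | .inr i, .inr e => R ≤ MulAction.stabilizer _ i ∧ Quotient.mk'' i = e.1
  | _, _ => False

theorem mem_fixedPoints_iff_le_stabilizer {α : Type*} [MulAction 𝒢.Completion α] {a : α} :
    a ∈ MulAction.fixedPoints R α ↔ R ≤ MulAction.stabilizer 𝒢.Completion a :=
  ⟨fun h g hg => h ⟨g, hg⟩, fun h g => h g.2⟩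

theorem fixedGraph_inc_iff {i : 𝒢.OrbitEdge} {x : 𝒢.OrbitVertex} :
    (𝒢.fixedGraph R).Inc i x ↔ 𝒢.Incident i x ∧ R ≤ MulAction.stabilizer 𝒢.Completion i := by
  constructor
  · rintro ⟨y, hi, -, -, h⟩
    exact ⟨(𝒢.orbitGraph_inc_iff).1 ⟨y, h⟩, mem_fixedPoints_iff_le_stabilizer.1 hi⟩
  · rintro ⟨h, hi⟩
    obtain ⟨y, hy⟩ := (𝒢.orbitGraph_inc_iff).2 h
    exact ⟨y, mem_fixedPoints_iff_le_stabilizer.2 hi,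
      mem_fixedPoints_iff_le_stabilizer.2 (hi.trans h.stabilizer_le),
      mem_fixedPoints_iff_le_stabilizer.2
        (hi.trans ((𝒢.orbitGraph_inc_iff).1 ⟨x, hy.symm⟩ : 𝒢.Incident i y).stabilizer_le), hy⟩

theorem centralizerQuotient_inc_iff {ε α} :
    (𝒢.centralizerQuotient R).Inc ε α ↔ ∃ i x, (𝒢.fixedGraph R).Inc i x ∧
      Quotient.mk'' i = ε ∧ Quotient.mk'' x = α := by
  constructor
  · rintro ⟨β, i, x, y, h, hi, hx, -⟩
    exact ⟨i, x, ⟨y, h⟩, hi, hx⟩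
  · rintro ⟨i, x, ⟨y, h⟩, rfl, rfl⟩
    exact ⟨_, i, x, y, h, rfl, rfl, rfl⟩

theorem LiesOver.le_stabilizer {z a} (h : LiesOver R z a) :
    R ≤ MulAction.stabilizer 𝒢.Completion z := by
  rcases z with x | i <;> rcases a with a | a
  · rw [stabilizer_inl]; exact h.1
  · exact h.elim
  · exact h.elim
  · rw [stabilizer_inr]; exact h.1

theorem exists_liesOver_of_le_stabilizer {z : 𝒢.OrbitVertex ⊕ 𝒢.OrbitEdge}
    (h : R ≤ MulAction.stabilizer 𝒢.Completion z) : ∃ a, LiesOver R z a := by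
  rcases z with x | i
  · rw [stabilizer_inl] at h
    exact ⟨.inl ⟨_, x, mem_fixedPoints_iff_le_stabilizer.2 h, rfl⟩, h, rfl⟩
  · rw [stabilizer_inr] at h
    obtain ⟨x, hx⟩ := exists_incident i
    have h1 := centralizerQuotient_inc_iff.2 ⟨i, x, fixedGraph_inc_iff.2 ⟨hx, h⟩, rfl, rfl⟩
    exact ⟨.inr ⟨_, h1.edge_mem⟩, h, rfl⟩

theorem exists_liesOver (a) : ∃ z, LiesOver R z a := by
  rcases a with ⟨_, x, hx, rfl⟩ | ⟨ε, hε⟩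
  · exact ⟨.inl x, mem_fixedPoints_iff_le_stabilizer.1 hx, rfl⟩
  · obtain ⟨α, β, hαβ⟩ := hε
    obtain ⟨i, x, h, rfl, rfl⟩ := centralizerQuotient_inc_iff.1 ⟨β, hαβ⟩
    exact ⟨.inr i, (fixedGraph_inc_iff.1 h).2, rfl⟩

theorem mk_centralizer_eq_iff {α : Type*} [MulAction 𝒢.Completion α] {x y : α} :
    (Quotient.mk'' x : MulAction.orbitRel.Quotient
      (Subgroup.centralizer (R : Set 𝒢.Completion)) α) = Quotient.mk'' y ↔
      ∃ c ∈ Subgroup.centralizer (R : Set 𝒢.Completion), c • x = y := by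
  rw [eq_comm, Quotient.eq'']
  constructor
  · rintro ⟨c, hc⟩
    exact ⟨c, c.2, hc⟩
  · rintro ⟨c, hc, h⟩
    exact ⟨⟨c, hc⟩, h⟩

theorem LiesOver.exists_smul_eq {z z' a} (h : LiesOver R z a) (h' : LiesOver R z' a) :
    ∃ c ∈ Subgroup.centralizer (R : Set 𝒢.Completion), c • z = z' := by
  rcases z with x | i <;> rcases a with a | a <;> rcases z' with y | j <;>
    first | exact h.elim | exact h'.elim | skip
  · obtain ⟨c, hc, hcx⟩ := mk_centralizer_eq_iff.1 (h.2.trans h'.2.symm)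
    exact ⟨c, hc, congrArg Sum.inl hcx⟩
  · obtain ⟨c, hc, hcx⟩ := mk_centralizer_eq_iff.1 (h.2.trans h'.2.symm)
    exact ⟨c, hc, congrArg Sum.inr hcx⟩

theorem LiesOver.smul {z a} (h : LiesOver R z a) {c : 𝒢.Completion}
    (hc : c ∈ Subgroup.centralizer (R : Set 𝒢.Completion)) : LiesOver R (c • z) a := by
  have hR := mem_normalizer_iff_conj.1 (centralizer_le_normalizer R hc)
  have hst : ∀ {α : Type (max u₁ u₂)} [MulAction 𝒢.Completion α] {x : α},
      R ≤ MulAction.stabilizer 𝒢.Completion x → R ≤ MulAction.stabilizer 𝒢.Completion (c • x) := by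
    intro α _ x hx
    rw [stabilizer_smul_eq, ← hR]
    exact conj_smul_mono hx
  rcases z with x | i <;> rcases a with a | a
  · exact ⟨hst h.1, (mk_centralizer_eq_iff.2 ⟨c, hc, rfl⟩).symm.trans h.2⟩
  · exact h.elim
  · exact h.elim
  · exact ⟨hst h.1, (mk_centralizer_eq_iff.2 ⟨c, hc, rfl⟩).symm.trans h.2⟩

theorem LiesOver.unique {z a b} (h : LiesOver R z a) (h' : LiesOver R z b) : a = b := by
  rcases z with x | i <;> rcases a with a | a <;> rcases b with b | b <;>
    first | exact h.elim | exact h'.elim | skip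
  · exact congrArg Sum.inl (Subtype.ext (h.2.symm.trans h'.2))
  · exact congrArg Sum.inr (Subtype.ext (h.2.symm.trans h'.2))

theorem LiesOver.isLeft_eq {z a} (h : LiesOver R z a) : a.isLeft = z.isLeft := by
  rcases z with x | i <;> rcases a with a | a <;> first | exact h.elim | rfl

theorem subdivision_adj_iff {α β : Type*} {Γ : Graph α β} {a b : Γ.vertexSet ⊕ Γ.edgeSet} :
    Γ.subdivision.Adj a b ↔ (∃ x e, a = Sum.inl x ∧ b = Sum.inr e ∧ Γ.Inc (e : β) (x : α)) ∨
      ∃ x e, b = Sum.inl x ∧ a = Sum.inr e ∧ Γ.Inc (e : β) (x : α) := by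
  rw [Graph.subdivision, SimpleGraph.fromRel_adj, and_iff_right_iff_imp]
  rintro (⟨x, i, rfl, rfl, -⟩ | ⟨x, i, rfl, rfl, -⟩) <;> simp

theorem LiesOver.adj {z z' a a'} (h : LiesOver R z a) (h' : LiesOver R z' a')
    (hz : 𝒢.incidenceGraph.Adj z z') : (𝒢.centralizerQuotient R).subdivision.Adj a a' := by
  rcases incidenceGraph_adj_iff.1 hz with ⟨x, i, rfl, rfl, hi⟩ | ⟨x, i, rfl, rfl, hi⟩ <;>
    rcases a with a | a <;> rcases a' with b | b <;>
    first | exact h.elim | exact h'.elim | skip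
  · exact subdivision_adj_iff.2 (Or.inl ⟨_, _, rfl, rfl, centralizerQuotient_inc_iff.2
      ⟨i, x, fixedGraph_inc_iff.2 ⟨hi, h'.1⟩, h'.2, h.2⟩⟩)
  · exact subdivision_adj_iff.2 (Or.inr ⟨_, _, rfl, rfl, centralizerQuotient_inc_iff.2
      ⟨i, x, fixedGraph_inc_iff.2 ⟨hi, h.1⟩, h.2, h'.2⟩⟩)

theorem LiesOver.exists_adj {z a a'} (h : LiesOver R z a)
    (ha : (𝒢.centralizerQuotient R).subdivision.Adj a a') :
    ∃ z', LiesOver R z' a' ∧ 𝒢.incidenceGraph.Adj z z' := by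
  obtain ⟨z₁, z₂, h₁, h₂, hz⟩ :
      ∃ z₁ z₂, LiesOver R z₁ a ∧ LiesOver R z₂ a' ∧ 𝒢.incidenceGraph.Adj z₁ z₂ := by
    rcases subdivision_adj_iff.1 ha with ⟨α, ε, rfl, rfl, hi⟩ | ⟨α, ε, rfl, rfl, hi⟩ <;>
      obtain ⟨i, x, hix, hi, hx⟩ := centralizerQuotient_inc_iff.1 hi <;>
      obtain ⟨hix, hR⟩ := fixedGraph_inc_iff.1 hix
    · exact ⟨.inl x, .inr i, ⟨hR.trans hix.stabilizer_le, hx⟩, ⟨hR, hi⟩,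
        incidenceGraph_adj_inl_inr.2 hix⟩
    · exact ⟨.inr i, .inl x, ⟨hR, hi⟩, ⟨hR.trans hix.stabilizer_le, hx⟩,
        (incidenceGraph_adj_inl_inr.2 hix).symm⟩
  obtain ⟨c, hc, rfl⟩ := h₁.exists_smul_eq h
  exact ⟨c • z₂, h₂.smul hc, incidenceGraph_adj_smul c hz⟩

/-- The normalizer acts on the quotient of the fixed graph by the centralizer. -/
theorem exists_normalizer_action (R : Subgroup 𝒢.Completion) :
    ∃ f : Subgroup.normalizer (R : Set 𝒢.Completion) →
      ((𝒢.centralizerQuotient R).subdivision →g (𝒢.centralizerQuotient R).subdivision),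
      ∀ (n : Subgroup.normalizer (R : Set 𝒢.Completion)) z a,
        LiesOver R z a → LiesOver R ((n : 𝒢.Completion) • z) (f n a) := by
  choose s hs using exists_liesOver (𝒢 := 𝒢) (R := R)
  have hR : ∀ (n : Subgroup.normalizer (R : Set 𝒢.Completion)) a,
      R ≤ MulAction.stabilizer 𝒢.Completion ((n : 𝒢.Completion) • s a) := by
    intro n a
    rw [stabilizer_smul_eq]
    conv_lhs => rw [← mem_normalizer_iff_conj.1 n.2]
    exact conj_smul_mono (hs a).le_stabilizer
  choose f hf using fun n a => exists_liesOver_of_le_stabilizer (hR n a)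
  have key : ∀ (n : Subgroup.normalizer (R : Set 𝒢.Completion)) z a,
        LiesOver R z a → LiesOver R ((n : 𝒢.Completion) • z) (f n a) := by
    intro n z a h
    obtain ⟨c, hc, rfl⟩ := (hs a).exists_smul_eq h
    -- The centralizer is normal in the normaliser, so the action on its orbits is well defined.
    have hc' : (n : 𝒢.Completion) * c * (n : 𝒢.Completion)⁻¹ ∈
        Subgroup.centralizer (R : Set 𝒢.Completion) := by
      rw [← conj_smul_centralizer_eq_of_mem_normalizer n.2, mem_conj_smul]
      simpa [mul_assoc] using hc
    have h1 := (hf n a).smul hc'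
    rw [smul_smul] at h1 ⊢
    simpa using h1
  refine ⟨fun n => ⟨f n, fun {a b} hab => ?_⟩, key⟩
  obtain ⟨z, hz, hadj⟩ := (hs a).exists_adj hab
  exact (key n _ _ (hs a)).adj (key n _ _ hz) (incidenceGraph_adj_smul _ hadj)

end CentralizerQuotient

section Centric

variable {V : Type u₁} {T : SimpleGraph V} {𝒢 : TreeOfGroups.{u₁, u₂, u₃} T}
  [∀ v, Finite (𝒢.vertexGroup v)] {p : ℕ} [Fact p.Prime] {R : Subgroup 𝒢.Completion}

/-- The lifting step across one edge. A Sylow subgroup `E` of the stabilizer of `i` in `A C(R)`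
satisfies `E C(R) = A C(R)`, because `A` preserves the `C(R)`-orbit of `i`. By centricity
`p`-subgroups meet `C(R)` inside `R`, so `A` is a Sylow subgroup of the stabilizer of `x` in `A
C(R)`, and a conjugate of `E` there equals `A`. Writing the conjugator as `a c`, the edge `c • i` is
fixed by `A`. -/
theorem exists_smul_le_stabilizer_of_incident
    (hcent : ∀ E : Subgroup 𝒢.Completion, IsFinP p E → E ≤ Subgroup.centralizer R → E ≤ R)
    {A : Subgroup 𝒢.Completion} (hA : IsFinP p A) (hRA : R ≤ A)
    (hAN : A ≤ Subgroup.normalizer (R : Set 𝒢.Completion)) {i : 𝒢.OrbitEdge} {x : 𝒢.OrbitVertex}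
    (hi : 𝒢.Incident i x) (hRi : R ≤ MulAction.stabilizer 𝒢.Completion i)
    (hAx : A ≤ MulAction.stabilizer 𝒢.Completion x)
    (hAi : ∀ a ∈ A, ∃ c ∈ Subgroup.centralizer (R : Set 𝒢.Completion), c • a • i = i) :
    ∃ c ∈ Subgroup.centralizer (R : Set 𝒢.Completion),
      A ≤ MulAction.stabilizer 𝒢.Completion (c • i) := by
  set C := Subgroup.centralizer (R : Set 𝒢.Completion) with hC
  have hR : IsFinP p R := hA.mono hRA
  have hAC : A ≤ Subgroup.normalizer (C : Set 𝒢.Completion) := le_normalizer_centralizer_of_le hAN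
  have hACN : A ⊔ C ≤ Subgroup.normalizer (R : Set 𝒢.Completion) :=
    sup_le hAN (centralizer_le_normalizer R)
  set L := (A ⊔ C) ⊓ MulAction.stabilizer 𝒢.Completion i with hL
  have : Finite L := Finite.of_injective _ (Subgroup.inclusion_injective inf_le_right)
  obtain ⟨E, hE⟩ := exists_isSyl (p := p) L
  have hLN : L ≤ Subgroup.normalizer (R : Set 𝒢.Completion) := inf_le_left.trans hACN
  have hRE : R ≤ E := hE.le_of_le_normalizer hR (le_inf (hRA.trans le_sup_left) hRi) hLN
  have hLE : L ≤ E ⊔ C := hE.le_sup_centralizer hLN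
    ((hA.inducedAut R).mono ((inducedAut_le_iff hLN hAN).2 inf_le_left))
  have hAE : A ⊔ C ≤ E ⊔ C := by
    refine sup_le (fun a ha => ?_) le_sup_right
    obtain ⟨c, hc, hca⟩ := hAi a ha
    have h1 : c * a ∈ L := by
      refine ⟨mul_mem (Subgroup.mem_sup_right hc) (Subgroup.mem_sup_left ha), ?_⟩
      change (c * a) • i = i
      rw [mul_smul, hca]
    exact (Subgroup.mul_mem_cancel_left _ (Subgroup.mem_sup_right hc)).1 (hLE h1)
  set K := (A ⊔ C) ⊓ MulAction.stabilizer 𝒢.Completion x with hK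
  have : Finite K := Finite.of_injective _ (Subgroup.inclusion_injective inf_le_right)
  have hAK : A ≤ K := le_inf le_sup_left hAx
  have hinter : ∀ W : Subgroup 𝒢.Completion, IsFinP p W → W ⊓ C ≤ R := fun W hW =>
    hcent _ (hW.mono inf_le_left) inf_le_right
  have hAsyl : IsSyl p K A := by
    obtain ⟨W, hW⟩ := exists_isSyl (p := p) K
    obtain ⟨l, hl, hAW, hW'⟩ := hW.exists_ge hAK hA
    refine (le_antisymm hAW fun w hw => ?_ : A = _) ▸ hW'
    obtain ⟨a, ha, c, hc, rfl⟩ := exists_mul_of_mem_sup hAC (hW'.1 hw).1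
    exact mul_mem ha (hRA (hinter _ hW'.2.1
      ⟨(Subgroup.mul_mem_cancel_left _ (hAW ha)).1 hw, hc⟩))
  obtain ⟨l, hl, hlE⟩ := hAsyl.2.2 E
    (le_inf (hE.1.trans inf_le_left) ((hE.1.trans inf_le_right).trans hi.stabilizer_le)) hE.2.1
  have hlN := hACN hl.1
  have hRl : R ≤ MulAut.conj l • E := by
    rw [← mem_normalizer_iff_conj.1 hlN]
    exact conj_smul_mono hRE
  have hAl : A ≤ MulAut.conj l • E ⊔ C := by
    have h1 : A ⊔ C ≤ MulAut.conj l • (E ⊔ C) := by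
      rw [← conj_smul_eq_of_mem hl.1]
      exact conj_smul_mono hAE
    rw [Subgroup.smul_sup, hC, conj_smul_centralizer_eq_of_mem_normalizer hlN] at h1
    exact le_sup_left.trans h1
  have hEN : MulAut.conj l • E ≤ Subgroup.normalizer (C : Set 𝒢.Completion) := hlE.trans hAC
  have hAE' : A ≤ MulAut.conj l • E := by
    intro a ha
    obtain ⟨e, he, c, hc, rfl⟩ := exists_mul_of_mem_sup hEN (hAl ha)
    exact mul_mem he (hRl (hinter _ hA ⟨(Subgroup.mul_mem_cancel_left _ (hlE he)).1 ha, hc⟩))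
  obtain ⟨a, ha, c, hc, rfl⟩ := exists_mul_of_mem_sup hAC hl.1
  refine ⟨c, hc, ?_⟩
  rw [conj_mul_smul, ← conj_inv_smul_le, conj_smul_eq_of_mem (inv_mem ha)] at hAE'
  rw [stabilizer_smul_eq]
  exact hAE'.trans (conj_smul_mono (hE.1.trans inf_le_right))

/-- A finite `p`-subgroup that contains the `p`-subgroups of its centralizer is well placed if the
quotient of its fixed graph by its centralizer is a tree. -/
theorem isGood_of_isMultiTree (hR : IsFinP p R) (hX : (𝒢.centralizerQuotient R).IsMultiTree)
    (hcent : ∀ E : Subgroup 𝒢.Completion, IsFinP p E → E ≤ Subgroup.centralizer R → E ≤ R) :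
    IsGood p R := by
  have := hR.1
  set N := Subgroup.normalizer (R : Set 𝒢.Completion) with hN
  set C := Subgroup.centralizer (R : Set 𝒢.Completion) with hC
  have hCN : C ≤ N := centralizer_le_normalizer R
  obtain ⟨f, hf⟩ := exists_normalizer_action R
  have hmul : ∀ m n a, f (m * n) a = f m (f n a) := by
    intro m n a
    obtain ⟨z, hz⟩ := exists_liesOver (𝒢 := 𝒢) (R := R) a
    have h1 := hf (m * n) z a hz
    rw [Subgroup.coe_mul, mul_smul] at h1
    exact h1.unique (hf m _ _ (hf n z a hz))
  have hone : ∀ a, f 1 a = a := by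
    intro a
    obtain ⟨z, hz⟩ := exists_liesOver a
    have h1 := hf 1 z a hz
    rw [Subgroup.coe_one, one_smul] at h1
    exact h1.unique hz
  have hinj : ∀ n, Function.Injective (f n) := fun n =>
    Function.LeftInverse.injective (g := f n⁻¹) fun a => by rw [← hmul, inv_mul_cancel, hone]
  -- `D` is the full preimage in `N` of a Sylow subgroup of the automorphisms induced on `R`. It
  -- contains `C` and acts on the quotient tree.
  obtain ⟨Δ, hΔ⟩ := exists_isSyl (p := p) (inducedAut R N)
  set D := (Δ.comap R.normalizerMonoidHom).map N.subtype with hD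
  have hDN : D ≤ N := Subgroup.map_subtype_le _
  have hDind : inducedAut R D = Δ := by
    rw [inducedAut, hD, Subgroup.subgroupOf, Subgroup.comap_map_eq_self_of_injective
      N.subtype_injective, Subgroup.map_comap_eq_self]
    intro α hα
    obtain ⟨n, -, rfl⟩ := hΔ.1 hα
    exact ⟨n, rfl⟩
  have hmax : ∀ A ≤ N, inducedAut R A ≤ Δ → A ≤ D := by
    intro A hAN hAΔ a ha
    exact ⟨⟨a, hAN ha⟩, hAΔ ⟨⟨a, hAN ha⟩, ha, rfl⟩, rfl⟩
  have hCD : C ≤ D := by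
    intro c hc
    refine ⟨⟨c, hCN hc⟩, ?_, rfl⟩
    have h1 : (⟨c, hCN hc⟩ : N) ∈ R.normalizerMonoidHom.ker := mem_ker_normalizerMonoidHom.2 hc
    change R.normalizerMonoidHom ⟨c, hCN hc⟩ ∈ Δ
    rw [MonoidHom.mem_ker.1 h1]
    exact one_mem _
  have hRD : R ≤ D := by
    refine hmax R Subgroup.le_normalizer ?_
    obtain ⟨_, ⟨n, -, rfl⟩, hn⟩ := hΔ.2.2 (inducedAut R R)
      (inducedAut_mono R Subgroup.le_normalizer) (hR.inducedAut R)
    rwa [← inducedAut_conj, mem_normalizer_iff_conj.1 n.2] at hn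
  obtain ⟨a₀⟩ := hX.2.1.nonempty
  obtain ⟨a, ha⟩ := hX.2.exists_fixed (A := D) (fun d => f ⟨d, hDN d.2⟩)
    (fun d e b => hmul ⟨d, hDN d.2⟩ ⟨e, hDN e.2⟩ b) a₀ (by
      -- `C` acts trivially on the quotient, so orbits are images of the finite group `Aut(R)`.
      have h1 : Function.FactorsThrough (fun d : D => f ⟨d, hDN d.2⟩ a₀)
          (fun d : D => R.normalizerMonoidHom ⟨d, hDN d.2⟩) := by
        intro d e hde
        obtain ⟨z, hz⟩ := exists_liesOver a₀
        have h2 : (⟨e, hDN e.2⟩ * ⟨d, hDN d.2⟩⁻¹ : N) ∈ R.normalizerMonoidHom.ker := by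
          rw [MonoidHom.mem_ker, map_mul, map_inv, mul_inv_eq_one]
          exact hde.symm
        have h3 := (hf ⟨d, hDN d.2⟩ z a₀ hz).smul (mem_ker_normalizerMonoidHom.1 h2)
        rw [smul_smul] at h3
        have h4 : LiesOver R ((e : 𝒢.Completion) • z) (f ⟨d, hDN d.2⟩ a₀) := by simpa using h3
        exact h4.unique (hf ⟨e, hDN e.2⟩ z a₀ hz)
      refine (Set.finite_range (Function.extend (fun d : D => R.normalizerMonoidHom ⟨d, hDN d.2⟩)
        (fun d : D => f ⟨d, hDN d.2⟩ a₀) fun _ => a₀)).subset ?_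
      rintro _ ⟨d, rfl⟩
      exact ⟨_, h1.extend_apply _ d⟩)
    Sum.isLeft (by
      intro b c h
      rcases subdivision_adj_iff.1 h with ⟨x, i, rfl, rfl, -⟩ | ⟨x, i, rfl, rfl, -⟩ <;> simp)
    (by
      intro d b
      obtain ⟨z, hz⟩ := exists_liesOver b
      rw [(hf ⟨d, hDN d.2⟩ z b hz).isLeft_eq, hz.isLeft_eq]
      cases z <;> rfl)
  obtain ⟨z, hz⟩ := exists_liesOver a
  set Dz := D ⊓ MulAction.stabilizer 𝒢.Completion z with hDz
  have : Finite Dz := Finite.of_injective _ (Subgroup.inclusion_injective inf_le_right)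
  -- `D` fixes the `C`-orbit of `z`, so each of its elements can be corrected by `C` to fix `z`
  -- itself. Hence `Δ` is already induced by the finite group `Dz`.
  have hDzC : D ≤ Dz ⊔ C := by
    intro d hd
    have h1 := hf ⟨d, hDN hd⟩ z a hz
    rw [ha ⟨d, hd⟩] at h1
    obtain ⟨c, hc, hcz⟩ := h1.exists_smul_eq hz
    have h2 : c * d ∈ Dz := ⟨mul_mem (hCD hc) hd, by
      change (c * d) • z = z
      rw [mul_smul]
      exact hcz⟩
    exact (Subgroup.mul_mem_cancel_left _ (Subgroup.mem_sup_right hc)).1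
      (Subgroup.mem_sup_left h2)
  obtain ⟨B, hB⟩ := exists_isSyl (p := p) Dz
  have hDzN : Dz ≤ N := inf_le_left.trans hDN
  have hBN : B ≤ N := hB.1.trans hDzN
  have hDzB : Dz ≤ B ⊔ C := hB.le_sup_centralizer hDzN
    (hΔ.2.1.mono (hDind ▸ inducedAut_mono R inf_le_left))
  have hDB : D ≤ B ⊔ C := hDzC.trans (sup_le hDzB le_sup_right)
  have hBind : inducedAut R B = Δ := le_antisymm
    (hDind ▸ inducedAut_mono R (hB.1.trans inf_le_left))
    (hDind ▸ (inducedAut_le_iff hDN hBN).2 hDB)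
  refine isGood_of_isSyl_inducedAut hBN hB.2.1 (hBind ▸ hΔ) fun A hAB hA => ?_
  have hAD : A ≤ D := hAB.trans (sup_le (hB.1.trans inf_le_left) hCD)
  set A' := A ⊔ R with hA'
  have hA'p : IsFinP p A' := hA.sup hR (hAD.trans hDN)
  have hA'D : A' ≤ D := sup_le hAD hRD
  have := hA'p.1
  obtain ⟨y, hy⟩ := exists_le_stabilizer A'
  have hy' : A' ≤ MulAction.stabilizer 𝒢.Completion
      (Sum.inl y : 𝒢.OrbitVertex ⊕ 𝒢.OrbitEdge) := by rwa [stabilizer_inl]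
  obtain ⟨b, hb⟩ := exists_liesOver_of_le_stabilizer (le_sup_right.trans hy')
  -- The path from the image `b` of a vertex fixed by `A'` to `a` is fixed by `A'`; along it, fixed
  -- lifts are found one edge at a time, ending with a lift of `a`.
  obtain ⟨z', hz', hAz'⟩ := hX.2.fixed_induction
    (fun d : A' => f ⟨d, hDN (hA'D d.2)⟩)
    (fun b => ∃ z', LiesOver R z' b ∧ A' ≤ MulAction.stabilizer 𝒢.Completion z') (by
      rintro u w huw hu hw ⟨z₁, hz₁, hAz₁⟩
      obtain ⟨z₂, hz₂, hadj⟩ := hz₁.exists_adj huw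
      rcases incidenceGraph_adj_iff.1 hadj with ⟨x, i, rfl, rfl, hi⟩ | ⟨x, i, rfl, rfl, hi⟩
      · rw [stabilizer_inl] at hAz₁
        have hRi := hz₂.le_stabilizer
        rw [stabilizer_inr] at hRi
        obtain ⟨c, hc, hcA⟩ := exists_smul_le_stabilizer_of_incident hcent hA'p le_sup_right
          (hA'D.trans hDN) hi hRi hAz₁ (by
            intro d hd
            have h1 := hf ⟨d, hDN (hA'D hd)⟩ _ _ hz₂
            rw [hw ⟨d, hd⟩] at h1
            obtain ⟨c, hc, hcz⟩ := h1.exists_smul_eq hz₂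
            exact ⟨c, hc, Sum.inr_injective hcz⟩)
        exact ⟨_, hz₂.smul hc, hcA.trans (stabilizer_inr _).ge⟩
      · rw [stabilizer_inr] at hAz₁
        exact ⟨_, hz₂, (hAz₁.trans hi.stabilizer_le).trans (stabilizer_inl _).ge⟩)
    (x := b) (y := a) (by
      intro d
      have h1 := hf ⟨d, hDN (hA'D d.2)⟩ _ _ hb
      have h2 : (d : 𝒢.Completion) • (Sum.inl y : 𝒢.OrbitVertex ⊕ 𝒢.OrbitEdge) = Sum.inl y :=
        hy' d.2
      dsimp only at h1
      rw [h2] at h1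
      exact h1.unique hb)
    (fun d => ha ⟨d, hA'D d.2⟩) (fun d => hinj _) ⟨_, hb, hy'⟩
  obtain ⟨c, hc, rfl⟩ := hz'.exists_smul_eq hz
  have h1 : MulAut.conj c • A' ≤ Dz := by
    refine le_inf (conj_smul_le_of_mem (hCD hc) hA'D) ?_
    rw [stabilizer_smul_eq]
    exact conj_smul_mono hAz'
  obtain ⟨l, hl, hlA⟩ := hB.2.2 _ h1 (hA'p.conj c)
  -- The factor `b'` in `B` is dropped, so that the whole conjugator centralizes `R`.
  obtain ⟨b', hb', c', hc', rfl⟩ := exists_mul_of_mem_sup (le_normalizer_centralizer_of_le hBN)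
    (hDzB hl)
  refine ⟨c' * c, mul_mem hc' hc, ?_⟩
  rw [conj_mul_smul, conj_smul_le_iff, conj_smul_eq_of_mem (inv_mem hb')] at hlA
  rw [conj_mul_smul]
  exact (conj_smul_mono (conj_smul_mono le_sup_left)).trans hlA

end Centric

end TreeOfGroups

section SylowExistence

theorem exists_lt_of_not_isSyl {G : Type*} [Group G] {p : ℕ} [Fact p.Prime] {P L : Subgroup G}
    [Finite L] (hP : IsFinP p P) (hPL : P ≤ L) (h : ¬ IsSyl p L P) :
    ∃ A ≤ L, IsFinP p A ∧ P < A := by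
  obtain ⟨W, hW⟩ := exists_isSyl (p := p) L
  obtain ⟨l, -, hl, hW'⟩ := hW.exists_ge hPL hP
  exact ⟨_, hW'.1, hW'.2.1, lt_of_le_of_ne hl fun h' => h (h' ▸ hW')⟩

theorem IsSyl.card_le {G : Type*} [Group G] {p : ℕ} {P L : Subgroup G} (h : IsSyl p L P) {g : G}
    {A : Subgroup G} (hA : IsFinP p A) (hAL : MulAut.conj g • A ≤ L) :
    Nat.card A ≤ Nat.card P := by
  obtain ⟨l, -, hl⟩ := h.2.2 _ hAL (hA.conj g)
  have := h.2.1.1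
  rw [← card_conj_smul g, ← card_conj_smul l]
  exact Subgroup.card_le_of_le hl

theorem not_isSyl_of_conj_le {G : Type*} [Group G] {p : ℕ} {P L : Subgroup G} {g : G}
    {A : Subgroup G} (hA : IsFinP p A) (hPA : P < A) (hAL : MulAut.conj g • A ≤ L) :
    ¬ IsSyl p L P := fun h =>
  have := hA.1
  (h.card_le hA hAL).not_gt (card_lt_of_lt hPA)

end SylowExistence

/-! ### Non-essential subgroups: chains of links across the orbit tree. -/

namespace TreeOfGroups

section NonEssential

variable {V : Type u₁} {T : SimpleGraph V} {𝒢 : TreeOfGroups.{u₁, u₂, u₃} T}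
  [∀ v, Finite (𝒢.vertexGroup v)] {p : ℕ} [Fact p.Prime] {P : Subgroup 𝒢.Completion}

/-- No conjugate of `P` is an essential subgroup of a vertex group. -/
def IsNowhereEssential (𝒢 : TreeOfGroups.{u₁, u₂, u₃} T) [∀ v, Finite (𝒢.vertexGroup v)]
    {p : ℕ} (S : ∀ v, Sylow p (𝒢.vertexGroup v)) (P : Subgroup 𝒢.Completion) : Prop :=
  ∀ (v : V) (Q : Subgroup (S v : Subgroup (𝒢.vertexGroup v))) (g : 𝒢.Completion),
    P = MulAut.conj g • (Q.map (S v : Subgroup (𝒢.vertexGroup v)).subtype).map (𝒢.vertexMap v) →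
    ¬ (groupFusion (𝒢.vertexGroup v) (S v)).IsEssential p Q

/-- Identifies the stabilizer of `x` with its vertex group so that `P` corresponds to a subgroup of
the chosen Sylow subgroup, where essentiality is defined; this adjusts the coset representative by
an element of the vertex group. -/
theorem exists_vertexGroup_hom (S : ∀ v, Sylow p (𝒢.vertexGroup v)) (hP : IsFinP p P)
    {x : 𝒢.OrbitVertex} (hx : P ≤ MulAction.stabilizer 𝒢.Completion x) :
    ∃ (f : 𝒢.vertexGroup x.1 →* 𝒢.Completion)
      (Q : Subgroup (S x.1 : Subgroup (𝒢.vertexGroup x.1))) (g : 𝒢.Completion),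
      Function.Injective f ∧ f.range = MulAction.stabilizer 𝒢.Completion x ∧
      (Q.map (S x.1 : Subgroup (𝒢.vertexGroup x.1)).subtype).map f = P ∧
      P = MulAut.conj g • (Q.map (S x.1 : Subgroup (𝒢.vertexGroup x.1)).subtype).map
        (𝒢.vertexMap x.1) := by
  obtain ⟨v, q⟩ := x
  obtain ⟨g, rfl⟩ := QuotientGroup.mk_surjective q
  dsimp only
  have key : ∀ g : 𝒢.Completion, Function.Injective
      ((MulAut.conj g).toMonoidHom.comp (𝒢.vertexMap v)) := fun g =>
    (MulAut.conj g).injective.comp (𝒢.vertexMap_injective v)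
  have hrange : ∀ g : 𝒢.Completion, ((MulAut.conj g).toMonoidHom.comp (𝒢.vertexMap v)).range =
      MulAction.stabilizer 𝒢.Completion (⟨v, g⟩ : 𝒢.OrbitVertex) := by
    intro g
    rw [stabilizer_vertex, MonoidHom.range_comp]
    rfl
  set f₀ := (MulAut.conj g).toMonoidHom.comp (𝒢.vertexMap v) with hf₀
  have hP₁ : (P.comap f₀).map f₀ = P := Subgroup.map_comap_eq_self (by rwa [hrange])
  have hP₁p : IsFinP p (P.comap f₀) := ⟨inferInstance, hP.2.comap_of_injective _ (key g)⟩
  obtain ⟨k, -, hk⟩ := (isSyl_top_of_sylow (S v)).2.2 _ le_top hP₁p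
  set Q := (MulAut.conj k • P.comap f₀).subgroupOf (S v : Subgroup (𝒢.vertexGroup v)) with hQ
  have hQmap : Q.map (S v : Subgroup (𝒢.vertexGroup v)).subtype = MulAut.conj k • P.comap f₀ :=
    Subgroup.map_subgroupOf_eq_of_le hk
  set g' := g * (𝒢.vertexMap v k)⁻¹ with hg'
  have hmk : (⟨v, g'⟩ : 𝒢.OrbitVertex) = ⟨v, g⟩ := by
    refine congrArg (Sigma.mk v) (QuotientGroup.eq.2 ?_)
    exact ⟨k, by rw [hg']; group⟩
  have hmap : (MulAut.conj k • P.comap f₀).map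
      ((MulAut.conj g').toMonoidHom.comp (𝒢.vertexMap v)) = P := by
    rw [conj_smul_eq_map, Subgroup.map_map]
    conv_rhs => rw [← hP₁]
    congr 1
    ext y
    simp [hf₀, hg', mul_assoc]
  refine ⟨(MulAut.conj g').toMonoidHom.comp (𝒢.vertexMap v), Q, g', key g', ?_, ?_, ?_⟩
  · rw [hrange, hmk]
  · rw [hQmap, hmap]
  · rw [hQmap, conj_smul_eq_map, Subgroup.map_map, hmap]

variable {S : ∀ v, Sylow p (𝒢.vertexGroup v)}

theorem reflTransGen_link_of_le_stabilizer (hne : 𝒢.IsNowhereEssential S P) (hP : IsFinP p P)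
    {x : 𝒢.OrbitVertex} {A B : Subgroup 𝒢.Completion}
    (hA : IsFinP p A) (hB : IsFinP p B) (hPA : P < A) (hPB : P < B)
    (hAx : A ≤ MulAction.stabilizer 𝒢.Completion x)
    (hBx : B ≤ MulAction.stabilizer 𝒢.Completion x) : Relation.ReflTransGen (Link p P) A B := by
  obtain ⟨f, Q, g, hf, hfr, hQ, hg⟩ := exists_vertexGroup_hom S hP (hPA.le.trans hAx)
  have h1 := isLinkConnected_of_not_isEssential (S x.1).isPGroup' (hne _ Q g hg)
  have hmap : ∀ {D : Subgroup 𝒢.Completion}, D ≤ MulAction.stabilizer 𝒢.Completion x →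
      (D.comap f).map f = D := fun h => Subgroup.map_comap_eq_self (by rwa [hfr])
  have hp : ∀ {D : Subgroup 𝒢.Completion}, IsFinP p D → IsFinP p (D.comap f) := fun h =>
    ⟨inferInstance, h.2.comap_of_injective _ hf⟩
  have hlt : ∀ {D : Subgroup 𝒢.Completion}, P < D → D ≤ MulAction.stabilizer 𝒢.Completion x →
      Q.map (S x.1 : Subgroup (𝒢.vertexGroup x.1)).subtype < D.comap f := by
    intro D hD hDx
    rw [← Subgroup.map_lt_map_iff_of_injective hf, hQ, hmap hDx]
    exact hD
  have h2 := h1 _ _ (hp hA) (hp hB) (hlt hPA hAx) (hlt hPB hBx)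
  have h3 := h2.lift (fun D => D.map f) fun _ _ h => h.map hf
  change Relation.ReflTransGen _ ((A.comap f).map f) ((B.comap f).map f) at h3
  rwa [hmap hAx, hmap hBx, hQ] at h3

/-- The case in which `P` itself is Sylow in a stabilizer: being non-essential, it has only inner
induced automorphisms there. -/
theorem normalizer_inf_stabilizer_le (hne : 𝒢.IsNowhereEssential S P)
    {x : 𝒢.OrbitVertex} (hsyl : IsSyl p (MulAction.stabilizer 𝒢.Completion x) P) :
    Subgroup.normalizer (P : Set 𝒢.Completion) ⊓ MulAction.stabilizer 𝒢.Completion x ≤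
      P ⊔ Subgroup.centralizer (P : Set 𝒢.Completion) := by
  obtain ⟨f, Q, g, hf, hfr, hQ, hg⟩ := exists_vertexGroup_hom S hsyl.2.1 hsyl.1
  set P₁ := Q.map (S x.1 : Subgroup (𝒢.vertexGroup x.1)).subtype with hP₁
  have hconj : ∀ (k : 𝒢.vertexGroup x.1) (D : Subgroup (𝒢.vertexGroup x.1)),
      (MulAut.conj k • D).map f = MulAut.conj (f k) • D.map f := by
    intro k D
    rw [conj_smul_eq_map, conj_smul_eq_map, Subgroup.map_map, Subgroup.map_map]
    congr 1
    ext y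
    simp
  have hP₁p : IsFinP p P₁ := IsFinP.map ⟨inferInstance, (S x.1).isPGroup'.to_subgroup Q⟩ _
  have h1 := normalizer_le_of_not_isEssential (S x.1).isPGroup' (hne _ Q g hg) (by
    refine ⟨le_top, hP₁p, fun A _ hA => ?_⟩
    obtain ⟨l, hl, hlA⟩ := hsyl.2.2 (A.map f) (hfr ▸ Subgroup.map_le_range f A) (hA.map f)
    rw [← hfr] at hl
    obtain ⟨k, rfl⟩ := hl
    refine ⟨k, Subgroup.mem_top _, ?_⟩
    rwa [← hconj, ← hQ, Subgroup.map_le_map_iff_of_injective hf] at hlA)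
  rintro n ⟨hn, hnx⟩
  rw [SetLike.mem_coe, ← hfr] at hnx
  obtain ⟨m, rfl⟩ := hnx
  have h2 : m ∈ Subgroup.normalizer (P₁ : Set (𝒢.vertexGroup x.1)) := by
    rw [mem_normalizer_iff_conj]
    apply Subgroup.map_injective hf
    rw [hconj, hQ]
    exact mem_normalizer_iff_conj.1 hn
  obtain ⟨a, ha, c, hc, rfl⟩ := exists_mul_of_mem_sup
    (le_normalizer_centralizer_of_le Subgroup.le_normalizer) (h1 h2)
  rw [map_mul]
  refine mul_mem (Subgroup.mem_sup_left (hQ ▸ Subgroup.mem_map_of_mem f ha))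
    (Subgroup.mem_sup_right ?_)
  rw [mem_centralizer_iff_conj] at hc ⊢
  intro y hy
  rw [← hQ] at hy
  obtain ⟨z, hz, rfl⟩ := hy
  rw [← map_mul, ← map_inv, ← map_mul, hc z hz]

end NonEssential

section ReachDefinition

variable {V : Type u₁} {T : SimpleGraph V} {𝒢 : TreeOfGroups.{u₁, u₂, u₃} T} {p : ℕ}
  {P : Subgroup 𝒢.Completion}

/-- A larger `p`-subgroup is found by walking towards the root along edges fixed by `P`. -/
inductive Reach (p : ℕ) (r : V) (P : Subgroup 𝒢.Completion) :
    𝒢.OrbitVertex → Subgroup 𝒢.Completion → Prop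
  | base {x A} (hA : IsFinP p A) (hPA : P < A) (hAx : A ≤ MulAction.stabilizer 𝒢.Completion x) :
      Reach p r P x A
  | up {i x y A} (hx : 𝒢.Incident i x) (hy : 𝒢.Incident i y)
      (hd : T.dist r x.1 = T.dist r y.1 + 1) (hPi : P ≤ MulAction.stabilizer 𝒢.Completion i)
      (h : Reach p r P y A) : Reach p r P x A

theorem Reach.isFinP_and_lt {r : V} {x : 𝒢.OrbitVertex} {A : Subgroup 𝒢.Completion}
    (h : Reach p r P x A) : IsFinP p A ∧ P < A := by
  induction h with
  | base hA hPA _ => exact ⟨hA, hPA⟩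
  | up _ _ _ _ _ ih => exact ih

theorem Reach.smul {r : V} {x : 𝒢.OrbitVertex} {A : Subgroup 𝒢.Completion}
    (h : Reach p r P x A) {c : 𝒢.Completion}
    (hc : c ∈ Subgroup.normalizer (P : Set 𝒢.Completion)) :
    Reach p r P (c • x) (MulAut.conj c • A) := by
  induction h with
  | base hA hPA hAx =>
    refine .base (hA.conj c) ?_ ?_
    · have := conj_smul_lt (g := c) hPA
      rwa [mem_normalizer_iff_conj.1 hc] at this
    · rw [stabilizer_smul_eq]
      exact conj_smul_mono hAx
  | up hx hy hd hPi _ ih =>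
    refine .up (hx.smul c) (hy.smul c) hd ?_ ih
    rw [stabilizer_smul_eq, ← mem_normalizer_iff_conj.1 hc]
    exact conj_smul_mono hPi

theorem Incident.adj {i : 𝒢.OrbitEdge} {x y : 𝒢.OrbitVertex} (hx : 𝒢.Incident i x)
    (hy : 𝒢.Incident i y) (h : x.1 ≠ y.1) : (i.1 : Sym2 V) = s(x.1, y.1) ∧ T.Adj x.1 y.1 := by
  have h1 : (i.1 : Sym2 V) = s(x.1, y.1) := (Sym2.mem_and_mem_iff h).1 ⟨hx.1, hy.1⟩
  refine ⟨h1, ?_⟩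
  have h2 := i.1.2
  rwa [h1] at h2

theorem Incident.exists_smul_eq {i j : 𝒢.OrbitEdge} {x : 𝒢.OrbitVertex} (hi : 𝒢.Incident i x)
    (hj : 𝒢.Incident j x) (h : i.1 = j.1) :
    ∃ g ∈ MulAction.stabilizer 𝒢.Completion x, g • i = j := by
  obtain ⟨e, a⟩ := i
  obtain ⟨e', b⟩ := j
  obtain rfl : e = e' := h
  obtain ⟨g, rfl⟩ := QuotientGroup.mk_surjective a
  obtain ⟨h, rfl⟩ := QuotientGroup.mk_surjective b
  have h1 : (h * g⁻¹) • (⟨e, g⟩ : 𝒢.OrbitEdge) = ⟨e, h⟩ := by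
    refine congrArg (Sigma.mk e) ?_
    change ((h * g⁻¹ * g : 𝒢.Completion) : 𝒢.Completion ⧸ (𝒢.edgeMap e).range) = h
    rw [inv_mul_cancel_right]
  refine ⟨h * g⁻¹, ?_, h1⟩
  have h2 := hi.smul (h * g⁻¹)
  rw [h1] at h2
  exact h2.eq_of_fst_eq hj rfl

end ReachDefinition

section Reach

variable {V : Type u₁} {T : SimpleGraph V} {𝒢 : TreeOfGroups.{u₁, u₂, u₃} T}
  [∀ v, Finite (𝒢.vertexGroup v)] {p : ℕ} [Fact p.Prime] {P : Subgroup 𝒢.Completion}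
  {S : ∀ v, Sylow p (𝒢.vertexGroup v)} {r : V}

/-- The link component found by walking towards the root does not depend on the walk; induction on
the distance from the root. -/
theorem Reach.reflTransGen_link (hindex : 𝒢.HasPrimeToIndex p r)
    (hne : 𝒢.IsNowhereEssential S P) (hP : IsFinP p P) :
    ∀ (n : ℕ) (x : 𝒢.OrbitVertex) (A B : Subgroup 𝒢.Completion), T.dist r x.1 = n →
      P ≤ MulAction.stabilizer 𝒢.Completion x → Reach p r P x A → Reach p r P x B →
      Relation.ReflTransGen (Link p P) A B := by
  intro n
  induction n with
  | zero =>
    intro x A B hd hPx hA hB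
    cases hA with
    | up _ _ hd' => omega
    | base hA hPA hAx =>
      cases hB with
      | up _ _ hd' => omega
      | base hB hPB hBx => exact reflTransGen_link_of_le_stabilizer hne hP hA hB hPA hPB hAx hBx
  | succ n ih =>
    intro x A B hd hPx hA hB
    -- A larger `p`-subgroup `A` at `x` is conjugate into the edge stabilizer, so `P` is not Sylow
    -- there either. A `p`-subgroup `D > P` fixing the edge is linked to `A` at `x` and to `B` from
    -- `y`.
    have key : ∀ {A B : Subgroup 𝒢.Completion} {i : 𝒢.OrbitEdge} {y : 𝒢.OrbitVertex},
        IsFinP p A → P < A → A ≤ MulAction.stabilizer 𝒢.Completion x → 𝒢.Incident i x →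
        𝒢.Incident i y → T.dist r x.1 = T.dist r y.1 + 1 →
        P ≤ MulAction.stabilizer 𝒢.Completion i → Reach p r P y B →
        Relation.ReflTransGen (Link p P) A B := by
      intro A B i y hA hPA hAx hx hy hd' hPi hB
      obtain ⟨l, hl, hlA⟩ := exists_conj_le_of_not_dvd_relIndex hA hAx (hindex i x y hx hy hd')
      obtain ⟨D, hDi, hD, hPD⟩ := exists_lt_of_not_isSyl hP hPi (not_isSyl_of_conj_le hA hPA hlA)
      exact (reflTransGen_link_of_le_stabilizer hne hP hA hD hPA hPD hAx
        (hDi.trans hx.stabilizer_le)).trans (ih y D B (by omega) (hPi.trans hy.stabilizer_le)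
          (.base hD hPD (hDi.trans hy.stabilizer_le)) hB)
    cases hA with
    | base hA hPA hAx =>
      cases hB with
      | base hB hPB hBx => exact reflTransGen_link_of_le_stabilizer hne hP hA hB hPA hPB hAx hBx
      | up hx hy hd' hPi hB => exact key hA hPA hAx hx hy hd' hPi hB
    | @up i _ y _ hx hy hd' hPi hA =>
      cases hB with
      | base hB hPB hBx => exact reflTransGen_link_symm (key hB hPB hBx hx hy hd' hPi hA)
      | @up i' _ y' _ hx' hy' hd'' hPi' hB =>
        -- If `P` is Sylow at `x`, the two edges towards the root are conjugate under the stabilizer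
        -- of `x`, and by Sylow's theorem in the edge stabilizer even under `N(P)`. The conjugator
        -- lies in `C(P) P`, and `P` fixes the edge, so an element of `C(P)` carries one edge to the
        -- other; this is a link. Otherwise a larger `p`-subgroup at `x` mediates.
        by_cases hsyl : IsSyl p (MulAction.stabilizer 𝒢.Completion x) P
        · obtain ⟨he, hadj⟩ := hx.adj hy (by intro h; rw [h] at hd'; omega)
          obtain ⟨he', hadj'⟩ := hx'.adj hy' (by intro h; rw [h] at hd''; omega)
          have hyy : y.1 = y'.1 :=
            𝒢.isTree.eq_of_dist_eq_dist_add_one hadj.symm hadj'.symm hd' hd''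
          obtain ⟨g, hg, hgi⟩ := hx.exists_smul_eq hx'
            (Subtype.ext (by rw [he, he', hyy]))
          have hsyl' : IsSyl p (MulAction.stabilizer 𝒢.Completion i) P := by
            obtain ⟨W, hW⟩ := exists_isSyl (p := p) (MulAction.stabilizer 𝒢.Completion i)
            refine hW.of_card_le hPi hP (hsyl.card_le (g := 1) hW.2.1 ?_)
            rw [map_one, one_smul]
            exact hW.1.trans hx.stabilizer_le
          obtain ⟨l, hl, hlP⟩ := hsyl'.2.2 (MulAut.conj g⁻¹ • P) (by
            rw [conj_inv_smul_le, ← stabilizer_smul_eq, hgi]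
            exact hPi') (hP.conj _)
          rw [← conj_mul_smul] at hlP
          have := hP.1
          have hm : l * g⁻¹ ∈ Subgroup.normalizer (P : Set 𝒢.Completion) :=
            mem_normalizer_iff_conj.2
              (Subgroup.eq_of_le_of_card_ge hlP (card_conj_smul _ _).ge)
          have hlx := hx.stabilizer_le hl
          have hn := normalizer_inf_stabilizer_le hne hsyl
            (Subgroup.mem_inf.2 ⟨inv_mem hm, inv_mem (mul_mem hlx (inv_mem hg))⟩)
          have hni : (l * g⁻¹)⁻¹ • i = i' := by
            have h1 : l⁻¹ • i = i := MulAction.mem_stabilizer_iff.1 (inv_mem hl)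
            rw [mul_inv_rev, inv_inv, mul_smul, h1, hgi]
          obtain ⟨c, hc, a, ha, hca⟩ := exists_mul_of_mem_sup'
            (le_normalizer_centralizer_of_le Subgroup.le_normalizer) hn
          have hai : a • i = i := hPi ha
          rw [← hca, mul_smul, hai] at hni
          have hyc : c • y = y' := by
            have h1 := hy.smul c
            rw [hni] at h1
            exact h1.eq_of_fst_eq hy' hyy
          have h2 := hA.smul (centralizer_le_normalizer P hc)
          rw [hyc] at h2
          exact .head (Link.of_conj hA.isFinP_and_lt.1 hA.isFinP_and_lt.2 hc)
            (ih y' _ _ (by omega) (hPi'.trans hy'.stabilizer_le) h2 hB)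
        · obtain ⟨D, hDx, hD, hPD⟩ := exists_lt_of_not_isSyl hP hPx hsyl
          exact (reflTransGen_link_symm (key hD hPD hDx hx hy hd' hPi hA)).trans
            (key hD hPD hDx hx' hy' hd'' hPi' hB)

/-- The index hypothesis provides at each vertex an edge towards the root that is fixed by `P`. At
the root `P` is not Sylow, because the larger group `E` is conjugate into the stabilizer. -/
theorem exists_reach (hindex : 𝒢.HasPrimeToIndex p r) (S : Sylow p (𝒢.vertexGroup r))
    (hP : IsFinP p P) {E : Subgroup 𝒢.Completion} (hE : IsFinP p E) (hPE : P < E) :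
    ∀ (n : ℕ) (x : 𝒢.OrbitVertex), T.dist r x.1 = n →
      P ≤ MulAction.stabilizer 𝒢.Completion x → ∃ A, Reach p r P x A := by
  intro n
  induction n with
  | zero =>
    rintro ⟨v, q⟩ hd hPx
    obtain ⟨h, rfl⟩ := QuotientGroup.mk_surjective q
    obtain rfl : r = v := 𝒢.isTree.1.dist_eq_zero_iff.1 hd
    obtain ⟨g, hg⟩ := exists_conj_le_sylow hindex S hE
    obtain ⟨A, hAx, hA, hPA⟩ := exists_lt_of_not_isSyl hP hPx
      (not_isSyl_of_conj_le (g := h * g) hE hPE (by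
        rw [conj_mul_smul, stabilizer_vertex]
        exact conj_smul_mono (hg.trans (Subgroup.map_le_range _ _))))
    exact ⟨A, .base hA hPA hAx⟩
  | succ n ih =>
    intro x hd hPx
    obtain ⟨i, y, hx, hy, hxy⟩ := exists_incident_closer r x (by
      intro h
      rw [h, SimpleGraph.dist_self] at hd
      omega)
    obtain ⟨l, hl, hlP⟩ := exists_conj_le_of_not_dvd_relIndex hP hPx (hindex i x y hx hy hxy)
    have hPi : P ≤ MulAction.stabilizer 𝒢.Completion (l⁻¹ • i) := by
      rw [stabilizer_smul_eq, ← conj_smul_le_iff]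
      exact hlP
    have hlx : l⁻¹ • x = x := MulAction.mem_stabilizer_iff.1 (inv_mem hl)
    have hx' := hx.smul l⁻¹
    rw [hlx] at hx'
    obtain ⟨A, hA⟩ := ih (l⁻¹ • y) (show T.dist r y.1 = n by omega)
      (hPi.trans (hy.smul l⁻¹).stabilizer_le)
    exact ⟨A, .up hx' (hy.smul l⁻¹) hxy hPi hA⟩

theorem isLinkConnected_of_isNowhereEssential (hindex : 𝒢.HasPrimeToIndex p r)
    (hne : 𝒢.IsNowhereEssential S P) (hP : IsFinP p P) : IsLinkConnected p P := by
  intro A B hA hB hPA hPB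
  have hAfin := hA.1
  have hBfin := hB.1
  obtain ⟨x, hx⟩ := exists_le_stabilizer A
  obtain ⟨y, hy⟩ := exists_le_stabilizer B
  have hlink : ∀ {x : 𝒢.OrbitVertex} {D E : Subgroup 𝒢.Completion},
      P ≤ MulAction.stabilizer 𝒢.Completion x → Reach p r P x D → Reach p r P x E →
      Relation.ReflTransGen (Link p P) D E := fun hPx hD hE =>
    Reach.reflTransGen_link hindex hne hP _ _ _ _ rfl hPx hD hE
  -- `Φ` is carried along the `P`-fixed path from a vertex fixed by `A` to one fixed by `B`. Towards
  -- the root it restricts; away from the root, some group is reached from both ends, and reached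
  -- groups are linked.
  set Φ : 𝒢.OrbitVertex → Prop := fun x => ∀ D, Reach p r P x D →
    Relation.ReflTransGen (Link p P) A D with hΦ
  have hedge : ∀ {i : 𝒢.OrbitEdge} {x y : 𝒢.OrbitVertex}, 𝒢.Incident i x → 𝒢.Incident i y →
      P ≤ MulAction.stabilizer 𝒢.Completion i → Φ x → Φ y := by
    intro i x y hx hy hPi hΦx D hD
    by_cases hxy : x.1 = y.1
    · exact hΦx D (hx.eq_of_fst_eq hy hxy ▸ hD)
    rcases 𝒢.isTree.dist_eq_dist_add_one_of_adj r (hx.adj hy hxy).2 with h | h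
    · exact hΦx D (.up hx hy h hPi hD)
    · obtain ⟨E, hE⟩ := exists_reach hindex (S r) hP hA hPA _ x rfl (hPi.trans hx.stabilizer_le)
      exact (hΦx E hE).trans
        (hlink (hPi.trans hy.stabilizer_le) (.up hy hx h hPi hE) hD)
  have hfix : ∀ z : 𝒢.OrbitVertex, P ≤ MulAction.stabilizer 𝒢.Completion z →
      ∀ g : P, smulHom (g : 𝒢.Completion) (Sum.inl z) = Sum.inl z := fun z hz g =>
    congrArg Sum.inl (hz g.2)
  have hΦy : Φ y := (incidenceGraph_isTree (𝒢 := 𝒢)).fixed_induction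
    (fun g : P => smulHom (g : 𝒢.Completion))
    (fun z => match z with
      | .inl x => Φ x
      | .inr i => ∀ x, 𝒢.Incident i x → Φ x) (by
      intro u w huw hu hw hQ
      rcases incidenceGraph_adj_iff.1 huw with ⟨x, i, rfl, rfl, hi⟩ | ⟨x, i, rfl, rfl, hi⟩
      · exact fun y hy => hedge hi hy (fun g hg => Sum.inr_injective (hw ⟨g, hg⟩)) hQ
      · exact hQ x hi)
    (x := .inl x) (y := .inl y) (hfix x (hPA.le.trans hx)) (hfix y (hPB.le.trans hy))
    (fun g => MulAction.injective (g : 𝒢.Completion))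
    (fun D hD => hlink (hPA.le.trans hx) (.base hA hPA hx) hD)
  exact hΦy B (.base hB hPB hy)

end Reach

end TreeOfGroups

/-! ### Fusion notions expressed in the ambient group. -/

section FusionTranslation

variable {G : Type*} [Group G] {S : Subgroup G}

theorem mem_map_subtype_iff {P : Subgroup S} {x : S} : (x : G) ∈ P.map S.subtype ↔ x ∈ P := by
  constructor
  · rintro ⟨y, hy, hyx⟩
    rwa [← S.subtype_injective hyx]
  · exact fun h => ⟨x, h, rfl⟩

theorem map_subtype_normalizer (P : Subgroup S) :
    (Subgroup.normalizer (P : Set S)).map S.subtype =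
      S ⊓ Subgroup.normalizer ((P.map S.subtype : Subgroup G) : Set G) := by
  have key : ∀ x : S, x ∈ Subgroup.normalizer (P : Set S) ↔
      (x : G) ∈ Subgroup.normalizer ((P.map S.subtype : Subgroup G) : Set G) := by
    intro x
    rw [Subgroup.mem_normalizer_iff, Subgroup.mem_normalizer_iff]
    constructor
    · intro h y
      constructor
      · rintro ⟨z, hz, rfl⟩
        exact mem_map_subtype_iff.2 ((h z).1 hz)
      · rintro ⟨z, hz, hzy⟩
        have h1 : y = ((x⁻¹ * z * x : S) : G) := by
          have hzy' : (z : G) = x * y * (x : G)⁻¹ := hzy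
          push_cast
          rw [hzy']
          group
        rw [h1]
        refine mem_map_subtype_iff.2 ((h _).2 ?_)
        simpa [mul_assoc] using hz
    · intro h y
      rw [← mem_map_subtype_iff, h y, ← mem_map_subtype_iff (x := x * y * x⁻¹)]
      rfl
  ext x
  constructor
  · rintro ⟨y, hy, rfl⟩
    exact ⟨y.2, (key y).1 hy⟩
  · rintro ⟨hx, hx'⟩
    exact ⟨⟨x, hx⟩, (key ⟨x, hx⟩).2 hx', rfl⟩

theorem map_subtype_centralizer (P : Subgroup S) :
    (Subgroup.centralizer (P : Set S)).map S.subtype =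
      S ⊓ Subgroup.centralizer ((P.map S.subtype : Subgroup G) : Set G) := by
  ext x
  constructor
  · rintro ⟨y, hy, rfl⟩
    refine ⟨y.2, Subgroup.mem_centralizer_iff.2 ?_⟩
    rintro _ ⟨z, hz, rfl⟩
    exact congrArg Subtype.val (Subgroup.mem_centralizer_iff.1 hy z hz)
  · rintro ⟨hx, hx'⟩
    refine ⟨⟨x, hx⟩, Subgroup.mem_centralizer_iff.2 fun z hz => Subtype.ext ?_, rfl⟩
    exact Subgroup.mem_centralizer_iff.1 hx' z ⟨z, hz, rfl⟩

theorem card_map_subtype (P : Subgroup S) : Nat.card (P.map S.subtype) = Nat.card P :=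
  (Nat.card_congr (P.equivMapOfInjective S.subtype S.subtype_injective).toEquiv).symm

theorem groupFusion_conj_iff {P R : Subgroup S} :
    (groupFusion G S).Conj P R ↔ ∃ g : G, MulAut.conj g • P.map S.subtype = R.map S.subtype := by
  constructor
  · rintro ⟨φ, ⟨g, hg⟩, -⟩
    have hg' : ∀ x : P, (((φ x : R) : S) : G) = g⁻¹ * ((x : S) : G) * g := hg
    refine ⟨g⁻¹, ?_⟩
    ext y
    rw [mem_conj_smul, inv_inv]
    constructor
    · rintro ⟨x, hx, hxy⟩
      refine ⟨φ ⟨x, hx⟩, (φ ⟨x, hx⟩).2, ?_⟩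
      change (((φ ⟨x, hx⟩ : R) : S) : G) = y
      rw [hg']
      change (x : G) = g * y * g⁻¹ at hxy
      rw [hxy]
      group
    · rintro ⟨r, hr, rfl⟩
      refine ⟨φ.symm ⟨r, hr⟩, (φ.symm ⟨r, hr⟩).2, ?_⟩
      have h1 := hg' (φ.symm ⟨r, hr⟩)
      rw [φ.apply_symm_apply] at h1
      change ((φ.symm ⟨r, hr⟩ : S) : G) = g * (r : G) * g⁻¹
      change (r : G) = _ at h1
      rw [h1]
      group
  · rintro ⟨g, hg⟩
    let e := P.equivMapOfInjective S.subtype S.subtype_injective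
    let e' := R.equivMapOfInjective S.subtype S.subtype_injective
    let c := Subgroup.equivSMul (MulAut.conj g) (P.map S.subtype)
    let φ : P ≃* R := (e.trans (c.trans (MulEquiv.subgroupCongr hg))).trans e'.symm
    have hφ : ∀ x : P, (((φ x : R) : S) : G) = g * ((x : S) : G) * g⁻¹ := by
      intro x
      change ((e' (e'.symm (MulEquiv.subgroupCongr hg (c (e x)))) : R.map S.subtype) : G) = _
      rw [e'.apply_symm_apply]
      rfl
    refine ⟨φ, ⟨g⁻¹, fun x => ?_⟩, ⟨g, fun x => ?_⟩⟩
    · rw [inv_inv]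
      exact hφ x
    · have h1 := hφ (φ.symm x)
      rw [φ.apply_symm_apply] at h1
      rw [h1]
      change ((φ.symm x : S) : G) = _
      group

theorem forall_groupFusion_conj_iff {P : Subgroup S} {Φ : Subgroup G → Prop} :
    (∀ R : Subgroup S, (groupFusion G S).Conj P R → Φ (R.map S.subtype)) ↔
      ∀ g : G, MulAut.conj g • P.map S.subtype ≤ S → Φ (MulAut.conj g • P.map S.subtype) := by
  constructor
  · intro h g hg
    have h1 := Subgroup.map_subgroupOf_eq_of_le hg
    rw [← h1]
    exact h _ (groupFusion_conj_iff.2 ⟨g, h1.symm⟩)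
  · intro h R hR
    obtain ⟨g, hg⟩ := groupFusion_conj_iff.1 hR
    rw [← hg]
    exact h g (hg ▸ Subgroup.map_subtype_le R)

theorem isCentric_iff {P : Subgroup S} :
    (groupFusion G S).IsCentric P ↔ ∀ g : G, MulAut.conj g • P.map S.subtype ≤ S →
      S ⊓ Subgroup.centralizer ((MulAut.conj g • P.map S.subtype : Subgroup G) : Set G) ≤
        MulAut.conj g • P.map S.subtype := by
  rw [← forall_groupFusion_conj_iff
    (Φ := fun R : Subgroup G => S ⊓ Subgroup.centralizer (R : Set G) ≤ R)]
  refine forall₂_congr fun R _ => ?_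
  rw [← map_subtype_centralizer, Subgroup.map_le_map_iff_of_injective S.subtype_injective]

theorem fullyCentralised_iff {P : Subgroup S} :
    (groupFusion G S).FullyCentralised P ↔ ∀ g : G, MulAut.conj g • P.map S.subtype ≤ S →
      Nat.card (S ⊓ Subgroup.centralizer
        ((MulAut.conj g • P.map S.subtype : Subgroup G) : Set G) : Subgroup G) ≤
      Nat.card (S ⊓ Subgroup.centralizer ((P.map S.subtype : Subgroup G) : Set G) :
        Subgroup G) := by
  refine Iff.trans ?_ (forall_groupFusion_conj_iff (P := P) (Φ := fun R : Subgroup G =>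
    Nat.card (S ⊓ Subgroup.centralizer (R : Set G) : Subgroup G) ≤
      Nat.card (S ⊓ Subgroup.centralizer ((P.map S.subtype : Subgroup G) : Set G) : Subgroup G)))
  refine forall₂_congr fun R _ => ?_
  rw [← map_subtype_centralizer, ← map_subtype_centralizer, card_map_subtype, card_map_subtype]

theorem fullyNormalised_iff {P : Subgroup S} :
    (groupFusion G S).FullyNormalised P ↔ ∀ g : G, MulAut.conj g • P.map S.subtype ≤ S →
      Nat.card (S ⊓ Subgroup.normalizer
        ((MulAut.conj g • P.map S.subtype : Subgroup G) : Set G) : Subgroup G) ≤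
      Nat.card (S ⊓ Subgroup.normalizer ((P.map S.subtype : Subgroup G) : Set G) :
        Subgroup G) := by
  refine Iff.trans ?_ (forall_groupFusion_conj_iff (P := P) (Φ := fun R : Subgroup G =>
    Nat.card (S ⊓ Subgroup.normalizer (R : Set G) : Subgroup G) ≤
      Nat.card (S ⊓ Subgroup.normalizer ((P.map S.subtype : Subgroup G) : Set G) : Subgroup G)))
  refine forall₂_congr fun R _ => ?_
  rw [← map_subtype_normalizer, ← map_subtype_normalizer, card_map_subtype, card_map_subtype]

end FusionTranslation

/-! ### Saturation from well-placedness, and the main theorem. -/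

section Saturation

variable {G : Type*} [Group G] {p : ℕ} {S : Subgroup G}

theorem IsSyl.smul {L B : Subgroup G} (h : IsSyl p L B) (g : G) :
    IsSyl p (MulAut.conj g • L) (MulAut.conj g • B) := by
  refine ⟨conj_smul_mono h.1, h.2.1.conj g, fun A hAL hA => ?_⟩
  rw [← conj_inv_smul_le] at hAL
  obtain ⟨l, hl, hlA⟩ := h.2.2 _ hAL (hA.conj _)
  refine ⟨g * l * g⁻¹, mem_conj_smul.2 (by simpa [mul_assoc] using hl), ?_⟩
  rw [conj_mul_smul, conj_mul_smul]
  exact conj_smul_mono hlA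

theorem IsGood.conj {U : Subgroup G} (h : IsGood p U) (g : G) : IsGood p (MulAut.conj g • U) := by
  intro L hCL hLN
  rw [← conj_smul_centralizer] at hCL ⊢
  rw [← conj_smul_normalizer, ← conj_inv_smul_le] at hLN
  rw [conj_smul_le_iff] at hCL
  obtain ⟨B, hB, hBi⟩ := h _ hCL hLN
  have hL : MulAut.conj g • MulAut.conj g⁻¹ • L = L := by
    rw [← conj_mul_smul, mul_inv_cancel, conj_one_smul]
  refine ⟨MulAut.conj g • B, ?_, ?_⟩
  · have h1 := hB.smul g
    rwa [hL] at h1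
  · rw [← Subgroup.smul_sup]
    conv => rw [← hL]
    rwa [Subgroup.relIndex_pointwise_smul]

/-- Moving a Sylow subgroup of `N(P)` into `S` and comparing orders shows that `N_S(P)` is itself
Sylow in `N(P)`. The index condition makes `Aut_S(P)` Sylow, and conjugating centralizers back into
`C(P)` bounds their orders. -/
theorem fullyCentralised_and_fullyAutomised [Fact p.Prime] (hSp : IsFinP p S)
    (hS : ∀ A : Subgroup G, IsFinP p A → ∃ g : G, MulAut.conj g • A ≤ S)
    (hgood : ∀ R : Subgroup G, IsFinP p R → IsGood p R) {P : Subgroup S}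
    (hP : (groupFusion G S).FullyNormalised P) :
    (groupFusion G S).FullyCentralised P ∧ (groupFusion G S).FullyAutomised p P := by
  have := hSp.1
  set P' := P.map S.subtype with hP'
  have hP'S : P' ≤ S := Subgroup.map_subtype_le P
  have hPp : IsFinP p P' := hSp.mono hP'S
  set N := Subgroup.normalizer (P' : Set G) with hN
  set C := Subgroup.centralizer (P' : Set G) with hC
  have hCN : C ≤ N := centralizer_le_normalizer P'
  obtain ⟨B, hB, hBi⟩ := hgood P' hPp N hCN le_rfl
  have hPB : P' ≤ B := hB.le_of_le_normalizer hPp Subgroup.le_normalizer le_rfl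
  have hDp : IsFinP p (S ⊓ N) := hSp.mono inf_le_left
  have hcard : Nat.card B ≤ Nat.card (S ⊓ N : Subgroup G) := by
    obtain ⟨h, hh⟩ := hS B hB.2.1
    refine le_trans ?_ (fullyNormalised_iff.1 hP h ((conj_smul_mono hPB).trans hh))
    have : Finite (S ⊓ Subgroup.normalizer ((MulAut.conj h • P' : Subgroup G) : Set G) :
      Subgroup G) := (hSp.mono inf_le_left).1
    rw [← card_conj_smul h]
    refine Subgroup.card_le_of_le (le_inf hh ?_)
    rw [← conj_smul_normalizer]
    exact conj_smul_mono hB.1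
  have hD : IsSyl p N (S ⊓ N) := hB.of_card_le inf_le_right hDp hcard
  have hDi : ¬ p ∣ ((S ⊓ N) ⊔ C).relIndex N := by
    obtain ⟨n, hn, hnD⟩ := hB.2.2 _ hD.1 hD.2.1
    have := hB.2.1.1
    have h1 : MulAut.conj n • (S ⊓ N) = B :=
      Subgroup.eq_of_le_of_card_ge hnD (by rwa [card_conj_smul])
    rwa [← Subgroup.relIndex_pointwise_smul (MulAut.conj n), Subgroup.smul_sup, h1,
      conj_smul_centralizer_eq_of_mem_normalizer hn, conj_smul_eq_of_mem hn]
  refine ⟨fullyCentralised_iff.2 fun g hg => ?_, ?_⟩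
  · set D := S ⊓ Subgroup.centralizer ((MulAut.conj g • P' : Subgroup G) : Set G)
    have h1 : MulAut.conj g⁻¹ • D ≤ C := by
      rw [conj_inv_smul_le, hC, conj_smul_centralizer]
      exact inf_le_right
    obtain ⟨n, hn, hnD⟩ := hD.2.2 _ (h1.trans hCN) ((hSp.mono inf_le_left : IsFinP p D).conj _)
    rw [← card_conj_smul g⁻¹, ← card_conj_smul n]
    have : Finite (S ⊓ C : Subgroup G) := (hSp.mono inf_le_left).1
    refine Subgroup.card_le_of_le (le_inf (hnD.trans inf_le_left) ?_)
    rw [← conj_smul_centralizer_eq_of_mem_normalizer hn]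
    exact conj_smul_mono h1
  · obtain ⟨f, hf, hfn⟩ := exists_normalizer_hom_aut S P
    have hH : (FusionSystem.autS P).subgroupOf ((groupFusion G S).aut P) =
        ((S ⊓ N).subgroupOf N).map f := by
      ext α
      constructor
      · rintro ⟨s, hs⟩
        obtain ⟨n, rfl⟩ := hf α
        have hs' : ∀ x : P, (n : G) * ((x : S) : G) * (n : G)⁻¹ =
            (s : G)⁻¹ * ((x : S) : G) * s := fun x => by
          rw [← hfn]; exact congrArg Subtype.val (hs x)
        have h1 : (n : G)⁻¹ * (s : G)⁻¹ ∈ C := by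
          rw [mem_centralizer_iff_conj]
          rintro _ ⟨x, hx, rfl⟩
          have h2 := hs' ⟨x, hx⟩
          change (n : G)⁻¹ * (s : G)⁻¹ * x * ((n : G)⁻¹ * (s : G)⁻¹)⁻¹ = x
          calc (n : G)⁻¹ * (s : G)⁻¹ * x * ((n : G)⁻¹ * (s : G)⁻¹)⁻¹
              = (n : G)⁻¹ * ((s : G)⁻¹ * x * s) * n := by group
            _ = x := by rw [← h2]; group
        have h2 : (s : G)⁻¹ ∈ N := (Subgroup.mul_mem_cancel_left _ (inv_mem n.2)).1 (hCN h1)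
        have h3 : (s : G)⁻¹ ∈ S := inv_mem s.2
        refine ⟨⟨_, h2⟩, ⟨h3, h2⟩, Subtype.ext (MulEquiv.ext fun x => Subtype.ext
          (Subtype.ext ?_))⟩
        rw [hfn, hfn, hs', inv_inv]
      · rintro ⟨n, hn, rfl⟩
        refine ⟨⟨(n : G)⁻¹, inv_mem hn.1⟩, fun x => Subtype.ext ?_⟩
        change (((((f n : (groupFusion G S).aut P) : MulAut P) x : P) : S) : G) =
          ((n : G)⁻¹)⁻¹ * ((x : S) : G) * (n : G)⁻¹
        rw [hfn, inv_inv]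
    have hp : IsPGroup p ((FusionSystem.autS P).subgroupOf ((groupFusion G S).aut P)) := by
      rw [hH]
      exact (hDp.2.comap_subtype (K := N)).map f
    have hi : ¬ p ∣ ((FusionSystem.autS P).subgroupOf ((groupFusion G S).aut P)).index := by
      intro h
      refine hDi (h.trans ?_)
      rw [← Subgroup.index_comap_of_surjective _ hf, Subgroup.relIndex]
      refine Subgroup.index_dvd_of_le ?_
      rw [hH, Subgroup.subgroupOf_sup inf_le_right hCN]
      refine sup_le (Subgroup.le_comap_map _ _) fun c hc => ?_
      have hc1 : f c = 1 := by
        refine Subtype.ext (MulEquiv.ext fun x => Subtype.ext (Subtype.ext ?_))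
        rw [hfn]
        exact mem_centralizer_iff_conj.1 hc x ⟨x, x.2, rfl⟩
      rw [Subgroup.mem_comap, hc1]
      exact one_mem _
    exact ⟨hp.toSylow hi, rfl⟩

/-- The idea is to correct the conjugator `g` of `φ` by an element of the centralizer of the image
`R`, so that it carries all of `N_φ` into `S` without changing `φ` on `P`. -/
theorem exists_extension (hSp : IsFinP p S)
    (hS : ∀ A : Subgroup G, IsFinP p A → ∃ g : G, MulAut.conj g • A ≤ S)
    (hgood : ∀ R : Subgroup G, IsFinP p R → IsGood p R) {P : Subgroup S}
    {φ : P →* (⊤ : Subgroup S)} (hφ : φ ∈ (groupFusion G S).Hom P ⊤)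
    (hR : (groupFusion G S).FullyCentralised (imageIn φ)) :
    ∃ ψ ∈ (groupFusion G S).Hom (FusionSystem.extender φ) ⊤,
      ψ.comp (Subgroup.inclusion (FusionSystem.le_extender φ)) = φ := by
  have := hSp.1
  obtain ⟨g, hg⟩ := hφ
  set R := (imageIn φ).map S.subtype with hR'
  have hRS : R ≤ S := Subgroup.map_subtype_le _
  have hRp : IsFinP p R := hSp.mono hRS
  have hmemR : ∀ x : P, g⁻¹ * ((x : S) : G) * g ∈ R := fun x => by
    rw [← hg]
    exact ⟨φ x, ⟨x, rfl⟩, rfl⟩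
  set C := Subgroup.centralizer (R : Set G) with hC
  set D := S ⊓ Subgroup.normalizer (R : Set G) with hD
  have hDp : IsFinP p D := hSp.mono inf_le_left
  have hDC : D ≤ Subgroup.normalizer (C : Set G) := le_normalizer_centralizer_of_le inf_le_right
  have hRD : R ≤ D := le_inf hRS Subgroup.le_normalizer
  have hCN : C ≤ Subgroup.normalizer (R : Set G) := centralizer_le_normalizer R
  obtain ⟨B₀, hB₀, -⟩ := hgood R hRp (D ⊔ C) le_sup_right (sup_le inf_le_right hCN)
  obtain ⟨l, -, hDB, hB⟩ := hB₀.exists_ge le_sup_left hDp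
  set B := MulAut.conj l • B₀
  -- Full centralisation is used here: moving `B` into `S` shows that `B ⊓ C` is no larger than `S ⊓
  -- C`. Consequently `B = D`, that is, `N_S(R)` is Sylow in `N_S(R) C(R)`.
  have hBC : S ⊓ C = B ⊓ C := by
    have hBCp : IsFinP p (B ⊓ C) := hB.2.1.mono inf_le_left
    have := hBCp.1
    refine Subgroup.eq_of_le_of_card_ge (le_inf (le_trans (inf_le_inf_left S hCN) hDB)
      inf_le_right) ?_
    obtain ⟨h, hh⟩ := hS B hB.2.1
    refine le_trans ?_ (fullyCentralised_iff.1 hR h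
      ((conj_smul_mono (hRD.trans hDB)).trans hh))
    have : Finite (S ⊓ Subgroup.centralizer ((MulAut.conj h • R : Subgroup G) : Set G) :
      Subgroup G) := (hSp.mono inf_le_left).1
    rw [← card_conj_smul h]
    refine Subgroup.card_le_of_le (le_inf ((conj_smul_mono inf_le_left).trans hh) ?_)
    rw [← conj_smul_centralizer]
    exact conj_smul_mono inf_le_right
  have hBD : B ≤ D := by
    intro b hb
    obtain ⟨d, hd, c, hc, rfl⟩ := exists_mul_of_mem_sup hDC (hB.1 hb)
    have h1 : c ∈ S ⊓ C := by
      rw [hBC]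
      exact ⟨(Subgroup.mul_mem_cancel_left _ (hDB hd)).1 hb, hc⟩
    exact mul_mem hd ⟨h1.1, hCN hc⟩
  set E := (FusionSystem.extender φ).map S.subtype with hE
  have hEp : IsFinP p E := hSp.mono (Subgroup.map_subtype_le _)
  -- By the definition of `N_φ`, a conjugated element acts on `R` as some `h` in `N_S(R)`, so it
  -- differs from `h` by an element of `C`.
  have hEL : MulAut.conj g⁻¹ • E ≤ D ⊔ C := by
    intro w hw
    rw [mem_conj_smul, inv_inv] at hw
    obtain ⟨e, ⟨heN, h, hh, heh⟩, hew⟩ := hw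
    have hew' : (e : G) = g * w * g⁻¹ := hew
    have hhD : (h : G) ∈ D := by
      rw [hD, hR', ← map_subtype_normalizer]
      exact ⟨h, hh, rfl⟩
    have h1 : h * w⁻¹ ∈ C := by
      rw [mem_centralizer_iff_conj]
      rintro _ ⟨_, ⟨x, rfl⟩, rfl⟩
      have hy : e⁻¹ * (x : S) * e ∈ P := (Subgroup.mem_normalizer_iff''.1 heN _).1 x.2
      have h2 := congrArg (Subtype.val : S → G) (heh x ⟨_, hy⟩ rfl)
      change ((φ ⟨_, hy⟩ : S) : G) = (h : G)⁻¹ * ((φ x : S) : G) * h at h2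
      rw [hg] at h2
      change g⁻¹ * ((e : G)⁻¹ * ((x : S) : G) * e) * g = _ at h2
      change (h : G) * w⁻¹ * ((φ x : S) : G) * (h * w⁻¹)⁻¹ = ((φ x : S) : G)
      have h3 : w⁻¹ * ((φ x : S) : G) * w = (h : G)⁻¹ * ((φ x : S) : G) * h := by
        rw [← h2, hew', hg]
        group
      calc (h : G) * w⁻¹ * ((φ x : S) : G) * (h * w⁻¹)⁻¹
          = h * (w⁻¹ * ((φ x : S) : G) * w) * (h : G)⁻¹ := by group
        _ = _ := by rw [h3]; group
    have h2 : (h : G) ∈ D ⊔ C := Subgroup.mem_sup_left hhD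
    exact inv_mem_iff.1 ((Subgroup.mul_mem_cancel_left _ h2).1 (Subgroup.mem_sup_right h1))
  obtain ⟨l, hl, hlE⟩ := hB.2.2 _ hEL (hEp.conj _)
  obtain ⟨d, hd, c, hc, rfl⟩ := exists_mul_of_mem_sup hDC hl
  have hcE : MulAut.conj c • MulAut.conj g⁻¹ • E ≤ S := by
    have h1 := hlE.trans hBD
    rw [conj_mul_smul, conj_smul_le_iff, conj_smul_eq_of_mem (inv_mem hd)] at h1
    exact h1.trans inf_le_left
  have hmem : ∀ e : FusionSystem.extender φ, (g * c⁻¹)⁻¹ * ((e : S) : G) * (g * c⁻¹) ∈ S := by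
    intro e
    refine hcE ?_
    rw [← conj_mul_smul, mem_conj_smul]
    exact ⟨e, e.2, by simp [mul_assoc]⟩
  let ψ : FusionSystem.extender φ →* (⊤ : Subgroup S) :=
    { toFun := fun e => ⟨⟨_, hmem e⟩, Subgroup.mem_top _⟩
      map_one' := by
        apply Subtype.ext
        apply Subtype.ext
        simp
      map_mul' := fun a b => by
        apply Subtype.ext
        apply Subtype.ext
        simp [mul_assoc] }
  refine ⟨ψ, ⟨g * c⁻¹, fun e => rfl⟩, MonoidHom.ext fun x => Subtype.ext (Subtype.ext ?_)⟩
  change (g * c⁻¹)⁻¹ * ((x : S) : G) * (g * c⁻¹) = ((φ x : S) : G)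
  have h1 := mem_centralizer_iff_conj.1 hc _ (hmemR x)
  rw [hg]
  conv_rhs => rw [← h1]
  group

theorem isSaturated_of_forall_isGood [Fact p.Prime] (hSp : IsFinP p S)
    (hS : ∀ A : Subgroup G, IsFinP p A → ∃ g : G, MulAut.conj g • A ≤ S)
    (hgood : ∀ R : Subgroup G, IsFinP p R → IsGood p R) : (groupFusion G S).IsSaturated p :=
  ⟨fun _ hP => fullyCentralised_and_fullyAutomised hSp hS hgood hP,
    fun _ _ hφ hR => exists_extension hSp hS hgood hφ hR⟩

/-- Frees centricity from `S` and from the choice of conjugate, as every finite `p`-subgroup of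
`C(P)` can be moved into `S` together with `P`. -/
theorem isCentric_iff_forall_le (hSp : IsFinP p S)
    (hS : ∀ A : Subgroup G, IsFinP p A → ∃ g : G, MulAut.conj g • A ≤ S) {P : Subgroup S} :
    (groupFusion G S).IsCentric P ↔ ∀ E : Subgroup G, IsFinP p E →
      E ≤ Subgroup.centralizer ((P.map S.subtype : Subgroup G) : Set G) → E ≤ P.map S.subtype := by
  rw [isCentric_iff]
  constructor
  · intro h E hE hEC
    have hPp : IsFinP p (P.map S.subtype) := hSp.mono (Subgroup.map_subtype_le P)
    obtain ⟨g, hg⟩ := hS _ (hE.sup hPp (hEC.trans (centralizer_le_normalizer _)))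
    have h1 := h g ((conj_smul_mono le_sup_right).trans hg)
    rw [← conj_smul_centralizer] at h1
    exact Subgroup.pointwise_smul_le_pointwise_smul_iff.1
      ((le_inf ((conj_smul_mono le_sup_left).trans hg) (conj_smul_mono hEC)).trans h1)
  · intro h g _
    rw [← conj_inv_smul_le]
    refine h _ ((hSp.mono inf_le_left).conj _) ?_
    rw [conj_inv_smul_le, conj_smul_centralizer]
    exact inf_le_right

end Saturation

theorem mainTheorem4 (p : ℕ) [Fact p.Prime] {V : Type u₁} {T : SimpleGraph V}
    (𝒢 : TreeOfGroups.{u₁, u₂, u₃} T) [∀ v, Finite (𝒢.vertexGroup v)]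
    (S : ∀ v, Sylow p (𝒢.vertexGroup v)) (vstar : V)
    -- for an edge `vw` that is the first edge of the path from `v` to `vstar`
    (hindex : ∀ (v w : V) (h : T.Adj v w) (q : T.Walk w vstar), (SimpleGraph.Walk.cons h q).IsPath →
      ¬ p ∣ (𝒢.hom ⟨s(v, w), h⟩ v (Sym2.mem_mk_left v w)).range.index)
    (S₀ : Subgroup 𝒢.Completion)
    (hS₀ : S₀ = (S vstar : Subgroup (𝒢.vertexGroup vstar)).map (𝒢.vertexMap vstar))
    (ha : ∀ P : Subgroup S₀,
      (∃ (v : V) (Q : Subgroup (S v : Subgroup (𝒢.vertexGroup v))) (g : 𝒢.Completion),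
        (groupFusion (𝒢.vertexGroup v) (S v)).IsEssential p Q ∧
        P.map S₀.subtype =
          ((Q.map (S v : Subgroup (𝒢.vertexGroup v)).subtype).map (𝒢.vertexMap v)).map
            (MulAut.conj g).toMonoidHom) →
      (groupFusion 𝒢.Completion S₀).IsCentric P)
    (hb : ∀ P : Subgroup S₀, (groupFusion 𝒢.Completion S₀).IsCentric P →
      (𝒢.centralizerQuotient (P.map S₀.subtype)).IsMultiTree) :
    (groupFusion 𝒢.Completion S₀).IsSaturated p := by
  have hidx := TreeOfGroups.hasPrimeToIndex_of_index hindex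
  have hSp : IsFinP p S₀ := by
    rw [hS₀]
    exact IsFinP.map ⟨inferInstance, (S vstar).isPGroup'⟩ _
  have hS : ∀ A : Subgroup 𝒢.Completion, IsFinP p A → ∃ g : 𝒢.Completion, MulAut.conj g • A ≤ S₀ := by
    intro A hA
    rw [hS₀]
    exact TreeOfGroups.exists_conj_le_sylow hidx (S vstar) hA
  have := hSp.1
  have hcard : ∀ A : Subgroup 𝒢.Completion, IsFinP p A → Nat.card A ≤ Nat.card S₀ := by
    intro A hA
    obtain ⟨g, hg⟩ := hS A hA
    rw [← card_conj_smul g]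
    exact Subgroup.card_le_of_le hg
  -- Descending induction on `|R|`, with `k` bounding `|S₀| - |R|`.
  have key : ∀ (k : ℕ) (R : Subgroup 𝒢.Completion), IsFinP p R →
      Nat.card S₀ ≤ Nat.card R + k → IsGood p R := by
    intro k
    induction k using Nat.strong_induction_on with
    | _ k ih =>
    intro R hR hk
    suffices h : ∀ R ≤ S₀, IsFinP p R → Nat.card S₀ ≤ Nat.card R + k → IsGood p R by
      obtain ⟨g, hg⟩ := hS R hR
      have h1 := (h _ hg (hR.conj g) (by rwa [card_conj_smul g R])).conj g⁻¹
      rwa [conj_inv_smul_smul] at h1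
    clear hR hk R
    intro R hRS hR hk
    have hmap := Subgroup.map_subgroupOf_eq_of_le hRS
    by_cases hcent : (groupFusion 𝒢.Completion S₀).IsCentric (R.subgroupOf S₀)
    · have h1 := (isCentric_iff_forall_le hSp hS).1 hcent
      have h2 := hb _ hcent
      rw [hmap] at h1 h2
      exact TreeOfGroups.isGood_of_isMultiTree hR h2 h1
    -- Hypothesis (a) in contrapositive form. Failure of centricity also supplies the `p`-subgroup
    -- of `C(R)` outside `R` that makes the reduction to a larger group possible.
    · have hne : 𝒢.IsNowhereEssential S R := fun v Q h hQ hess =>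
        hcent (ha _ ⟨v, Q, h, hess, hmap.trans hQ⟩)
      rw [isCentric_iff_forall_le hSp hS] at hcent
      push Not at hcent
      obtain ⟨A, hA, hAC, hAR⟩ := hcent
      rw [hmap] at hAC hAR
      refine isGood_of_isLinkConnected hR hcard (fun U hU hRU => ?_)
        (TreeOfGroups.isLinkConnected_of_isNowhereEssential hidx hne hR) hA hAC hAR
      have := hU.1
      have h1 := card_lt_of_lt hRU
      have h2 := hcard U hU
      exact ih (Nat.card S₀ - Nat.card U) (by omega) U hU (by omega)
  exact isSaturated_of_forall_isGood hSp hS fun R hR => key (Nat.card S₀) R hR (by omega)
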